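/- Let $m>0$ and let $\mathbb S^1=\mathbb R/2\pi\mathbb Z$ with coordinate $\theta$. Let $\mathcal D=C^\infty(\mathbb S^1,\mathbb R)\times C^\infty(\mathbb S^1,\mathbb R)$ be the space of Cauchy data $(\Phi,\Pi)$, with symplectic form $\delta((\Phi,\Pi),(\Phi',\Pi'))=\int_{\mathbb S^1}(\Phi\,\Pi'-\Phi'\,\Pi)\,d\theta$. Let $\mathcal R$ be the set of open connected nonempty $I\subset\mathbb S^1$ whose complement has nonempty interior, and for $I\in\mathcal R$ let $\mathcal D(I)$ be the set of Cauchy data supported in $I$. Let $\mathcal W$ be the Weyl $C^*$-algebra of $(\mathcal D,\delta)$, i.e. the nonzero $C^*$-algebra generated by elements $W(z)$, $z\in\mathcal D$, with $W(0)=1$, $W(-z)=W(z)^*$, $W(z)W(w)=e^{-i\delta(z,w)/2}W(z+w)$ (unique up to isomorphism), and let $\mathcal W(I)$ be its $C^*$-subalgebra generated by the $W(z)$ with $z\in\mathcal D(I)$. Let $A$ be the self-adjoint closure of $-\frac{d^2}{d\theta^2}+m^2$ on $L^2(\mathbb S^1,d\theta)$, and put $K(\Phi,\Pi)=2^{-1/2}(A^{1/4}\Phi+iA^{-1/4}\Pi)$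 and $\mu(z,w)=\mathrm{Re}\langle K z,K w\rangle$. Let $\mathfrak H_0$ be the symmetric Fock space over $L^2(\mathbb S^1,d\theta)$, with vacuum vector $\Psi_0$, annihilation operators $a(\psi)$ and creation operators $a^*(\psi)$ on the vectors with finitely many particles, and Weyl operators $W[\psi]=e^{\overline{a(\psi)-a^*(\psi)}}$. The vacuum state $\omega_0$ of $\mathcal W$ is determined by $\omega_0(W(z))=e^{-\frac12\langle Kz,Kz\rangle}$, and has GNS triple $(\mathfrak H_0,\pi_0,\Psi_0)$ with $\pi_0(W(z))=W[Kz]$. For a character $\chi$ of $\mathcal D$ (a group homomorphism from the additive group $\mathcal D$ to $U(1)$, not assumed continuous) let $\alpha_\chi$ be the $*$-automorphism of $\mathcal W$ with $\alpha_\chi(W(z))=\chi(z)W(z)$, and let $\omega_\chi=\omega_0\circ\alpha_\chi$; it has GNS triple $(\mathfrak H_0,\pi_\chi,\Psi_0)$ with $\pi_\chi(W(z))=\chi(z)\pi_0(W(z))$. Two states are called unitarily equivalent if their GNS representations are, and locally unitarily equivalent if for every $I\in\mathcal R$ the restrictions of their GNS representations to $\mathcal W(I)$ are. All these objects exist, and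 for all characters $\chi_1,\chi_2$ of $\mathcal D$ the following hold. (a) For every $I\in\mathcal R$ there is a unitary operator $U_I:\mathfrak H_0\to\mathfrak H_0$ with $U_I\pi_{\chi_1}(a)=\pi_{\chi_2}(a)U_I$ for all $a\in\mathcal W(I)$ if and only if $\chi_1\overline{\chi_2}$ is continuous on $\mathcal D(I)$ with respect to $\mu$. (b) $\omega_{\chi_1}$ is unitarily equivalent to $\omega_{\chi_2}$ if and only if $\chi_1\overline{\chi_2}$ is continuous on $\mathcal D$ with respect to $\mu$. (c) For real-valued $f\in L^2(\mathbb S^1,d\theta)$ and real-valued $g\in\mathrm{Dom}(A^{1/4})$, the characters $\chi_f(\Phi,\Pi)=e^{i\int f\Phi\,d\theta}$ and $\chi^{(g)}(\Phi,\Pi)=e^{-i\int g\Pi\,d\theta}$ induce states $\omega_{\chi_f}$ and $\omega_{\chi^{(g)}}$ unitarily equivalent to $\omega_0$, and for all $a\in\mathcal W$ $$\pi_{\chi_f}(a)=W[i\,2^{-1/2}A^{-1/4}f]\;\pi_0(a)\;W[i\,2^{-1/2}A^{-1/4}f]^*,\qquad \pi_{\chi^{(g)}}(a)=W[2^{-1/2}A^{1/4}g]\;\pi_0(a)\;W[2^{-1/2}A^{1/4}g]^*.$$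 (d) $\omega_{\chi_1}$ is unitarily equivalent to $\omega_{\chi_2}$ if and only if it is locally unitarily equivalent to $\omega_{\chi_2}$. -/

import Mathlib

open scoped InnerProductSpace ComplexOrder
open MeasureTheory Complex

noncomputable section

namespace KGCircle

/-! ## The circle, Cauchy data, proper intervals -/

instance instFactTwoPi : Fact (0 < 2 * Real.pi) := ⟨Real.two_pi_pos⟩

/-- The circle `ℝ / 2πℤ` with its standard coordinate `θ`; `volume` is `dθ`, of total mass `2π`. -/
abbrev S1 : Type := AddCircle (2 * Real.pi)

/-- `C^∞(S¹, ℝ)`: functions on the circle whose `2π`-periodic lift to `ℝ` is smooth. -/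
def SmoothFun : Submodule ℝ (S1 → ℝ) where
  carrier := {f | ContDiff ℝ (⊤ : ℕ∞) (fun x : ℝ => f (x : S1))}
  add_mem' := fun {f g} hf hg => by
    have hf' : ContDiff ℝ (⊤ : ℕ∞) (fun x : ℝ => f (x : S1)) := hf
    have hg' : ContDiff ℝ (⊤ : ℕ∞) (fun x : ℝ => g (x : S1)) := hg
    exact hf'.add hg'
  zero_mem' := by
    change ContDiff ℝ (⊤ : ℕ∞) (fun _ : ℝ => (0 : ℝ))
    exact contDiff_const
  smul_mem' := fun c f hf => by
    have hf' : ContDiff ℝ (⊤ : ℕ∞) (fun x : ℝ => f (x : S1)) := hf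
    exact contDiff_const.smul hf'

theorem smooth_continuous (f : SmoothFun) : Continuous (f : S1 → ℝ) := by
  have h : ContDiff ℝ (⊤ : ℕ∞) (fun x : ℝ => (f : S1 → ℝ) (x : S1)) := f.2
  exact (QuotientAddGroup.isQuotientMap_mk _).continuous_iff.mpr h.continuous

theorem smooth_memLp (f : SmoothFun) : MemLp (f : S1 → ℝ) 2 volume := by
  obtain ⟨C, hC⟩ := (isCompact_range (smooth_continuous f)).isBounded.exists_norm_le
  exact MemLp.of_bound (smooth_continuous f).aestronglyMeasurable C
    (Filter.Eventually.of_forall fun x => hC _ ⟨x, rfl⟩)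

/-- Cauchy data `(Φ, Π)` on the circle. -/
abbrev CauchyData : Type := SmoothFun × SmoothFun

/-- The symplectic form `∫ (Φ Π' - Φ' Π) dθ` on Cauchy data. -/
def symp (z w : CauchyData) : ℝ :=
  ∫ θ : S1, ((z.1 : S1 → ℝ) θ * (w.2 : S1 → ℝ) θ - (w.1 : S1 → ℝ) θ * (z.2 : S1 → ℝ) θ)

/-- Open proper intervals of the circle. -/
structure IsProperInterval (I : Set S1) : Prop where
  isOpen : IsOpen I
  isConnected : IsConnected I
  exterior_nonempty : (interior Iᶜ).Nonempty

/-- Cauchy data supported in `I`. -/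
def localData (I : Set S1) : Set CauchyData :=
  {z | tsupport (z.1 : S1 → ℝ) ⊆ I ∧ tsupport (z.2 : S1 → ℝ) ⊆ I}

/-! ## Weyl algebras -/

/-- `(𝔄, W)` is a Weyl algebra (CCR-representation) of `(V, σ)`. -/
structure IsWeylAlgebra {V : Type*} [AddCommGroup V] {𝔄 : Type*} [CStarAlgebra 𝔄]
    (σ : V → V → ℝ) (W : V → 𝔄) : Prop where
  map_zero : W 0 = 1
  map_neg : ∀ v, W (-v) = star (W v)
  map_mul : ∀ v w, W v * W w = Complex.exp (-(I * (σ v w : ℂ) / 2)) • W (v + w)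
  generates : (StarAlgebra.adjoin ℂ (Set.range W)).topologicalClosure = ⊤

/-- The local algebra of `I`: the C*-subalgebra generated by the `W(Φ, Π)` with `(Φ, Π)` supported
in `I`. -/
def localAlgebra {𝔄 : Type*} [CStarAlgebra 𝔄] (W : CauchyData → 𝔄) (I : Set S1) :
    StarSubalgebra ℂ 𝔄 :=
  (StarAlgebra.adjoin ℂ (W '' localData I)).topologicalClosure

/-! ## The one-particle space and the powers of `A = -d²/dθ² + m²` -/

/-- The complex Hilbert space `L²(S¹, dθ)`. -/
abbrev OneParticle : Type := Lp ℂ 2 (volume : Measure S1)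

/-- The class in `L²(S¹, dθ)` of a real square-integrable function. -/
def toL2 (f : S1 → ℝ) (hf : MemLp f 2 volume) : OneParticle :=
  MemLp.toLp (fun θ => (f θ : ℂ)) hf.ofReal

/-- The orthonormal basis `θ ↦ e^{ikθ} / √(2π)`, `k ∈ ℤ`, of `L²(S¹, dθ)`. -/
def mode (k : ℤ) : OneParticle :=
  ((Real.sqrt (2 * Real.pi))⁻¹ : ℂ) •
    ContinuousMap.toLp (E := ℂ) 2 (volume : Measure S1) ℂ (fourier k)

/-- The coordinates of `ψ` in the basis `mode`. -/
def coord (ψ : OneParticle) (k : ℤ) : ℂ := ⟪mode k, ψ⟫_ℂ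

/-- The domain of `A^α`. The self-adjoint operator `A` is diagonal in the basis `mode`, with
eigenvalues `k² + m²`. -/
def domA (m α : ℝ) : Set OneParticle :=
  {ψ | Summable fun k : ℤ => ‖((((k : ℝ) ^ 2 + m ^ 2) ^ α : ℝ) : ℂ) * coord ψ k‖ ^ 2}

/-- The operator `A^α` (meaningful on `domA m α`). -/
def powA (m α : ℝ) (ψ : OneParticle) : OneParticle :=
  ∑' k : ℤ, (((((k : ℝ) ^ 2 + m ^ 2) ^ α : ℝ) : ℂ) * coord ψ k) • mode k

/-- `K(Φ, Π) = 2^{-1/2} (A^{1/4} Φ + i A^{-1/4} Π)`. -/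
def K (m : ℝ) (z : CauchyData) : OneParticle :=
  ((Real.sqrt 2)⁻¹ : ℂ) •
    (powA m (1 / 4) (toL2 z.1 (smooth_memLp z.1)) + I • powA m (-(1 / 4)) (toL2 z.2 (smooth_memLp z.2)))

/-- The real scalar product `μ` on Cauchy data. -/
def mu (m : ℝ) (z w : CauchyData) : ℝ := (⟪K m z, K m w⟫_ℂ).re

/-- Continuity of the restriction of `χ` to `S`, with respect to the norm `√μ(z, z)`. -/
def MuContinuousOn (m : ℝ) (χ : CauchyData → ℂ) (S : Set CauchyData) : Prop :=
  ∀ z ∈ S, ∀ ε > 0, ∃ δ > 0, ∀ w ∈ S, Real.sqrt (mu m (w - z) (w - z)) < δ → ‖χ w - χ z‖ < ε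

/-! ## The symmetric Fock space and Weyl operators -/

/-- The symmetric Fock space over `L²(S¹, dθ)`. In the basis `mode`, the `n`-fold Hilbert tensor
power of `L²(S¹, dθ)` is `ℓ²(ℤⁿ)`, so the full Fock space is `ℓ²` of the finite words in `ℤ`, words
of length `n` giving the `n`-particle space; the symmetric Fock space consists of the vectors
invariant under permutation of the letters. -/
def fockSubmodule : Submodule ℂ (lp (fun _ : List ℤ => ℂ) 2) where
  carrier := {F | ∀ l l' : List ℤ, l.Perm l' → F l = F l'}
  add_mem' := fun {F G} hF hG l l' h => by
    change F l + G l = F l' + G l'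
    rw [hF l l' h, hG l l' h]
  zero_mem' := fun _ _ _ => rfl
  smul_mem' := fun c F hF l l' h => by
    change c • F l = c • F l'
    rw [hF l l' h]

theorem isClosed_fockSubmodule : IsClosed (fockSubmodule : Set (lp (fun _ : List ℤ => ℂ) 2)) := by
  have hc : ∀ l : List ℤ, Continuous fun F : lp (fun _ : List ℤ => ℂ) 2 => F l := fun l =>
    (continuous_apply l).comp (lp.uniformContinuous_coe (E := fun _ : List ℤ => ℂ)
      (p := 2)).continuous
  have : (fockSubmodule : Set (lp (fun _ : List ℤ => ℂ) 2)) =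
      ⋂ (l : List ℤ) (l' : List ℤ) (_ : l.Perm l'), {F | F l = F l'} := by
    ext F
    simp only [Set.mem_iInter]
    exact Iff.rfl
  rw [this]
  exact isClosed_iInter fun l => isClosed_iInter fun l' => isClosed_iInter fun _ =>
    isClosed_eq (hc l) (hc l')

abbrev Fock : Type := fockSubmodule

instance instCompleteSpaceFock : CompleteSpace Fock :=
  isClosed_fockSubmodule.completeSpace_coe

/-- The Fock vacuum. -/
def vacuum : Fock :=
  ⟨lp.single 2 ([] : List ℤ) (1 : ℂ), fun l l' h => by
    by_cases hl : l = []
    · subst hl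
      rw [h.nil_eq]
    · have hl' : l' ≠ [] := fun h' => hl (by subst h'; exact h.eq_nil)
      rw [lp.single_apply_ne _ _ _ hl, lp.single_apply_ne _ _ _ hl']⟩

/-- The annihilation operator `a(ψ)`, antilinear in `ψ`:
`(a(ψ)F)(k₁, …, kₙ) = √(n+1) ∑ₖ conj(ψₖ) F(k, k₁, …, kₙ)`. -/
def annihilation (ψ : OneParticle) (F : List ℤ → ℂ) (l : List ℤ) : ℂ :=
  (Real.sqrt (l.length + 1) : ℂ) * ∑' k : ℤ, star (coord ψ k) * F (k :: l)

/-- The creation operator `a*(ψ)`, linear in `ψ`: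
`(a*(ψ)F)(k₁, …, kₙ) = n^{-1/2} ∑ⱼ ψ_{kⱼ} F(k₁, …, kₙ without kⱼ)`. -/
def creation (ψ : OneParticle) (F : List ℤ → ℂ) (l : List ℤ) : ℂ :=
  ((Real.sqrt l.length)⁻¹ : ℂ) * ∑ j : Fin l.length, coord ψ (l.get j) * F (l.eraseIdx j)

/-- The graph of `a(ψ) - a*(ψ)`, defined on the vectors with finitely many particles. -/
def fieldGraph (ψ : OneParticle) : Set (Fock × Fock) :=
  {p | (∃ N : ℕ, ∀ l : List ℤ, N < l.length → p.1.1 l = 0) ∧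
    ∀ l : List ℤ, p.2.1 l = annihilation ψ p.1.1 l - creation ψ p.1.1 l}

/-- `U = e^T`, where `T` is the (unbounded, skew-adjoint) operator with graph `G`: `U` is the time-one
map of the strongly continuous one-parameter unitary group whose infinitesimal generator is `T`. -/
def IsUnitaryExp (G : Set (Fock × Fock)) (U : Fock →L[ℂ] Fock) : Prop :=
  ∃ V : ℝ → (Fock →L[ℂ] Fock),
    V 0 = 1 ∧ (∀ s t, V (s + t) = V s * V t) ∧ (∀ t, V t ∈ unitary (Fock →L[ℂ] Fock)) ∧
    (∀ x, Continuous fun t => V t x) ∧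
    (∀ x y, HasDerivAt (fun t => V t x) y 0 ↔ (x, y) ∈ G) ∧ V 1 = U

open Classical in
/-- The Weyl operator `W[ψ] = exp(closure of a(ψ) - a*(ψ))`. -/
def weylOp (ψ : OneParticle) : Fock →L[ℂ] Fock :=
  if h : ∃ U, IsUnitaryExp (closure (fieldGraph ψ)) U then h.choose else 1

/-! ## Characters -/

theorem integrable_mul_smooth {f : S1 → ℝ} (hf : MemLp f 2 volume) (Φ : SmoothFun) :
    Integrable (fun θ => f θ * (Φ : S1 → ℝ) θ) volume :=
  hf.integrable_mul (smooth_memLp Φ)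

/-- The character `χ_f(Φ, Π) = exp(i ∫ f Φ dθ)`. -/
def charLower (f : S1 → ℝ) (hf : MemLp f 2 volume) : AddChar CauchyData Circle where
  toFun z := Circle.exp (∫ θ, f θ * (z.1 : S1 → ℝ) θ)
  map_zero_eq_one' := by simp
  map_add_eq_mul' z w := by
    rw [← Circle.exp_add, ← integral_add (integrable_mul_smooth hf _) (integrable_mul_smooth hf _)]
    congr 2
    funext θ
    exact mul_add _ _ _

/-- The character `χ^{(g)}(Φ, Π) = exp(-i ∫ g Π dθ)`. -/
def charUpper (g : S1 → ℝ) (hg : MemLp g 2 volume) : AddChar CauchyData Circle where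
  toFun z := Circle.exp (-∫ θ, g θ * (z.2 : S1 → ℝ) θ)
  map_zero_eq_one' := by simp
  map_add_eq_mul' z w := by
    rw [← Circle.exp_add, ← neg_add,
      ← integral_add (integrable_mul_smooth hg _) (integrable_mul_smooth hg _)]
    congr 3
    funext θ
    exact mul_add _ _ _

/-- The function `χ₁ · conj χ₂`. -/
def quotChar (χ₁ χ₂ : AddChar CauchyData Circle) (z : CauchyData) : ℂ :=
  (χ₁ z : ℂ) * star (χ₂ z : ℂ)

/-! ## GNS triples and unitary equivalence of states -/

/-- `(H, π, Ψ)` is a GNS triple of `φ`. -/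
structure IsGNSTriple {𝔄 : Type*} [CStarAlgebra 𝔄] {H : Type*} [NormedAddCommGroup H]
    [InnerProductSpace ℂ H] [CompleteSpace H] (φ : 𝔄 → ℂ) (π : 𝔄 →⋆ₐ[ℂ] (H →L[ℂ] H)) (Ψ : H) :
    Prop where
  expectation : ∀ a, φ a = ⟪Ψ, π a Ψ⟫_ℂ
  cyclic : Dense (Set.range fun a => π a Ψ)

/-- The restrictions to `S` of the GNS representations of `φ` and `ψ` are unitarily equivalent. -/
def UnitarilyEquivalentOn {𝔄 : Type*} [CStarAlgebra 𝔄] [PartialOrder 𝔄] [StarOrderedRing 𝔄]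
    (S : Set 𝔄) (φ ψ : 𝔄 →ₚ[ℂ] ℂ) : Prop :=
  ∃ U : φ.GNS ≃ₗᵢ[ℂ] ψ.GNS, ∀ a ∈ S, ∀ x, U (φ.gnsStarAlgHom a x) = ψ.gnsStarAlgHom a (U x)

/-- Unitary equivalence of states. -/
def UnitarilyEquivalent {𝔄 : Type*} [CStarAlgebra 𝔄] [PartialOrder 𝔄] [StarOrderedRing 𝔄]
    (φ ψ : 𝔄 →ₚ[ℂ] ℂ) : Prop :=
  UnitarilyEquivalentOn Set.univ φ ψ

/-- Local unitary equivalence of states. -/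
def LocallyUnitarilyEquivalent {𝔄 : Type*} [CStarAlgebra 𝔄] [PartialOrder 𝔄] [StarOrderedRing 𝔄]
    (W : CauchyData → 𝔄) (φ ψ : 𝔄 →ₚ[ℂ] ℂ) : Prop :=
  ∀ I, IsProperInterval I → UnitarilyEquivalentOn (localAlgebra W I : Set 𝔄) φ ψ

end KGCircle

end

namespace KGCircle

/-! ## Uniqueness of the Weyl algebra -/

section WeylUniqueness

open scoped Pointwise

/-! Everything rests on three mechanisms.

Algebra: representations and gauge automorphisms must be defined on an arbitrary C*-algebra
generated by Weyl elements. Since the symplectic form is nondegenerate, each coefficient of a finite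
sum of Weyl elements is bounded by the norm of the sum, which compares the norms of the same sum in
two Weyl systems up to the number of terms. Applied to high powers of `star a * a`, whose supports
grow only polynomially, the comparison becomes sharp (`SameCombination.norm_le_norm`), and every
Weyl system extends to a *-homomorphism (`IsWeylAlgebra.exists_starAlgHom`).

Fock space: the coherent vectors are total and satisfy `⟪e φ, e ψ⟫ = exp ⟪φ, ψ⟫`. These two
properties, `IsExponential`, suffice to construct Weyl operators, their relations and their strong
continuity. The operators obtained are the exponentials of `a(ψ) - a*(ψ)` because the closed field
operator is the whole generator of the group `t ↦ weyl e (tψ)`, and a unitary group is determined by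
its generator (`weylOp_eq`). `K` has dense range and `Im ⟪K z, K w⟫` is half the symplectic form, so
`z ↦ weyl e (K m z)` is a Weyl system with cyclic vacuum.

Intertwiners: strong continuity forces the quotient of two intertwined characters to be
`μ`-continuous. Conversely, a continuous character of a real normed space lifts to a continuous
linear functional, which Hahn-Banach and Riesz represent by a vector `η`; conjugation by a Weyl
operator multiplies each Weyl operator by the corresponding phase. This argument on a subspace of
data (`IsExponential.exists_intertwiner_iff`) gives (a) and (b), and explicit vectors `η` give (c).

For (d), multiplication by a smooth function is bounded for the norm of `K`: it is a convolution of
Fourier coefficients with rapidly decaying kernel, against slowly varying weights. A partition of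
unity subordinate to two proper intervals then makes a locally continuous character continuous
(`muContinuousOn_univ_of_local`). -/

/-- The Weyl relations over a symplectic form, without a generation requirement. -/
structure IsWeylSystem {V : Type*} [AddCommGroup V] {𝔄 : Type*} [CStarAlgebra 𝔄]
    (σ : V → V → ℝ) (W : V → 𝔄) : Prop where
  map_zero : W 0 = 1
  map_neg : ∀ v, W (-v) = star (W v)
  map_mul : ∀ v w, W v * W w = Complex.exp (-(I * (σ v w : ℂ) / 2)) • W (v + w)

theorem IsWeylAlgebra.isWeylSystem {V : Type*} [AddCommGroup V] {𝔄 : Type*} [CStarAlgebra 𝔄]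
    {σ : V → V → ℝ} {W : V → 𝔄} (hW : IsWeylAlgebra σ W) : IsWeylSystem σ W :=
  ⟨hW.map_zero, hW.map_neg, hW.map_mul⟩

variable {V : Type*} [AddCommGroup V] [Module ℝ V] {𝔄 𝔅 : Type*} [CStarAlgebra 𝔄]
  [CStarAlgebra 𝔅] {σ : V →ₗ[ℝ] V →ₗ[ℝ] ℝ} {W : V → 𝔄} {U : V → 𝔅}

namespace IsWeylSystem

theorem star_mul_self (hσ : σ.IsAlt) (hW : IsWeylSystem (fun v w => σ v w) W) (v : V) :
    star (W v) * W v = 1 := by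
  rw [← hW.map_neg, hW.map_mul]
  simp [hσ v, hW.map_zero]

theorem norm_le_one (hσ : σ.IsAlt) (hW : IsWeylSystem (fun v w => σ v w) W) (v : V) :
    ‖W v‖ ≤ 1 := by
  have h : ‖W v‖ * ‖W v‖ ≤ 1 := by
    rw [← CStarRing.norm_star_mul_self, hW.star_mul_self hσ]
    rcases subsingleton_or_nontrivial 𝔄 with h | h
    · simp [Subsingleton.elim (1 : 𝔄) 0]
    · simp
  nlinarith [norm_nonneg (W v)]

theorem mul_mul_neg (hσ : σ.IsAlt) (hW : IsWeylSystem (fun v w => σ v w) W) (u v : V) :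
    W u * W v * W (-u) = Complex.exp (-(I * (σ u v : ℂ))) • W v := by
  rw [hW.map_mul, smul_mul_assoc, hW.map_mul, smul_smul, ← Complex.exp_add]
  have h : σ v u = -σ u v := (hσ.neg u v).symm
  have h2 : u + v + -u = v := by abel
  have h3 : σ (u + v) (-u) = σ u v := by
    rw [_root_.map_neg, _root_.map_add, LinearMap.add_apply, hσ u, h]
    ring
  rw [h2, h3]
  congr 2
  ring

/-- Averaging the sum with its conjugate by a suitable `W u` does not increase the norm, fixes the
constant term and kills one chosen nonzero index; the indices are removed one by one. -/
theorem norm_coeff_zero_le [Nontrivial 𝔄] (hσ : σ.IsAlt) (hnd : ∀ v, v ≠ 0 → ∃ u, σ u v ≠ 0)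
    (hW : IsWeylSystem (fun v w => σ v w) W) (S : Finset V) :
    ∀ c : V → ℂ, 0 ∉ S → ‖c 0‖ ≤ ‖c 0 • (1 : 𝔄) + ∑ v ∈ S, c v • W v‖ := by
  classical
  induction S using Finset.induction_on with
  | empty => intro c _; simp [norm_smul]
  | insert v S hv ih =>
    intro c h0
    rw [Finset.mem_insert, not_or] at h0
    obtain ⟨u₀, hu₀⟩ := hnd v (Ne.symm h0.1)
    -- The scaling makes `σ u v = π`, so that conjugation by `W u` changes the sign of `W v`.
    set u : V := (Real.pi / σ u₀ v) • u₀ with hu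
    have huv : σ u v = Real.pi := by
      rw [hu, map_smul, LinearMap.smul_apply, smul_eq_mul]
      field_simp
    set k : V → ℂ := fun w => (1 + Complex.exp (-(I * (σ u w : ℂ)))) / 2 with hk
    have hk0 : k 0 = 1 := by simp [hk]
    have hkv : k v = 0 := by
      simp only [hk, huv]
      rw [mul_comm, Complex.exp_neg, Complex.exp_pi_mul_I]
      norm_num
    set X : 𝔄 := c 0 • (1 : 𝔄) + ∑ v ∈ insert v S, c v • W v with hX
    have key : (k 0 * c 0) • (1 : 𝔄) + ∑ w ∈ S, (k w * c w) • W w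
        = (1 / 2 : ℂ) • (X + W u * X * W (-u)) := by
      have e1 : W u * X * W (-u) = c 0 • (1 : 𝔄) +
          ∑ w ∈ insert v S, (Complex.exp (-(I * (σ u w : ℂ))) * c w) • W w := by
        rw [hX, mul_add, add_mul, Finset.mul_sum, Finset.sum_mul]
        congr 1
        · rw [mul_smul_comm, mul_one, smul_mul_assoc]
          congr 1
          have := hW.mul_mul_neg hσ u 0
          rw [hW.map_zero, mul_one] at this
          simpa using this
        · refine Finset.sum_congr rfl fun w _ => ?_
          rw [mul_smul_comm, smul_mul_assoc, hW.mul_mul_neg hσ, smul_smul, mul_comm]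
      have e2 : ∑ w ∈ S, (k w * c w) • W w = ∑ w ∈ insert v S, (k w * c w) • W w := by
        rw [Finset.sum_insert hv, hkv]
        simp
      rw [e2, e1, hX, hk0, smul_add, smul_add, smul_add, Finset.smul_sum, Finset.smul_sum]
      have e3 : ∀ w, (k w * c w) • W w = (1 / 2 : ℂ) • c w • W w +
          (1 / 2 : ℂ) • (Complex.exp (-(I * (σ u w : ℂ))) * c w) • W w := fun w => by
        rw [smul_smul, smul_smul, ← add_smul]
        congr 1
        simp only [hk]
        ring
      simp only [e3, Finset.sum_add_distrib]
      module
    have h1 := ih (fun w => k w * c w) h0.2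
    rw [key, hk0, one_mul] at h1
    refine h1.trans ?_
    have h2 : ‖W u * X * W (-u)‖ ≤ ‖X‖ := by
      calc ‖W u * X * W (-u)‖ ≤ ‖W u‖ * ‖X‖ * ‖W (-u)‖ := norm_mul₃_le
        _ ≤ 1 * ‖X‖ * 1 := by
          gcongr
          exacts [hW.norm_le_one hσ u, hW.norm_le_one hσ _]
        _ = ‖X‖ := by ring
    rw [norm_smul]
    have h3 := norm_add_le X (W u * X * W (-u))
    norm_num
    linarith

/-- Multiplication by `W (-v)` moves the index `v` to `0`; the coefficients `d` absorb the phases of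
the Weyl relation. -/
theorem norm_coeff_le [Nontrivial 𝔄] (hσ : σ.IsAlt) (hnd : ∀ v, v ≠ 0 → ∃ u, σ u v ≠ 0)
    (hW : IsWeylSystem (fun v w => σ v w) W) (S : Finset V) (c : V → ℂ) {v : V} (hv : v ∈ S) :
    ‖c v‖ ≤ ‖∑ w ∈ S, c w • W w‖ := by
  classical
  set d : V → ℂ := fun w => Complex.exp (-(I * (σ (-v) (v + w) : ℂ) / 2)) * c (v + w) with hd
  have hd0 : d 0 = c v := by simp [hd, hσ v]
  have h1 := hW.norm_coeff_zero_le hσ hnd ((S.erase v).image (fun w => -v + w)) d (by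
    simp only [Finset.mem_image, Finset.mem_erase, not_exists, not_and]
    rintro w ⟨hw, -⟩ h
    exact hw (by rw [neg_add_eq_zero] at h; exact h.symm))
  have h2 : d 0 • (1 : 𝔄) + ∑ w ∈ (S.erase v).image (fun w => -v + w), d w • W w
      = W (-v) * ∑ w ∈ S, c w • W w := by
    rw [Finset.sum_image (fun a _ b _ h => add_left_cancel h), Finset.mul_sum,
      ← Finset.add_sum_erase S _ hv]
    congr 1
    · rw [mul_smul_comm, hW.map_neg, hW.star_mul_self hσ, hd0]
    · refine Finset.sum_congr rfl fun w _ => ?_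
      rw [mul_smul_comm, hW.map_mul, smul_smul]
      simp only [hd, add_neg_cancel_left]
      rw [mul_comm]
  rw [h2, hd0] at h1
  calc ‖c v‖ ≤ ‖W (-v) * ∑ w ∈ S, c w • W w‖ := h1
    _ ≤ ‖W (-v)‖ * ‖∑ w ∈ S, c w • W w‖ := norm_mul_le _ _
    _ ≤ 1 * ‖∑ w ∈ S, c w • W w‖ := by gcongr; exact hW.norm_le_one hσ _
    _ = _ := one_mul _

end IsWeylSystem

/-! ### Norm comparison between two Weyl systems -/

/-- `a` and `b` are the same linear combination, with indices in `S`, of two families. -/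
def SameCombination (W : V → 𝔄) (U : V → 𝔅) (S : Finset V) (a : 𝔄) (b : 𝔅) : Prop :=
  ∃ c : V → ℂ, a = ∑ v ∈ S, c v • W v ∧ b = ∑ v ∈ S, c v • U v

-- The coefficients of the product involve only `c`, `d` and `σ`, not the family itself. This makes
-- `SameCombination` stable under products.
open Classical in
theorem IsWeylSystem.sum_mul_sum (hW : IsWeylSystem (fun v w => σ v w) W) (S T : Finset V)
    (c d : V → ℂ) : (∑ v ∈ S, c v • W v) * (∑ v ∈ T, d v • W v) = ∑ x ∈ S + T,
      (∑ p ∈ S ×ˢ T with p.1 + p.2 = x, c p.1 * d p.2 *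
        Complex.exp (-(I * (σ p.1 p.2 : ℂ) / 2))) • W x := by
  rw [Finset.sum_mul_sum, ← Finset.sum_product', ← Finset.sum_fiberwise_of_maps_to
    (s := S ×ˢ T) (t := S + T) (g := fun p => p.1 + p.2)]
  · refine Finset.sum_congr rfl fun x _ => ?_
    rw [Finset.sum_smul]
    refine Finset.sum_congr rfl fun p hp => ?_
    rw [smul_mul_smul_comm, hW.map_mul, smul_smul, (Finset.mem_filter.1 hp).2]
  · intro p hp
    rw [Finset.mem_product] at hp
    exact Finset.add_mem_add hp.1 hp.2

open Classical in
theorem IsWeylSystem.star_sum (hW : IsWeylSystem (fun v w => σ v w) W) (S : Finset V)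
    (c : V → ℂ) : star (∑ v ∈ S, c v • W v) = ∑ x ∈ -S, star (c (-x)) • W x := by
  rw [_root_.star_sum, ← Finset.image_neg_eq_neg,
    Finset.sum_image (fun a _ b _ h => neg_injective h)]
  refine Finset.sum_congr rfl fun v _ => ?_
  rw [star_smul, hW.map_neg, neg_neg]

open Classical in
theorem SameCombination.mul (hW : IsWeylSystem (fun v w => σ v w) W)
    (hU : IsWeylSystem (fun v w => σ v w) U) {S T : Finset V} {a a' : 𝔄} {b b' : 𝔅}
    (h : SameCombination W U S a b) (h' : SameCombination W U T a' b') :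
    SameCombination W U (S + T) (a * a') (b * b') := by
  obtain ⟨c, rfl, rfl⟩ := h
  obtain ⟨d, rfl, rfl⟩ := h'
  exact ⟨_, hW.sum_mul_sum S T c d, hU.sum_mul_sum S T c d⟩

open Classical in
theorem SameCombination.star (hW : IsWeylSystem (fun v w => σ v w) W)
    (hU : IsWeylSystem (fun v w => σ v w) U) {S : Finset V} {a : 𝔄} {b : 𝔅}
    (h : SameCombination W U S a b) : SameCombination W U (-S) (star a) (star b) := by
  obtain ⟨c, rfl, rfl⟩ := h
  exact ⟨_, hW.star_sum S c, hU.star_sum S c⟩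

open Classical in
theorem SameCombination.pow (hW : IsWeylSystem (fun v w => σ v w) W)
    (hU : IsWeylSystem (fun v w => σ v w) U) {S : Finset V} {a : 𝔄} {b : 𝔅}
    (h : SameCombination W U S a b) (n : ℕ) : SameCombination W U (n • S) (a ^ n) (b ^ n) := by
  induction n with
  | zero =>
    rw [zero_nsmul, ← Finset.singleton_zero]
    exact ⟨fun _ => 1, by simp [hW.map_zero], by simp [hU.map_zero]⟩
  | succ n ih =>
    rw [succ_nsmul, pow_succ, pow_succ]
    exact ih.mul hW hU h

/-- A crude bound: every coefficient is at most `‖a‖` and every `U v` has norm at most one. The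
cardinality factor is removed later by passing to powers. -/
theorem SameCombination.norm_le [Nontrivial 𝔄] (hσ : σ.IsAlt)
    (hnd : ∀ v, v ≠ 0 → ∃ u, σ u v ≠ 0) (hW : IsWeylSystem (fun v w => σ v w) W)
    (hU : IsWeylSystem (fun v w => σ v w) U) {S : Finset V} {a : 𝔄} {b : 𝔅}
    (h : SameCombination W U S a b) : ‖b‖ ≤ S.card * ‖a‖ := by
  obtain ⟨c, rfl, rfl⟩ := h
  rw [← nsmul_eq_mul]
  refine (norm_sum_le _ _).trans (Finset.sum_le_card_nsmul _ _ _ fun v hv => ?_)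
  rw [norm_smul]
  calc ‖c v‖ * ‖U v‖ ≤ ‖c v‖ * 1 := by gcongr; exact hU.norm_le_one hσ v
    _ ≤ _ := by rw [mul_one]; exact hW.norm_coeff_le hσ hnd S c hv

open Classical in
/-- Polynomial growth of sumsets in commutative groups. -/
theorem card_nsmul_le_pow {G : Type*} [AddCommGroup G] (S : Finset G) (n : ℕ) :
    (n • S).card ≤ (n + 1) ^ S.card := by
  -- By commutativity an `n`-fold sum depends only on the multiplicities of its summands, each of
  -- which is at most `n`.
  have hmem : ∀ n : ℕ, ∀ x ∈ n • S, ∃ f : G → ℕ, (∀ s, f s ≤ n) ∧ x = ∑ s ∈ S, f s • s := by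
    intro n
    induction n with
    | zero =>
      intro x hx
      refine ⟨fun _ => 0, fun _ => le_rfl, ?_⟩
      simpa using hx
    | succ n ih =>
      intro x hx
      rw [succ_nsmul] at hx
      obtain ⟨y, hy, s, hs, rfl⟩ := Finset.mem_add.1 hx
      obtain ⟨f, hf, rfl⟩ := ih y hy
      refine ⟨fun t => f t + if t = s then 1 else 0, fun t => ?_, ?_⟩
      · have := hf t
        beta_reduce
        split_ifs <;> omega
      · simp [add_smul, Finset.sum_add_distrib, ite_smul, hs]
  have hsub : n • S ⊆ (Fintype.piFinset fun _ : S => Finset.range (n + 1)).image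
      (fun f => ∑ s : S, f s • (s : G)) := by
    intro x hx
    obtain ⟨f, hf, rfl⟩ := hmem n x hx
    refine Finset.mem_image.2 ⟨fun s => f s, ?_, ?_⟩
    · simp only [Fintype.mem_piFinset, Finset.mem_range]
      exact fun s => Nat.lt_succ_of_le (hf s)
    · exact Finset.sum_coe_sort S fun s => f s • s
  refine (Finset.card_le_card hsub).trans (Finset.card_image_le.trans ?_)
  simp

/-- If `x > y`, then `(x / y) ^ n` eventually beats the polynomial factor. -/
theorem le_of_pow_two_pow_le_mul {x y : ℝ} (hy : 0 ≤ y) (r : ℕ)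
    (h : ∀ k : ℕ, x ^ 2 ^ k ≤ ((2 ^ k : ℕ) + 1 : ℝ) ^ r * y ^ 2 ^ k) : x ≤ y := by
  by_contra hlt
  push Not at hlt
  rcases hy.eq_or_lt with rfl | hy
  · have := h 0
    simp at this
    linarith
  have hρ : 1 < x / y := by rwa [one_lt_div hy]
  have hx0 : 0 < x := hy.trans hlt
  have hlim := tendsto_pow_const_div_const_pow_of_one_lt r hρ
  -- The limit is used at the exponent `2 ^ k + 1`, which matches the base of the polynomial factor;
  -- the threshold `y / x` cancels the one extra factor `x / y`.
  obtain ⟨N, hN⟩ := Filter.eventually_atTop.1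
    (hlim.eventually_lt_const (show 0 < y / x by positivity))
  obtain ⟨k, hkN⟩ : ∃ k : ℕ, N ≤ 2 ^ k + 1 := ⟨N, (Nat.lt_two_pow_self.le).trans (Nat.le_succ _)⟩
  have hk := hN _ hkN
  have h1 := h k
  rw [div_lt_iff₀ (by positivity), pow_succ (x / y), div_pow] at hk
  have e : y / x * (x ^ 2 ^ k / y ^ 2 ^ k * (x / y)) = x ^ 2 ^ k / y ^ 2 ^ k := by
    field_simp
  rw [e, lt_div_iff₀ (by positivity)] at hk
  push_cast at hk h1
  linarith

/-- For the self-adjoint elements `star a * a` and `star b * b` the norm of a `2 ^ k`-th power is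
the power of the norm. The crude bound for these powers costs only the cardinality of a `2 ^ k`-fold
sumset, polynomial in `2 ^ k`, which disappears on taking roots. -/
theorem SameCombination.norm_le_norm [Nontrivial 𝔄] (hσ : σ.IsAlt)
    (hnd : ∀ v, v ≠ 0 → ∃ u, σ u v ≠ 0) (hW : IsWeylSystem (fun v w => σ v w) W)
    (hU : IsWeylSystem (fun v w => σ v w) U) {S : Finset V} {a : 𝔄} {b : 𝔅}
    (h : SameCombination W U S a b) : ‖b‖ ≤ ‖a‖ := by
  classical
  have hT := (h.star hW hU).mul hW hU h
  have hle : ‖Star.star b * b‖ ≤ ‖Star.star a * a‖ := by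
    refine le_of_pow_two_pow_le_mul (norm_nonneg _) (-S + S).card fun k => ?_
    have h1 := (hT.pow hW hU (2 ^ k)).norm_le hσ hnd hW hU
    have h2 : ‖(Star.star b * b) ^ 2 ^ k‖ = ‖Star.star b * b‖ ^ 2 ^ k :=
      congrArg NNReal.toReal ((IsSelfAdjoint.star_mul_self b).nnnorm_pow_two_pow k)
    have h3 : ‖(Star.star a * a) ^ 2 ^ k‖ = ‖Star.star a * a‖ ^ 2 ^ k :=
      congrArg NNReal.toReal ((IsSelfAdjoint.star_mul_self a).nnnorm_pow_two_pow k)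
    rw [h2, h3] at h1
    refine h1.trans ?_
    gcongr
    exact_mod_cast card_nsmul_le_pow (-S + S) (2 ^ k)
  rw [CStarRing.norm_star_mul_self, CStarRing.norm_star_mul_self] at hle
  exact (mul_self_le_mul_self_iff (norm_nonneg _) (norm_nonneg _)).2 hle

/-! ### Universal property and gauge automorphisms -/

theorem IsWeylAlgebra.dense_span {V : Type*} [AddCommGroup V] {W : V → 𝔄} {σ : V → V → ℝ}
    (hW : IsWeylAlgebra σ W) : Dense (Submodule.span ℂ (Set.range W) : Set 𝔄) := by
  have hsub : (StarAlgebra.adjoin ℂ (Set.range W) : Set 𝔄) ⊆ Submodule.span ℂ (Set.range W) := by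
    intro a ha
    -- By the Weyl relations the linear span is already closed under products and adjoints, so the
    -- generated star algebra adds nothing to it.
    have ha' : a ∈ (StarAlgebra.adjoin ℂ (Set.range W)).toSubalgebra := ha
    rw [StarAlgebra.adjoin_toSubalgebra, ← Subalgebra.mem_toSubmodule,
      Algebra.adjoin_eq_span] at ha'
    refine Submodule.span_le.2 (fun x hx => ?_) ha'
    refine Submonoid.closure_induction
      (motive := fun x _ => x ∈ Submodule.span ℂ (Set.range W)) ?_ ?_ ?_ hx
    · rintro x (⟨v, rfl⟩ | ⟨v, hv⟩)
      · exact Submodule.subset_span ⟨v, rfl⟩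
      · refine Submodule.subset_span ⟨-v, ?_⟩
        rw [hW.map_neg, hv, star_star]
    · exact Submodule.subset_span ⟨0, hW.map_zero⟩
    · intro x y _ _ hx hy
      refine Submodule.span_induction₂ (p := fun x y _ _ => x * y ∈ Submodule.span ℂ (Set.range W))
        ?_ ?_ ?_ ?_ ?_ ?_ ?_ hx hy
      · rintro _ _ ⟨v, rfl⟩ ⟨w, rfl⟩
        rw [hW.map_mul]
        exact Submodule.smul_mem _ _ (Submodule.subset_span ⟨_, rfl⟩)
      · simp
      · simp
      · intro x y z _ _ _ h1 h2
        rw [add_mul]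
        exact add_mem h1 h2
      · intro x y z _ _ _ h1 h2
        rw [mul_add]
        exact add_mem h1 h2
      · intro r x y _ _ h
        rw [smul_mul_assoc]
        exact Submodule.smul_mem _ _ h
      · intro r x y _ _ h
        rw [mul_smul_comm]
        exact Submodule.smul_mem _ _ h
  have hd : Dense (StarAlgebra.adjoin ℂ (Set.range W) : Set 𝔄) := by
    rw [dense_iff_closure_eq, ← StarSubalgebra.topologicalClosure_coe, hW.generates]
    rfl
  exact hd.mono hsub

/-- The universal property of the Weyl algebra of a nondegenerate symplectic form. -/
theorem IsWeylAlgebra.exists_starAlgHom [Nontrivial 𝔄] (hσ : σ.IsAlt)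
    (hnd : ∀ v, v ≠ 0 → ∃ u, σ u v ≠ 0) (hW : IsWeylAlgebra (fun v w => σ v w) W)
    (hU : IsWeylSystem (fun v w => σ v w) U) : ∃ π : 𝔄 →⋆ₐ[ℂ] 𝔅, ∀ v, π (W v) = U v := by
  have hdense : DenseRange (Finsupp.linearCombination ℂ W) := by
    have := hW.dense_span
    rw [← Finsupp.range_linearCombination] at this
    exact this
  -- This inequality gives both independence of the chosen linear combination and continuity, hence
  -- the extension to the closure.
  have hbound : ∀ c : V →₀ ℂ,
      ‖Finsupp.linearCombination ℂ U c‖ ≤ 1 * ‖Finsupp.linearCombination ℂ W c‖ := fun c => by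
    rw [one_mul]
    exact SameCombination.norm_le_norm hσ hnd hW.isWeylSystem hU (S := c.support) ⟨c, rfl, rfl⟩
  set π : 𝔄 →L[ℂ] 𝔅 :=
    (Finsupp.linearCombination ℂ U).extendOfNorm (Finsupp.linearCombination ℂ W)
  have hπ : ∀ v, π (W v) = U v := fun v => by
    have := LinearMap.extendOfNorm_eq hdense ⟨1, hbound⟩ (Finsupp.single v 1)
    simpa [Finsupp.linearCombination_single] using this
  -- Multiplicativity is extended by density in one factor at a time, with a Weyl element on the
  -- left first.
  have hmul1 : ∀ v x, π (W v * x) = U v * π x := fun v x => by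
    have : π ∘L ContinuousLinearMap.mul ℂ 𝔄 (W v) = ContinuousLinearMap.mul ℂ 𝔅 (U v) ∘L π := by
      refine ContinuousLinearMap.ext_on hW.dense_span ?_
      rintro _ ⟨w, rfl⟩
      simp [hW.map_mul, hU.map_mul, hπ]
    exact DFunLike.congr_fun this x
  have hmul : ∀ x y, π (x * y) = π x * π y := fun x y => by
    have : π ∘L (ContinuousLinearMap.mul ℂ 𝔄).flip y
        = (ContinuousLinearMap.mul ℂ 𝔅).flip (π y) ∘L π := by
      refine ContinuousLinearMap.ext_on hW.dense_span ?_
      rintro _ ⟨w, rfl⟩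
      simp [hmul1, hπ]
    exact DFunLike.congr_fun this x
  have hone : π 1 = 1 := by rw [← hW.map_zero, hπ, hU.map_zero]
  have hstar : ∀ x, π (star x) = star (π x) := by
    have h2 : ∀ x, star (π (star x)) = π x := fun x => by
      have : ((starL ℂ : 𝔅 ≃L⋆[ℂ] 𝔅) : 𝔅 →L⋆[ℂ] 𝔅) ∘SL
          (π ∘SL ((starL ℂ : 𝔄 ≃L⋆[ℂ] 𝔄) : 𝔄 →L⋆[ℂ] 𝔄)) = π := by
        refine ContinuousLinearMap.ext_on hW.dense_span ?_
        rintro _ ⟨w, rfl⟩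
        simp [← hW.map_neg, hπ, hU.map_neg]
      exact DFunLike.congr_fun this x
    intro x
    rw [← h2 x, star_star]
  exact ⟨{ toFun := π
           map_one' := hone
           map_mul' := hmul
           map_zero' := π.map_zero
           map_add' := π.map_add
           commutes' := fun r => by simp [Algebra.algebraMap_eq_smul_one, hone]
           map_star' := hstar }, hπ⟩

theorem IsWeylAlgebra.starAlgHom_ext {V : Type*} [AddCommGroup V] {W : V → 𝔄} {σ : V → V → ℝ}
    (hW : IsWeylAlgebra σ W) {π ρ : 𝔄 →⋆ₐ[ℂ] 𝔅} (h : ∀ v, π (W v) = ρ (W v)) : π = ρ := by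
  have hc : ∀ π : 𝔄 →⋆ₐ[ℂ] 𝔅, Continuous π := fun π =>
    AddMonoidHomClass.continuous_of_bound π 1 fun x => by
      rw [one_mul]
      exact NonUnitalStarAlgHom.norm_apply_le π x
  ext x
  have hcl : IsClosed {x | π x = ρ x} := isClosed_eq (hc π) (hc ρ)
  refine hcl.closure_subset_iff.2 ?_ (hW.dense_span x)
  intro y hy
  induction hy using Submodule.span_induction with
  | mem y hy => obtain ⟨v, rfl⟩ := hy; exact h v
  | zero => simp
  | add a b _ _ ha hb => simp only [Set.mem_ofPred_eq, map_add] at *; rw [ha, hb]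
  | smul c a _ ha => simp only [Set.mem_ofPred_eq, map_smul] at *; rw [ha]

/-- The gauge automorphism of a character. -/
theorem IsWeylAlgebra.exists_gauge [Nontrivial 𝔄] (hσ : σ.IsAlt)
    (hnd : ∀ v, v ≠ 0 → ∃ u, σ u v ≠ 0) (hW : IsWeylAlgebra (fun v w => σ v w) W)
    (χ : AddChar V Circle) : ∃ α : 𝔄 ≃⋆ₐ[ℂ] 𝔄, ∀ v, α (W v) = (χ v : ℂ) • W v := by
  -- Twisting by a character preserves the Weyl relations, so the universal property applies to `χ`
  -- and, for the inverse map, to `χ⁻¹`.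
  have hsys : ∀ χ : AddChar V Circle,
      IsWeylSystem (fun v w => σ v w) fun v => (χ v : ℂ) • W v := fun χ =>
    ⟨by simp [hW.map_zero], fun v => by
      rw [star_smul, hW.map_neg, AddChar.map_neg_eq_inv, Circle.coe_inv_eq_conj]; rfl, fun v w => by
      rw [smul_mul_smul_comm, hW.map_mul, AddChar.map_add_eq_mul, Circle.coe_mul,
        smul_comm]⟩
  obtain ⟨f, hf⟩ := hW.exists_starAlgHom hσ hnd (hsys χ)
  obtain ⟨g, hg⟩ := hW.exists_starAlgHom hσ hnd (hsys χ⁻¹)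
  have hc : ∀ v, (χ v : ℂ) * (χ (-v) : ℂ) = 1 := fun v => by
    rw [← Circle.coe_mul, AddChar.map_neg_eq_inv, mul_inv_cancel, Circle.coe_one]
  refine ⟨StarAlgEquiv.ofStarAlgHom f g ?_ ?_, hf⟩
  · refine hW.starAlgHom_ext fun v => ?_
    simp [hf, hg, smul_smul, hc]
  · refine hW.starAlgHom_ext fun v => ?_
    simp [hf, hg, smul_smul, hc, mul_comm]

end WeylUniqueness
end KGCircle

namespace KGCircle

/-! ## Exponential vectors in an abstract Hilbert space -/

/-- `e` is a total family of exponential vectors over `E`. -/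
structure IsExponential {E H : Type*} [NormedAddCommGroup E] [InnerProductSpace ℂ E]
    [NormedAddCommGroup H] [InnerProductSpace ℂ H] (e : E → H) : Prop where
  inner_eq : ∀ φ ψ, ⟪e φ, e ψ⟫_ℂ = Complex.exp ⟪φ, ψ⟫_ℂ
  dense_span : Dense (Submodule.span ℂ (Set.range e) : Set H)

/-- The squared distance `‖e ψ - e φ‖ ^ 2` is a combination of values of the continuous kernel that
vanishes at `ψ = φ`. -/
theorem continuous_of_inner_eq_exp {E H : Type*} [NormedAddCommGroup E] [InnerProductSpace ℂ E]
    [NormedAddCommGroup H] [InnerProductSpace ℂ H] {e : E → H}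
    (he : ∀ φ ψ, ⟪e φ, e ψ⟫_ℂ = Complex.exp ⟪φ, ψ⟫_ℂ) : Continuous e := by
  rw [continuous_iff_continuousAt]
  intro φ
  rw [ContinuousAt, tendsto_iff_norm_sub_tendsto_zero]
  have h1 : ∀ ψ, ‖e ψ - e φ‖ ^ 2 =
      (Complex.exp ⟪ψ, ψ⟫_ℂ - Complex.exp ⟪ψ, φ⟫_ℂ -
        (Complex.exp ⟪φ, ψ⟫_ℂ - Complex.exp ⟪φ, φ⟫_ℂ)).re := by
    intro ψ
    rw [← he, ← he, ← he, ← he, ← inner_sub_right, ← inner_sub_right, ← inner_sub_left,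
      ← inner_self_eq_norm_sq (𝕜 := ℂ)]
    rfl
  have h2 : Filter.Tendsto (fun ψ => ‖e ψ - e φ‖ ^ 2) (nhds φ) (nhds 0) := by
    simp only [h1]
    have : Continuous fun ψ : E => (Complex.exp ⟪ψ, ψ⟫_ℂ - Complex.exp ⟪ψ, φ⟫_ℂ -
        (Complex.exp ⟪φ, ψ⟫_ℂ - Complex.exp ⟪φ, φ⟫_ℂ)).re := by fun_prop
    convert this.tendsto φ using 2
    simp
  have h3 := (Real.continuous_sqrt.tendsto 0).comp h2
  simpa [Function.comp_def, Real.sqrt_sq (norm_nonneg _)] using h3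

/-! ## The basis of modes -/

theorem orthonormal_mode : Orthonormal ℂ mode := by
  have h2π : (0 : ℝ) < 2 * Real.pi := Real.two_pi_pos
  rw [orthonormal_iff_ite]
  intro i j
  have h1 : ⟪ContinuousMap.toLp (E := ℂ) 2 (volume : Measure S1) ℂ (fourier i),
      ContinuousMap.toLp (E := ℂ) 2 (volume : Measure S1) ℂ (fourier j)⟫_ℂ =
      if i = j then ((2 * Real.pi : ℝ) : ℂ) else 0 := by
    rw [ContinuousMap.inner_toLp]
    simp_rw [← fourier_neg, ← fourier_add]
    split_ifs with h
    · simp [h, Measure.real, AddCircle.measure_univ, Real.pi_pos.le]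
    · have hij : j + -i ≠ 0 := sub_ne_zero.mpr (Ne.symm h)
      exact integral_eq_zero_of_add_right_eq_neg (μ := volume)
        (fourier_add_half_inv_index hij h2π)
  rw [mode, mode, inner_smul_left, inner_smul_right, h1]
  split_ifs
  · rw [← Complex.ofReal_inv, Complex.conj_ofReal]
    norm_cast
    rw [← mul_assoc, ← mul_inv, Real.mul_self_sqrt h2π.le, inv_mul_cancel₀ h2π.ne']
  · simp

theorem span_mode_topologicalClosure : (Submodule.span ℂ (Set.range mode)).topologicalClosure = ⊤ := by
  have hne : ((Real.sqrt (2 * Real.pi))⁻¹ : ℂ) ≠ 0 := by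
    rw [← Complex.ofReal_inv]
    exact_mod_cast (inv_pos.2 (Real.sqrt_pos.2 Real.two_pi_pos)).ne'
  have h1 : (Submodule.span ℂ (Set.range mode)) =
      (Submodule.span ℂ (Set.range (@fourier (2 * Real.pi)))).map
        (ContinuousMap.toLp (E := ℂ) 2 (volume : Measure S1) ℂ).toLinearMap := by
    rw [Submodule.map_span, ← Set.range_comp]
    refine le_antisymm (Submodule.span_le.2 ?_) (Submodule.span_le.2 ?_)
    · rintro _ ⟨k, rfl⟩
      exact Submodule.smul_mem _ _ (Submodule.subset_span ⟨k, rfl⟩)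
    · rintro _ ⟨k, rfl⟩
      have : (ContinuousMap.toLp (E := ℂ) 2 (volume : Measure S1) ℂ) (fourier k) =
          ((Real.sqrt (2 * Real.pi))⁻¹ : ℂ)⁻¹ • mode k := by
        rw [mode, smul_smul, inv_mul_cancel₀ hne, one_smul]
      change (ContinuousMap.toLp (E := ℂ) 2 (volume : Measure S1) ℂ) (fourier k) ∈ _
      rw [this]
      exact Submodule.smul_mem _ _ (Submodule.subset_span ⟨k, rfl⟩)
  rw [h1]
  convert! (ContinuousMap.toLp_denseRange ℂ (volume : Measure S1) ℂ (p := 2)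
    ENNReal.ofNat_ne_top).topologicalClosure_map_submodule span_fourier_closure_eq_top

/-- The modes as a Hilbert basis. -/
noncomputable def modeBasis : HilbertBasis ℤ ℂ OneParticle :=
  HilbertBasis.mk orthonormal_mode span_mode_topologicalClosure.ge

@[simp] theorem coe_modeBasis : ⇑modeBasis = mode := HilbertBasis.coe_mk _ _

theorem coord_eq_repr (ψ : OneParticle) (k : ℤ) : coord ψ k = modeBasis.repr ψ k := by
  rw [modeBasis.repr_apply_apply, coe_modeBasis]
  rfl

theorem coord_add (φ ψ : OneParticle) (k : ℤ) : coord (φ + ψ) k = coord φ k + coord ψ k :=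
  inner_add_right _ _ _

theorem coord_smul (c : ℂ) (ψ : OneParticle) (k : ℤ) : coord (c • ψ) k = c * coord ψ k :=
  inner_smul_right _ _ _

@[simp] theorem coord_zero (k : ℤ) : coord 0 k = 0 := inner_zero_right _

theorem coord_ext {φ ψ : OneParticle} (h : ∀ k, coord φ k = coord ψ k) : φ = ψ := by
  apply modeBasis.repr.injective
  ext k
  rw [← coord_eq_repr, ← coord_eq_repr, h]

theorem hasSum_coord_inner (φ ψ : OneParticle) :
    HasSum (fun k => star (coord φ k) * coord ψ k) ⟪φ, ψ⟫_ℂ := by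
  have := modeBasis.hasSum_inner_mul_inner φ ψ
  simp only [coe_modeBasis] at this
  refine this.congr_fun fun k => ?_
  congr 1
  exact inner_conj_symm φ (mode k)

theorem hasSum_norm_coord_sq (φ : OneParticle) :
    HasSum (fun k => ‖coord φ k‖ ^ 2) (‖φ‖ ^ 2) := by
  have h := hasSum_coord_inner φ φ
  have h2 : ⟪φ, φ⟫_ℂ = ((‖φ‖ ^ 2 : ℝ) : ℂ) := by
    rw [inner_self_eq_norm_sq_to_K]; simp
  rw [h2] at h
  have h3 : (fun k => star (coord φ k) * coord φ k) = fun k => ((‖coord φ k‖ ^ 2 : ℝ) : ℂ) := by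
    funext k
    rw [mul_comm]
    simpa using Complex.mul_conj' (coord φ k)
  rw [h3] at h
  exact Complex.hasSum_ofReal.1 h

theorem summable_norm_coord_mul (φ ψ : OneParticle) :
    Summable fun k => ‖star (coord φ k) * coord ψ k‖ := by
  refine .of_nonneg_of_le (fun _ => norm_nonneg _) (fun k => ?_)
    ((hasSum_norm_coord_sq φ).summable.add (hasSum_norm_coord_sq ψ).summable)
  rw [norm_mul, norm_star]
  nlinarith [sq_nonneg (‖coord φ k‖ - ‖coord ψ k‖), sq_nonneg (‖coord φ k‖ + ‖coord ψ k‖)]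

/-! ## Sums over words -/

theorem hasSum_prod_fin {f : ℤ → ℂ} (hf : Summable fun k => ‖f k‖) (n : ℕ) :
    Summable (fun v : Fin n → ℤ => ‖∏ i, f (v i)‖) ∧
      HasSum (fun v : Fin n → ℤ => ∏ i, f (v i)) ((∑' k, f k) ^ n) := by
  induction n with
  | zero =>
    refine ⟨Summable.of_finite, ?_⟩
    simp
  | succ n ih =>
    obtain ⟨e, he⟩ : ∃ e : ℤ × (Fin n → ℤ) ≃ (Fin (n + 1) → ℤ), ∀ p, e p = Fin.cons p.1 p.2 :=
      ⟨Fin.consEquiv (fun _ => ℤ), fun _ => rfl⟩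
    have hcomp : ∀ p : ℤ × (Fin n → ℤ), ∏ i, f (e p i) = f p.1 * ∏ i, f (p.2 i) := by
      intro p
      rw [he, Fin.prod_univ_succ]
      rfl
    have hs : Summable fun p : ℤ × (Fin n → ℤ) => ‖f p.1 * ∏ i, f (p.2 i)‖ :=
      Summable.mul_norm (f := f) (g := fun v : Fin n → ℤ => ∏ i, f (v i)) hf ih.1
    constructor
    · rw [← e.summable_iff]
      simpa only [Function.comp_def, hcomp] using hs
    · rw [← e.hasSum_iff]
      simp only [Function.comp_def, hcomp]
      rw [pow_succ']
      exact HasSum.mul (f := f) (g := fun v : Fin n → ℤ => ∏ i, f (v i)) hf.of_norm.hasSum ih.2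
        hs.of_norm

/-- Grouping the words by length `n` turns the sum into `∑ (∑' k, f k) ^ n / n!`. Absolute
convergence comes from the same computation with `‖f k‖`. -/
theorem hasSum_list_prod {f : ℤ → ℂ} (hf : Summable fun k => ‖f k‖) :
    Summable (fun l : List ℤ => ‖((l.length.factorial : ℂ))⁻¹ * (l.map f).prod‖) ∧
    HasSum (fun l : List ℤ => ((l.length.factorial : ℂ))⁻¹ * (l.map f).prod)
      (Complex.exp (∑' k, f k)) := by
  have hcomp : ∀ p : Σ n, Fin n → ℤ, ((List.equivSigmaTuple.symm p).map f).prod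
      = ∏ i, f (p.2 i) := by
    rintro ⟨n, v⟩
    simp [List.equivSigmaTuple, List.map_ofFn, List.prod_ofFn]
  have hlen : ∀ p : Σ n, Fin n → ℤ, (List.equivSigmaTuple.symm p).length = p.1 := by
    rintro ⟨n, v⟩
    simp [List.equivSigmaTuple]
  have hf' : Summable fun k => ‖((‖f k‖ : ℝ) : ℂ)‖ := by simpa using hf
  have hsn : Summable fun p : Σ n, Fin n → ℤ =>
      ‖((p.1.factorial : ℂ))⁻¹ * ∏ i, f (p.2 i)‖ := by
    rw [summable_sigma_of_nonneg fun _ => norm_nonneg _]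
    refine ⟨fun n => ?_, ?_⟩
    · simp only [norm_mul]
      exact ((hasSum_prod_fin hf n).1).mul_left _
    · have h1 : ∀ n : ℕ, ∑' v : Fin n → ℤ, ‖((n.factorial : ℂ))⁻¹ * ∏ i, f (v i)‖
          = (∑' k, ‖f k‖) ^ n / n.factorial := by
        intro n
        have h3 : HasSum (fun v : Fin n → ℤ => ∏ i, ‖f (v i)‖) ((∑' k, ‖f k‖) ^ n) := by
          have h2 := (hasSum_prod_fin hf' n).2
          rw [← Complex.ofReal_tsum, ← Complex.ofReal_pow] at h2
          refine Complex.hasSum_ofReal.1 (h2.congr_fun fun v => ?_)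
          exact Complex.ofReal_prod _ _
        simp only [norm_mul, norm_prod, norm_inv, Complex.norm_natCast]
        rw [tsum_mul_left, h3.tsum_eq]
        ring
      simp only [h1]
      exact Real.summable_pow_div_factorial _
  have hexp : HasSum (fun n : ℕ => ((n.factorial : ℂ))⁻¹ * (∑' k, f k) ^ n)
      (Complex.exp (∑' k, f k)) := by
    have := NormedSpace.expSeries_div_hasSum_exp (𝔸 := ℂ) (∑' k, f k)
    rw [← Complex.exp_eq_exp_ℂ] at this
    simpa [div_eq_inv_mul] using this
  constructor
  · rw [← List.equivSigmaTuple.symm.summable_iff]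
    simpa only [Function.comp_def, hcomp, hlen] using hsn
  · rw [← List.equivSigmaTuple.symm.hasSum_iff]
    simp only [Function.comp_def, hcomp, hlen]
    have hterm : ∀ n : ℕ, HasSum (fun v : Fin n → ℤ => ((n.factorial : ℂ))⁻¹ * ∏ i, f (v i))
        (((n.factorial : ℂ))⁻¹ * (∑' k, f k) ^ n) := fun n =>
      HasSum.mul_left ((n.factorial : ℂ)⁻¹) (hasSum_prod_fin hf n).2
    exact HasSum.sigma_of_hasSum
      (f := fun p : Σ n, Fin n → ℤ => ((p.1.factorial : ℂ))⁻¹ * ∏ i, f (p.2 i)) hexp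
      hterm hsn.of_norm

/-! ## Coherent vectors -/

/-- The coefficients of the coherent vector with one-particle coefficients `c`. -/
noncomputable def cohCoeff (c : ℤ → ℂ) (l : List ℤ) : ℂ :=
  ((Real.sqrt l.length.factorial)⁻¹ : ℂ) * (l.map c).prod

theorem star_cohCoeff_mul (c d : ℤ → ℂ) (l : List ℤ) : star (cohCoeff c l) * cohCoeff d l =
    ((l.length.factorial : ℂ))⁻¹ * (l.map fun k => star (c k) * d k).prod := by
  have h2 : ∀ l : List ℤ, star (l.map c).prod = (l.map fun k => star (c k)).prod := fun l => by
    induction l with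
    | nil => simp
    | cons a l ih => rw [List.map_cons, List.prod_cons, star_mul', ih, List.map_cons, List.prod_cons]
  have h1 : ((Real.sqrt l.length.factorial)⁻¹ : ℂ) * ((Real.sqrt l.length.factorial)⁻¹ : ℂ) =
      ((l.length.factorial : ℂ))⁻¹ := by
    rw [← mul_inv, ← Complex.ofReal_mul, Real.mul_self_sqrt (by positivity)]
    simp
  rw [List.prod_map_mul, ← h2, ← h1]
  simp only [cohCoeff, star_mul', star_inv₀, Complex.star_def, Complex.conj_ofReal]
  ring

theorem cohCoeff_perm (c : ℤ → ℂ) {l l' : List ℤ} (h : l.Perm l') :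
    cohCoeff c l = cohCoeff c l' := by
  rw [cohCoeff, cohCoeff, h.length_eq, (h.map c).prod_eq]

theorem hasSum_cohCoeff (φ ψ : OneParticle) :
    Summable (fun l => ‖star (cohCoeff (coord φ) l) * cohCoeff (coord ψ) l‖) ∧
    HasSum (fun l => star (cohCoeff (coord φ) l) * cohCoeff (coord ψ) l)
      (Complex.exp ⟪φ, ψ⟫_ℂ) := by
  simp only [star_cohCoeff_mul]
  rw [← (hasSum_coord_inner φ ψ).tsum_eq]
  exact hasSum_list_prod (summable_norm_coord_mul φ ψ)

theorem memℓp_cohCoeff (φ : OneParticle) : Memℓp (cohCoeff (coord φ)) 2 := by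
  refine memℓp_gen ?_
  refine (hasSum_cohCoeff φ φ).1.congr fun l => ?_
  rw [norm_mul, norm_star]
  norm_num
  ring

/-- The coherent (exponential) vector `e(φ) = ∑ φ^{⊗n} / √n!`. -/
noncomputable def coherent (φ : OneParticle) : Fock :=
  ⟨⟨cohCoeff (coord φ), memℓp_cohCoeff φ⟩, fun _ _ h => cohCoeff_perm _ h⟩

theorem coherent_apply (φ : OneParticle) (l : List ℤ) :
    (coherent φ).1 l = cohCoeff (coord φ) l := rfl

theorem hasSum_fock_inner (F G : Fock) : HasSum (fun l => star (F.1 l) * G.1 l) ⟪F, G⟫_ℂ := by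
  have h : HasSum (fun l => ⟪F.1 l, G.1 l⟫_ℂ) ⟪F, G⟫_ℂ := lp.hasSum_inner (𝕜 := ℂ) F.1 G.1
  refine h.congr_fun fun l => ?_
  rw [RCLike.inner_apply, mul_comm]
  rfl

theorem inner_coherent (φ ψ : OneParticle) :
    ⟪coherent φ, coherent ψ⟫_ℂ = Complex.exp ⟪φ, ψ⟫_ℂ :=
  (hasSum_fock_inner _ _).unique (hasSum_cohCoeff φ ψ).2

theorem coherent_zero : coherent 0 = vacuum := by
  apply Subtype.ext
  ext l
  rw [coherent_apply]
  change _ = lp.single (E := fun _ : List ℤ => ℂ) 2 ([] : List ℤ) (1 : ℂ) l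
  cases l with
  | nil => simp [cohCoeff]
  | cons a l => rw [lp.single_apply_ne _ _ _ (by simp)]; simp [cohCoeff]

theorem fock_ext {F G : Fock} (h : ∀ l, F.1 l = G.1 l) : F = G :=
  Subtype.ext (lp.ext (funext h))

/-- Evaluation of Fock vectors at a word. -/
noncomputable def fockEval (l : List ℤ) : Fock →L[ℂ] ℂ :=
  (lp.evalCLM ℂ (fun _ : List ℤ => ℂ) 2 l) ∘L fockSubmodule.subtypeL

end KGCircle

namespace KGCircle

/-! ## Totality of the coherent vectors -/

theorem coord_mode (j k : ℤ) : coord (mode j) k = if k = j then 1 else 0 :=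
  orthonormal_iff_ite.1 orthonormal_mode k j

theorem coord_sum_smul_mode (S : Finset ℤ) (c : ℤ → ℂ) (k : ℤ) :
    coord (∑ j ∈ S, c j • mode j) k = if k ∈ S then c k else 0 := by
  have h : coord (∑ j ∈ S, c j • mode j) k = ∑ j ∈ S, coord (c j • mode j) k := inner_sum _ _ _
  rw [h]
  simp [coord_smul, coord_mode]

/-- Uniqueness of power series coefficients; it separates the particle numbers below. -/
theorem eq_zero_of_hasSum_pow_mul {c : ℕ → ℂ} (h : ∀ t : ℂ, HasSum (fun n => t ^ n * c n) 0) :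
    c = 0 := by
  have h1 : HasFPowerSeriesAt (0 : ℂ → ℂ) (FormalMultilinearSeries.ofScalars ℂ c) 0 := by
    rw [hasFPowerSeriesAt_iff]
    refine Filter.Eventually.of_forall fun t => ?_
    simpa [FormalMultilinearSeries.coeff_ofScalars] using h t
  have h2 := h1.eq_zero
  funext n
  have h3 := congrArg (fun p => FormalMultilinearSeries.coeff p n) h2
  have h4 : FormalMultilinearSeries.coeff (0 : FormalMultilinearSeries ℂ ℂ ℂ) n = 0 := rfl
  simpa [FormalMultilinearSeries.coeff_ofScalars, h4] using h3

/-- The pairing of `F` with the coherent vector of a finite mode combination scaled by `t` is a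
power series in `t`. Its `n`-th coefficient is the displayed sum, up to a nonzero factor. -/
theorem sum_words_eq_zero {F : Fock} (hF : ∀ φ, ⟪coherent φ, F⟫_ℂ = 0) (S : Finset ℤ) (z : ℤ → ℂ)
    (n : ℕ) : ∑ v ∈ Fintype.piFinset fun _ : Fin n => S, F.1 (List.ofFn v) * ∏ i, z (v i) = 0 := by
  set z' : ℤ → ℂ := fun k => if k ∈ S then z k else 0 with hz'
  set c : ℕ → ℂ := fun n => ((Real.sqrt n.factorial)⁻¹ : ℂ) *
    ∑ v ∈ Fintype.piFinset fun _ : Fin n => S, F.1 (List.ofFn v) * ∏ i, z (v i) with hc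
  have hfib : ∀ (t : ℂ) (n : ℕ), HasSum (fun v : Fin n → ℤ => t ^ n *
      (((Real.sqrt n.factorial)⁻¹ : ℂ) * (F.1 (List.ofFn v) * ∏ i, z' (v i)))) (t ^ n * c n) := by
    intro t n
    refine HasSum.mul_left _ (HasSum.mul_left _ ?_)
    have h1 : ∑ v ∈ Fintype.piFinset fun _ : Fin n => S, F.1 (List.ofFn v) * ∏ i, z (v i) =
        ∑ v ∈ Fintype.piFinset fun _ : Fin n => S, F.1 (List.ofFn v) * ∏ i, z' (v i) := by
      refine Finset.sum_congr rfl fun v hv => ?_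
      rw [Fintype.mem_piFinset] at hv
      congr 1
      exact Finset.prod_congr rfl fun i _ => (if_pos (hv i)).symm
    rw [h1]
    refine hasSum_sum_of_ne_finset_zero fun v hv => ?_
    rw [Fintype.mem_piFinset] at hv
    push Not at hv
    obtain ⟨i, hi⟩ := hv
    rw [Finset.prod_eq_zero (Finset.mem_univ i) (if_neg hi), mul_zero]
  have hsum : ∀ t : ℂ, HasSum (fun n => t ^ n * c n) 0 := by
    intro t
    -- The conjugates compensate the antilinearity of the inner product in its first argument.
    set φ : OneParticle := ∑ k ∈ S, (star t * star (z k)) • mode k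
    have hφ : ∀ k, star (coord φ k) = t * z' k := by
      intro k
      rw [coord_sum_smul_mode S (fun k => star t * star (z k))]
      simp only [hz']
      split_ifs <;> simp
    have h1 := hasSum_fock_inner (coherent φ) F
    rw [hF φ, ← List.equivSigmaTuple.symm.hasSum_iff] at h1
    have h2 : ∀ p : Σ n, Fin n → ℤ, star (cohCoeff (coord φ) (List.ofFn p.2)) * F.1 (List.ofFn p.2) =
        t ^ p.1 * (((Real.sqrt p.1.factorial)⁻¹ : ℂ) *
          (F.1 (List.ofFn p.2) * ∏ i, z' (p.2 i))) := by
      rintro ⟨n, v⟩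
      simp only [cohCoeff, List.map_ofFn, List.prod_ofFn, List.length_ofFn, star_mul', star_prod,
        Function.comp_apply, hφ, Finset.prod_mul_distrib, Finset.prod_const, Finset.card_univ,
        Fintype.card_fin, star_inv₀, Complex.star_def, Complex.conj_ofReal]
      ring
    have h3 : HasSum (fun p : Σ n, Fin n → ℤ => t ^ p.1 * (((Real.sqrt p.1.factorial)⁻¹ : ℂ) *
          (F.1 (List.ofFn p.2) * ∏ i, z' (p.2 i)))) 0 :=
      h1.congr_fun fun p => (h2 p).symm
    exact h3.sigma fun n => hfib t n
  have h0 := congrFun (eq_zero_of_hasSum_pow_mul hsum) n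
  simp only [hc, Pi.zero_apply, mul_eq_zero, inv_eq_zero, Complex.ofReal_eq_zero] at h0
  exact h0.resolve_left (Real.sqrt_pos.2 (by positivity)).ne'

/-- For a finite alphabet the `n`-particle part of `F` defines a polynomial vanishing at every
point, hence zero. By symmetry of `F` the coefficient at the monomial of `l` is `F l` times the
number of rearrangements of `l`. -/
theorem eq_zero_of_inner_coherent {F : Fock} (hF : ∀ φ, ⟪coherent φ, F⟫_ℂ = 0) : F = 0 := by
  classical
  refine fock_ext fun l => ?_
  change F.1 l = 0
  set n := l.length
  set v₀ : Fin n → ℤ := l.get with hv₀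
  have hl : List.ofFn v₀ = l := List.ofFn_get l
  set S : Finset ℤ := l.toFinset
  set P : MvPolynomial ℤ ℂ := ∑ v ∈ Fintype.piFinset fun _ : Fin n => S,
    MvPolynomial.monomial (Multiset.toFinsupp (List.ofFn v : Multiset ℤ)) (F.1 (List.ofFn v))
    with hP
  have hP0 : P = 0 := by
    refine MvPolynomial.funext fun z => ?_
    rw [map_zero, hP, map_sum, ← sum_words_eq_zero hF S z n]
    refine Finset.sum_congr rfl fun v _ => ?_
    rw [MvPolynomial.eval_monomial]
    congr 1
    rw [Finsupp.prod, Multiset.toFinsupp_support]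
    have := Finset.prod_multiset_map_count (List.ofFn v : Multiset ℤ) z
    simp only [Multiset.toFinsupp_apply]
    rw [← this, Multiset.map_coe, Multiset.prod_coe, List.map_ofFn, List.prod_ofFn]
    rfl
  have hco := congrArg (MvPolynomial.coeff (Multiset.toFinsupp (l : Multiset ℤ))) hP0
  rw [hP, MvPolynomial.coeff_sum, MvPolynomial.coeff_zero] at hco
  have hterm : ∀ v ∈ Fintype.piFinset fun _ : Fin n => S,
      MvPolynomial.coeff (Multiset.toFinsupp (l : Multiset ℤ)) (MvPolynomial.monomial
        (Multiset.toFinsupp (List.ofFn v : Multiset ℤ)) (F.1 (List.ofFn v))) =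
      if (List.ofFn v).Perm l then F.1 l else 0 := by
    intro v _
    rw [MvPolynomial.coeff_monomial]
    have hiff : Multiset.toFinsupp (List.ofFn v : Multiset ℤ) = Multiset.toFinsupp (l : Multiset ℤ)
        ↔ (List.ofFn v).Perm l := by
      rw [Multiset.toFinsupp.injective.eq_iff, Multiset.coe_eq_coe]
    by_cases h : (List.ofFn v).Perm l
    · rw [if_pos (hiff.2 h), if_pos h, F.2 _ _ h]
    · rw [if_neg (fun h' => h (hiff.1 h')), if_neg h]
  rw [Finset.sum_congr rfl hterm, ← Finset.sum_filter, Finset.sum_const, nsmul_eq_mul,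
    mul_eq_zero] at hco
  refine hco.resolve_left ?_
  rw [Nat.cast_eq_zero, Finset.card_eq_zero]
  -- The number of rearrangements is positive, since `v₀` spells `l` itself.
  refine Finset.Nonempty.ne_empty ⟨v₀, ?_⟩
  rw [Finset.mem_filter, Fintype.mem_piFinset, hl]
  exact ⟨fun i => List.mem_toFinset.2 (List.get_mem _ _), List.Perm.refl _⟩

theorem isExponential_coherent : IsExponential coherent := by
  refine ⟨inner_coherent, ?_⟩
  rw [Submodule.dense_iff_topologicalClosure_eq_top,
    Submodule.topologicalClosure_eq_top_iff, Submodule.eq_bot_iff]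
  intro F hF
  rw [Submodule.mem_orthogonal] at hF
  exact eq_zero_of_inner_coherent fun φ => hF _ (Submodule.subset_span ⟨φ, rfl⟩)

end KGCircle

namespace KGCircle

/-! ## Weyl operators defined on coherent vectors -/

/-- The squared norm only sees the Gram matrix. Hence a map given by a formula on exponential
vectors extends isometrically, and no linear independence is required. -/
theorem norm_linearCombination_eq {ι E F : Type*} [NormedAddCommGroup E] [InnerProductSpace ℂ E]
    [NormedAddCommGroup F] [InnerProductSpace ℂ F] {u : ι → E} {v : ι → F}
    (h : ∀ i j, ⟪u i, u j⟫_ℂ = ⟪v i, v j⟫_ℂ) (c : ι →₀ ℂ) :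
    ‖Finsupp.linearCombination ℂ u c‖ = ‖Finsupp.linearCombination ℂ v c‖ := by
  have h1 : ⟪Finsupp.linearCombination ℂ u c, Finsupp.linearCombination ℂ u c⟫_ℂ =
      ⟪Finsupp.linearCombination ℂ v c, Finsupp.linearCombination ℂ v c⟫_ℂ := by
    simp only [Finsupp.linearCombination_apply, Finsupp.sum, sum_inner, inner_sum, inner_smul_left,
      inner_smul_right, h]
  rw [@norm_eq_sqrt_re_inner ℂ E, @norm_eq_sqrt_re_inner ℂ F, h1]

section Weyl

variable {E H : Type*} [NormedAddCommGroup E] [InnerProductSpace ℂ E] [NormedAddCommGroup H]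
  [InnerProductSpace ℂ H] {e : E → H}

theorem IsExponential.denseRange (he : IsExponential e) :
    DenseRange (Finsupp.linearCombination ℂ e) := by
  have := he.dense_span
  rw [← Finsupp.range_linearCombination] at this
  exact this

/-- The image of a coherent vector under a Weyl operator. -/
noncomputable def weylCoherent (e : E → H) (ψ φ : E) : H :=
  Complex.exp (⟪ψ, φ⟫_ℂ - ⟪ψ, ψ⟫_ℂ / 2) • e (φ - ψ)

theorem IsExponential.inner_weylCoherent (he : IsExponential e) (ψ φ χ : E) :
    ⟪weylCoherent e ψ φ, weylCoherent e ψ χ⟫_ℂ = ⟪e φ, e χ⟫_ℂ := by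
  rw [weylCoherent, weylCoherent, inner_smul_left, inner_smul_right, he.inner_eq,
    he.inner_eq, ← Complex.exp_conj, ← Complex.exp_add, ← Complex.exp_add, map_sub, map_div₀,
    inner_conj_symm, inner_conj_symm, inner_sub_left, inner_sub_right, inner_sub_right]
  congr 1
  rw [map_ofNat]
  ring

theorem IsExponential.clm_ext (he : IsExponential e) {F : Type*} [NormedAddCommGroup F]
    [NormedSpace ℂ F] {S T : H →L[ℂ] F}
    (h : ∀ φ, S (e φ) = T (e φ)) : S = T := by
  refine ContinuousLinearMap.ext_on he.dense_span ?_
  rintro _ ⟨φ, rfl⟩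
  exact h φ

theorem IsExponential.weyl_bound (he : IsExponential e) (ψ : E) (c : E →₀ ℂ) :
    ‖Finsupp.linearCombination ℂ (weylCoherent e ψ) c‖ ≤
      1 * ‖Finsupp.linearCombination ℂ e c‖ := by
  rw [one_mul, norm_linearCombination_eq (he.inner_weylCoherent ψ)]

variable [CompleteSpace H]

/-- The Weyl operator of `ψ`, as the continuous extension of `weylCoherent e ψ`. -/
noncomputable def weyl (e : E → H) (ψ : E) : H →L[ℂ] H :=
  (Finsupp.linearCombination ℂ (weylCoherent e ψ)).extendOfNorm (Finsupp.linearCombination ℂ e)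

theorem IsExponential.weyl_coherent (he : IsExponential e) (ψ φ : E) : weyl e ψ (e φ) =
    Complex.exp (⟪ψ, φ⟫_ℂ - ⟪ψ, ψ⟫_ℂ / 2) • e (φ - ψ) := by
  have := LinearMap.extendOfNorm_eq he.denseRange
    ⟨1, he.weyl_bound ψ⟩ (Finsupp.single φ 1)
  rw [Finsupp.linearCombination_single, Finsupp.linearCombination_single, one_smul,
    one_smul] at this
  exact this

theorem IsExponential.norm_weyl_apply_le (he : IsExponential e) (ψ : E) (x : H) :
    ‖weyl e ψ x‖ ≤ ‖x‖ := by
  have := LinearMap.norm_extendOfNorm_apply_le he.denseRange 1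
    (he.weyl_bound ψ) x
  rwa [one_mul] at this

theorem IsExponential.weyl_zero (he : IsExponential e) :
    weyl e 0 = 1 := he.clm_ext fun φ => by simp [he.weyl_coherent]

theorem IsExponential.weyl_mul (he : IsExponential e) (ψ φ : E) :
    weyl e ψ * weyl e φ = Complex.exp (-(I * ((⟪ψ, φ⟫_ℂ).im : ℂ))) • weyl e (ψ + φ) := by
  refine he.clm_ext fun χ => ?_
  rw [mul_apply_eq_comp, smul_apply, he.weyl_coherent, he.weyl_coherent,
    map_smul, he.weyl_coherent, smul_smul, smul_smul, ← Complex.exp_add, ← Complex.exp_add, sub_sub,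
    add_comm φ ψ]
  congr 2
  have h1 : ⟪φ, ψ⟫_ℂ = ⟪ψ, φ⟫_ℂ - 2 * (I * ((⟪ψ, φ⟫_ℂ).im : ℂ)) := by
    have h2 : ⟪φ, ψ⟫_ℂ = (starRingEnd ℂ) ⟪ψ, φ⟫_ℂ := (inner_conj_symm φ ψ).symm
    rw [h2]
    generalize ⟪ψ, φ⟫_ℂ = z
    apply Complex.ext
    · simp
    · simp
      ring
  rw [inner_sub_right, inner_add_left, inner_add_right, inner_add_left, inner_add_left, h1]
  ring

theorem IsExponential.weyl_neg_mul (he : IsExponential e) (ψ : E) :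
    weyl e (-ψ) * weyl e ψ = 1 := by
  rw [he.weyl_mul, neg_add_cancel, he.weyl_zero, inner_neg_left, neg_im,
    show (⟪ψ, ψ⟫_ℂ).im = 0 from inner_self_im (𝕜 := ℂ) ψ]
  simp

theorem IsExponential.weyl_mul_neg (he : IsExponential e) (ψ : E) :
    weyl e ψ * weyl e (-ψ) = 1 := by
  simpa using he.weyl_neg_mul (-ψ)

theorem IsExponential.norm_weyl_apply (he : IsExponential e) (ψ : E) (x : H) :
    ‖weyl e ψ x‖ = ‖x‖ := by
  refine le_antisymm (he.norm_weyl_apply_le ψ x) ?_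
  calc ‖x‖ = ‖(weyl e (-ψ) * weyl e ψ) x‖ := by rw [he.weyl_neg_mul]; rfl
    _ ≤ ‖weyl e ψ x‖ := he.norm_weyl_apply_le _ _

theorem IsExponential.star_weyl (he : IsExponential e) (ψ : E) :
    star (weyl e ψ) = weyl e (-ψ) := by
  have h1 : star (weyl e ψ) * weyl e ψ = 1 :=
    (ContinuousLinearMap.norm_map_iff_adjoint_comp_self (weyl e ψ)).1 (he.norm_weyl_apply ψ)
  calc star (weyl e ψ) = star (weyl e ψ) * (weyl e ψ * weyl e (-ψ)) := by
        rw [he.weyl_mul_neg, mul_one]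
    _ = weyl e (-ψ) := by rw [← mul_assoc, h1, one_mul]

theorem IsExponential.weyl_mem_unitary (he : IsExponential e) (ψ : E) :
    weyl e ψ ∈ unitary (H →L[ℂ] H) := by
  rw [Unitary.mem_iff, he.star_weyl]
  exact ⟨he.weyl_neg_mul ψ, he.weyl_mul_neg ψ⟩

theorem IsExponential.inner_weyl_left (he : IsExponential e) (ψ : E) (x y : H) :
    ⟪weyl e ψ x, y⟫_ℂ = ⟪x, weyl e (-ψ) y⟫_ℂ := by
  rw [← he.star_weyl]
  exact (ContinuousLinearMap.adjoint_inner_right (weyl e ψ) x y).symm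

/-- The phases of the two products add up instead of cancelling. This is the mechanism by which a
vector `η` implements a character. -/
theorem IsExponential.weyl_mul_mul_star (he : IsExponential e) (η ψ : E) :
    weyl e η * weyl e ψ * star (weyl e η) =
    Complex.exp (-(2 * I * ((⟪η, ψ⟫_ℂ).im : ℂ))) • weyl e ψ := by
  rw [he.star_weyl, he.weyl_mul, smul_mul_assoc, he.weyl_mul, smul_smul, ← Complex.exp_add]
  have h1 : η + ψ + -η = ψ := by abel
  have h2 : (⟪ψ, η⟫_ℂ).im = -(⟪η, ψ⟫_ℂ).im := inner_im_symm (𝕜 := ℂ) ψ η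
  have h3 : (⟪η, η⟫_ℂ).im = 0 := inner_self_im (𝕜 := ℂ) η
  rw [h1, inner_neg_right, inner_add_left, neg_im, add_im, h2, h3]
  congr 2
  push_cast
  ring

/-- On the span of the exponential vectors continuity is explicit; since all Weyl operators are
isometries, approximating `x` from this dense span is uniform in `ψ`. -/
theorem IsExponential.continuous_weyl_apply (he : IsExponential e) (x : H) :
    Continuous fun ψ => weyl e ψ x := by
  refine continuous_of_uniform_approx_of_continuous fun u hu => ?_
  obtain ⟨ε, hε, hεu⟩ := Metric.mem_uniformity_dist.1 hu
  obtain ⟨y, hy, hxy⟩ := he.dense_span.exists_dist_lt x hε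
  refine ⟨fun ψ => weyl e ψ y, ?_, fun ψ => hεu ?_⟩
  · clear hxy
    induction hy using Submodule.span_induction with
    | mem y hy =>
      obtain ⟨φ, rfl⟩ := hy
      simp only [he.weyl_coherent]
      exact Continuous.smul (by fun_prop) ((continuous_of_inner_eq_exp he.inner_eq).comp (by fun_prop))
    | zero => simpa using continuous_const
    | add a b _ _ ha hb => simp only [map_add]; fun_prop
    | smul c a _ ha => simp only [map_smul]; fun_prop
  · rwa [dist_eq_norm, ← map_sub, he.norm_weyl_apply, ← dist_eq_norm]

end Weyl

/-! ## One-parameter unitary groups -/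

section Group

variable {H : Type*} [NormedAddCommGroup H] [InnerProductSpace ℂ H]
  {V V' : ℝ → (H →L[ℂ] H)}

theorem norm_apply_of_mem_unitary [CompleteSpace H] {U : H →L[ℂ] H}
    (hU : U ∈ unitary (H →L[ℂ] H)) (x : H) :
    ‖U x‖ = ‖x‖ :=
  (ContinuousLinearMap.norm_map_iff_adjoint_comp_self U).2 (Unitary.mem_iff.1 hU).1 x

theorem hasDerivAt_group (hadd : ∀ s t, V (s + t) = V s * V t) {x y : H}
    (h : HasDerivAt (fun t => V t x) y 0) (t : ℝ) : HasDerivAt (fun s => V s x) (V t y) t := by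
  have h1 : (fun s => V s x) = fun s => V t (V (s - t) x) := by
    funext s
    rw [← mul_apply_eq_comp, ← hadd, add_sub_cancel]
  rw [h1]
  rw [← sub_self t] at h
  exact (V t).restrictScalars ℝ |>.hasFDerivAt.comp_hasDerivAt t (h.comp_sub_const t t)

theorem hasDerivAt_group_apply (hadd : ∀ s t, V (s + t) = V s * V t) {x y : H}
    (h : HasDerivAt (fun t => V t x) y 0) (t : ℝ) :
    HasDerivAt (fun s => V s (V t x)) (V t y) 0 := by
  have h1 : (fun s => V s (V t x)) = fun s => V t (V s x) := by
    funext s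
    rw [← mul_apply_eq_comp, ← hadd, add_comm, hadd]
    rfl
  rw [h1]
  exact (V t).restrictScalars ℝ |>.hasFDerivAt.comp_hasDerivAt 0 h

theorem re_inner_eq_zero_of_hasDerivAt [CompleteSpace H]
    (h0 : V 0 = 1) (hu : ∀ t, V t ∈ unitary (H →L[ℂ] H))
    {x y : H} (h : HasDerivAt (fun t => V t x) y 0) : (⟪x, y⟫_ℂ).re = 0 := by
  have h1 := (h.inner ℂ h)
  have h2 : (fun t => ⟪V t x, V t x⟫_ℂ) = fun _ => ⟪x, x⟫_ℂ := by
    funext t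
    rw [inner_self_eq_norm_sq_to_K, inner_self_eq_norm_sq_to_K, norm_apply_of_mem_unitary (hu t)]
  rw [h2] at h1
  have h3 := h1.unique (hasDerivAt_const _ _)
  simp only [h0, one_apply_eq_self] at h3
  have h4 := congrArg Complex.re h3
  rw [← inner_conj_symm y x, Complex.add_re, Complex.conj_re] at h4
  simp at h4
  linarith

/-- On the domain of the generator of `V`, the curve `V' (-t) (V t x)` has zero derivative, so it
stays equal to `x`; density of that domain does the rest. -/
theorem group_eq_of_hasDerivAt [CompleteSpace H]
    (h0 : V 0 = 1) (hadd : ∀ s t, V (s + t) = V s * V t)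
    (h0' : V' 0 = 1)
    (hadd' : ∀ s t, V' (s + t) = V' s * V' t) (hu' : ∀ t, V' t ∈ unitary (H →L[ℂ] H))
    (hgen : ∀ x y, HasDerivAt (fun t => V t x) y 0 → HasDerivAt (fun t => V' t x) y 0)
    (hd : Dense {x | ∃ y, HasDerivAt (fun t => V t x) y 0}) : V = V' := by
  have hinv : ∀ t x, V' t (V' (-t) x) = x := fun t x => by
    rw [← mul_apply_eq_comp, ← hadd', add_neg_cancel, h0']
    rfl
  have key : ∀ x y, HasDerivAt (fun t => V t x) y 0 → ∀ t, V t x = V' t x := by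
    intro x y hxy
    have hder : ∀ t, HasDerivAt (fun t => V' (-t) (V t x)) 0 t := by
      intro t
      have h1 := hasDerivAt_group_apply hadd hxy t
      have h2 := h1.sub (hgen _ _ h1)
      rw [hasDerivAt_iff_isLittleO_nhds_zero] at h2 ⊢
      refine Asymptotics.IsLittleO.of_norm_left (h2.norm_left.congr_left fun h => ?_)
      -- The product rule is replaced by this identity: the outer factors are isometries, and the
      -- inner difference of the two orbits of `V t x` is `o(h)` because both have the same
      -- derivative at zero.
      have e : V' (-(t + h)) (V (t + h) x) - V' (-t) (V t x) - h • (0 : H) =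
          V' (-t) (V' (-h) (V h (V t x) - V' h (V t x))) := by
        have e1 : V' (-h) (V' h (V t x)) = V t x := by simpa using hinv (-h) (V t x)
        rw [map_sub, e1, map_sub, neg_add, hadd', add_comm t h, hadd]
        simp
      rw [e, norm_apply_of_mem_unitary (hu' _), norm_apply_of_mem_unitary (hu' _)]
      simp [h0, h0']
    intro t
    have h1 := is_const_of_deriv_eq_zero (fun t => (hder t).differentiableAt)
      (fun t => (hder t).deriv) t 0
    simp only [neg_zero, h0, h0', one_apply_eq_self] at h1
    rw [← hinv t (V t x), h1]
  funext t
  ext x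
  have hcl : IsClosed {x | V t x = V' t x} := isClosed_eq (V t).continuous (V' t).continuous
  refine hcl.closure_subset_iff.2 ?_ (hd x)
  rintro x ⟨y, hxy⟩
  exact key x y hxy t

end Group

end KGCircle

namespace KGCircle

/-! ## The generator of the Weyl group on exponential vectors -/

section Generator

open Filter Topology

variable {E H : Type*} [NormedAddCommGroup E] [InnerProductSpace ℂ E] [NormedAddCommGroup H]
  [InnerProductSpace ℂ H] {e : E → H}

theorem tendsto_slope_cexp (a : ℂ) :
    Tendsto (fun t : ℝ => ((t : ℂ))⁻¹ * (Complex.exp (t * a) - 1)) (𝓝[≠] 0) (𝓝 a) := by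
  have h : HasDerivAt (fun t : ℝ => Complex.exp (t * a)) a 0 := by
    have h1 : HasDerivAt (fun t : ℝ => (t : ℂ) * a) (1 * a) 0 :=
      (Complex.ofRealCLM.hasDerivAt (x := (0 : ℝ))).mul_const a
    simpa using h1.cexp
  have h2 := h.tendsto_slope_zero
  simpa using h2

variable [CompleteSpace H]

/-- The inner products `⟪q s, q t⟫` of difference quotients are explicit in the kernel and have a
joint limit `L` as `s` and `t` tend independently to zero. So `‖q s - q t‖ ^ 2` tends to `L - L - (L
- L) = 0`, and completeness of `H` gives the derivative. -/
theorem IsExponential.exists_hasDerivAt (he : IsExponential e) (φ ψ : E) :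
    ∃ y, HasDerivAt (fun t : ℝ => e (φ + (t : ℂ) • ψ)) y 0 := by
  set q : ℝ → H := fun t => ((t : ℂ))⁻¹ • (e (φ + (t : ℂ) • ψ) - e φ) with hq
  set F : Filter ℝ := 𝓝[≠] (0 : ℝ) with hF
  -- The mixed derivative in `s` and `t` at zero of `exp ⟪φ + s ψ, φ + t ψ⟫`.
  set L : ℂ := Complex.exp ⟪φ, φ⟫_ℂ * (⟪ψ, φ⟫_ℂ * ⟪φ, ψ⟫_ℂ + 1 * ⟪ψ, ψ⟫_ℂ) with hL
  have hne : ∀ᶠ t in F, t ≠ 0 := self_mem_nhdsWithin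
  have h0 : Tendsto (fun t : ℝ => t) F (𝓝 0) := tendsto_id'.2 nhdsWithin_le_nhds
  have hG : Tendsto (fun p : ℝ × ℝ => ⟪q p.1, q p.2⟫_ℂ) (F ×ˢ F) (𝓝 L) := by
    have t1 : Tendsto (fun p : ℝ × ℝ => p.1) (F ×ˢ F) F := tendsto_fst
    have t2 : Tendsto (fun p : ℝ × ℝ => p.2) (F ×ˢ F) F := tendsto_snd
    have n1 : ∀ᶠ p : ℝ × ℝ in F ×ˢ F, p.1 ≠ 0 := t1.eventually hne
    have n2 : ∀ᶠ p : ℝ × ℝ in F ×ˢ F, p.2 ≠ 0 := t2.eventually hne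
    have t3 : Tendsto (fun p : ℝ × ℝ => p.1 * p.2) (F ×ˢ F) F := by
      refine tendsto_nhdsWithin_iff.2 ⟨?_, ?_⟩
      · simpa using (h0.comp t1).mul (h0.comp t2)
      · filter_upwards [n1, n2] with p h1 h2 using mul_ne_zero h1 h2
    have c1 := (tendsto_slope_cexp ⟪ψ, φ⟫_ℂ).comp t1
    have c2 := (tendsto_slope_cexp ⟪φ, ψ⟫_ℂ).comp t2
    have c3 := (tendsto_slope_cexp ⟪ψ, ψ⟫_ℂ).comp t3
    have c4 : Tendsto (fun p : ℝ × ℝ => Complex.exp (p.1 * ⟪ψ, φ⟫_ℂ + p.2 * ⟪φ, ψ⟫_ℂ))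
        (F ×ˢ F) (𝓝 1) := by
      have hc : Continuous fun p : ℝ × ℝ => Complex.exp (p.1 * ⟪ψ, φ⟫_ℂ + p.2 * ⟪φ, ψ⟫_ℂ) := by
        fun_prop
      have h := (hc.tendsto (0, 0)).comp ((h0.comp t1).prodMk_nhds (h0.comp t2))
      simpa [Function.comp_def] using h
    have c5 := ((c1.mul c2).add (c4.mul c3)).const_mul (Complex.exp ⟪φ, φ⟫_ℂ)
    refine c5.congr' ?_
    filter_upwards [n1, n2] with p h1 h2
    have e1 : (p.1 : ℂ) ≠ 0 := Complex.ofReal_ne_zero.2 h1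
    have e2 : (p.2 : ℂ) ≠ 0 := Complex.ofReal_ne_zero.2 h2
    simp only [Function.comp_apply, hq, inner_smul_left, inner_smul_right, inner_sub_left,
      inner_sub_right, he.inner_eq, inner_add_left, inner_add_right, map_inv₀, Complex.conj_ofReal,
      Complex.ofReal_mul]
    have x1 : ⟪φ, φ⟫_ℂ + (p.1 : ℂ) * ⟪ψ, φ⟫_ℂ + ((p.2 : ℂ) * (⟪φ, ψ⟫_ℂ + (p.1 : ℂ) * ⟪ψ, ψ⟫_ℂ)) =
      ⟪φ, φ⟫_ℂ + ((p.1 : ℂ) * ⟪ψ, φ⟫_ℂ + (p.2 : ℂ) * ⟪φ, ψ⟫_ℂ) +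
        (p.1 : ℂ) * (p.2 : ℂ) * ⟪ψ, ψ⟫_ℂ := by ring
    rw [x1]
    simp only [Complex.exp_add]
    field_simp
    ring
  have hcau : Cauchy (F.map q) := by
    rw [cauchy_map_iff, tendsto_uniformity_iff_dist_tendsto_zero]
    refine ⟨inferInstance, ?_⟩
    have g1 := hG.comp (Tendsto.prodMk (tendsto_fst (f := F) (g := F)) tendsto_fst)
    have g2 := hG.comp (Tendsto.prodMk (tendsto_snd (f := F) (g := F)) tendsto_fst)
    have g3 := hG.comp (Tendsto.prodMk (tendsto_snd (f := F) (g := F)) tendsto_snd)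
    have g4 := (Complex.continuous_re.tendsto _).comp ((g1.sub hG).sub (g2.sub g3))
    have g5 := (Real.continuous_sqrt.tendsto _).comp g4
    simp only [sub_self, Complex.zero_re, Real.sqrt_zero] at g5
    refine g5.congr fun p => ?_
    simp only [Function.comp_apply]
    rw [← inner_sub_right, ← inner_sub_right, ← inner_sub_left, dist_eq_norm,
      @norm_eq_sqrt_re_inner ℂ]
    rfl
  obtain ⟨y, hy⟩ := CompleteSpace.complete hcau
  refine ⟨y, ?_⟩
  rw [hasDerivAt_iff_tendsto_slope_zero]
  refine (show Tendsto q F (𝓝 y) from hy).congr fun t => ?_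
  simp [hq, ← Complex.coe_smul]

/-- The derivative of `t ↦ e (φ + t ψ)` at `0`. -/
noncomputable def expDeriv (e : E → H) (φ ψ : E) : H :=
  deriv (fun t : ℝ => e (φ + (t : ℂ) • ψ)) 0

theorem IsExponential.hasDerivAt (he : IsExponential e) (φ ψ : E) :
    HasDerivAt (fun t : ℝ => e (φ + (t : ℂ) • ψ)) (expDeriv e φ ψ) 0 := by
  obtain ⟨y, hy⟩ := he.exists_hasDerivAt φ ψ
  rwa [expDeriv, hy.deriv]

/-- The generator of `t ↦ W[tψ]` on the exponential vector of `φ`. -/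
noncomputable def weylGen (e : E → H) (ψ φ : E) : H := ⟪ψ, φ⟫_ℂ • e φ - expDeriv e φ ψ

theorem IsExponential.hasDerivAt_weyl (he : IsExponential e) (ψ φ : E) :
    HasDerivAt (fun t : ℝ => weyl e ((t : ℂ) • ψ) (e φ)) (weylGen e ψ φ) 0 := by
  have h1 : HasDerivAt (fun t : ℝ => e (φ - (t : ℂ) • ψ)) (-expDeriv e φ ψ) 0 := by
    have h := he.hasDerivAt φ ψ
    rw [← neg_zero] at h
    have h2 := HasDerivAt.scomp (0 : ℝ) h (hasDerivAt_neg (0 : ℝ))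
    simpa [Function.comp_def, sub_eq_add_neg] using h2
  have h2 : HasDerivAt (fun t : ℝ => Complex.exp (t * ⟪ψ, φ⟫_ℂ - t * t * (⟪ψ, ψ⟫_ℂ / 2)))
      ⟪ψ, φ⟫_ℂ 0 := by
    have h0 := Complex.ofRealCLM.hasDerivAt (x := (0 : ℝ))
    have h3 := ((h0.mul_const ⟪ψ, φ⟫_ℂ).sub ((h0.mul h0).mul_const (⟪ψ, ψ⟫_ℂ / 2))).cexp
    simpa using h3
  have h3 := h2.smul h1
  simp only [Complex.ofReal_zero, zero_mul, sub_zero, Complex.exp_zero, one_smul, zero_smul] at h3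
  have h4 : weylGen e ψ φ = -expDeriv e φ ψ + ⟪ψ, φ⟫_ℂ • e φ := by rw [weylGen]; abel
  rw [h4]
  refine h3.congr_of_eventuallyEq (Eventually.of_forall fun t => ?_)
  simp only [he.weyl_coherent, inner_smul_left, inner_smul_right, Complex.conj_ofReal,
    Pi.smul_apply']
  congr 2
  ring

variable (e) in
/-- The one-parameter group `t ↦ W[tψ]`. -/
noncomputable def weylGroup (ψ : E) (t : ℝ) : H →L[ℂ] H := weyl e ((t : ℂ) • ψ)

theorem IsExponential.weylGroup_zero (he : IsExponential e) (ψ : E) : weylGroup e ψ 0 = 1 := by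
  simp [weylGroup, he.weyl_zero]

theorem IsExponential.weylGroup_add (he : IsExponential e) (ψ : E) (s t : ℝ) :
    weylGroup e ψ (s + t) = weylGroup e ψ s * weylGroup e ψ t := by
  have h : (⟪(s : ℂ) • ψ, (t : ℂ) • ψ⟫_ℂ).im = 0 := by
    rw [inner_smul_left, inner_smul_right, Complex.conj_ofReal, ← mul_assoc, ← Complex.ofReal_mul,
      Complex.im_ofReal_mul, show (⟪ψ, ψ⟫_ℂ).im = 0 from inner_self_im (𝕜 := ℂ) ψ, mul_zero]
  rw [weylGroup, weylGroup, weylGroup, he.weyl_mul, h]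
  simp [add_smul]

theorem IsExponential.weylGroup_mem_unitary (he : IsExponential e) (ψ : E) (t : ℝ) :
    weylGroup e ψ t ∈ unitary (H →L[ℂ] H) := he.weyl_mem_unitary _

theorem IsExponential.continuous_weylGroup (he : IsExponential e) (ψ : E) (x : H) :
    Continuous fun t => weylGroup e ψ t x :=
  (he.continuous_weyl_apply x).comp (by fun_prop)

theorem IsExponential.inner_weylGroup (he : IsExponential e) (ψ : E) (t : ℝ) (x y : H) :
    ⟪x, weylGroup e ψ t y⟫_ℂ = ⟪weylGroup e ψ (-t) x, y⟫_ℂ := by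
  rw [weylGroup, weylGroup, he.inner_weyl_left]
  simp

/-- The group permutes the rays of exponential vectors and commutes with its generator, so the same
scalar and the same `φ'` serve both vectors. Identities known only on exponential vectors can thus
be transported along the group. -/
theorem IsExponential.weylGroup_exp (he : IsExponential e) (ψ : E) (t : ℝ) (φ : E) :
    ∃ (κ : ℂ) (φ' : E), weylGroup e ψ t (e φ) = κ • e φ' ∧
      weylGroup e ψ t (weylGen e ψ φ) = κ • weylGen e ψ φ' := by
  refine ⟨_, _, he.weyl_coherent _ _, ?_⟩
  have h1 := hasDerivAt_group_apply (he.weylGroup_add ψ) (he.hasDerivAt_weyl ψ φ) t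
  refine h1.unique ?_
  have h2 : ∀ s, weylGroup e ψ s (weylGroup e ψ t (e φ)) = _ • weylGroup e ψ s (e _) := fun s =>
    (congrArg (weylGroup e ψ s) (he.weyl_coherent _ _)).trans (map_smul _ _ _)
  simp only [h2]
  exact (he.hasDerivAt_weyl ψ _).const_smul _

/-- A pair that is skew against the generator on exponential vectors alone already lies in the graph
of the generator: both sides of the integral equation for the orbit of `x` have the same inner
products with all `e φ`. -/
theorem IsExponential.hasDerivAt_weylGroup_of_skew (he : IsExponential e) {ψ : E} {x y : H}
    (h : ∀ φ, ⟪x, weylGen e ψ φ⟫_ℂ = -⟪y, e φ⟫_ℂ) :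
    HasDerivAt (fun t => weylGroup e ψ t x) y 0 := by
  have hc := he.continuous_weylGroup ψ y
  have hI : ∀ s, HasDerivAt (fun s => ∫ r in (0 : ℝ)..s, weylGroup e ψ r y)
      (weylGroup e ψ s y) s := fun s => (hc.integral_hasStrictDerivAt 0 s).hasDerivAt
  have key : ∀ s, weylGroup e ψ s x = x + ∫ r in (0 : ℝ)..s, weylGroup e ψ r y := by
    intro s
    have hz : innerSL ℂ (weylGroup e ψ s x - ∫ r in (0 : ℝ)..s, weylGroup e ψ r y) =
        innerSL ℂ x := by
      refine he.clm_ext fun φ => ?_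
      rw [innerSL_apply_apply, innerSL_apply_apply, ← inner_conj_symm _ (e φ),
        ← inner_conj_symm x]
      congr 1
      -- Moving the group to the other side gives the orbit of `e φ` at time `-s`, a multiple of
      -- some `e φ'`; the skewness hypothesis at `φ'` makes the derivative vanish.
      have hd : ∀ s, HasDerivAt (fun s => ⟪e φ, weylGroup e ψ s x -
          ∫ r in (0 : ℝ)..s, weylGroup e ψ r y⟫_ℂ) 0 s := by
        intro s
        have d1 : HasDerivAt (fun s => weylGroup e ψ (-s) (e φ))
            (-weylGroup e ψ (-s) (weylGen e ψ φ)) s := by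
          have := HasDerivAt.scomp s (hasDerivAt_group (he.weylGroup_add ψ)
            (he.hasDerivAt_weyl ψ φ) (-s)) (hasDerivAt_neg s)
          simpa [Function.comp_def] using this
        have d2 := d1.inner ℂ (hasDerivAt_const s x)
        have d3 := (hasDerivAt_const s (e φ)).inner ℂ (hI s)
        have d4 := d2.sub d3
        obtain ⟨κ, φ', h1, h2⟩ := he.weylGroup_exp ψ (-s) φ
        have h3 : ⟪weylGen e ψ φ', x⟫_ℂ = -⟪e φ', y⟫_ℂ := by
          rw [← inner_conj_symm, h, map_neg, inner_conj_symm]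
        have h4 : ⟪weylGroup e ψ (-s) (e φ), (0 : H)⟫_ℂ +
            ⟪-weylGroup e ψ (-s) (weylGen e ψ φ), x⟫_ℂ -
            (⟪e φ, weylGroup e ψ s y⟫_ℂ + ⟪(0 : H), ∫ r in (0 : ℝ)..s, weylGroup e ψ r y⟫_ℂ)
            = 0 := by
          rw [he.inner_weylGroup, h1, h2, inner_neg_left, inner_smul_left, inner_smul_left, h3]
          simp [mul_comm]
        rw [h4] at d4
        refine d4.congr_of_eventuallyEq (Eventually.of_forall fun s => ?_)
        simp only [inner_sub_right, Pi.sub_apply]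
        rw [he.inner_weylGroup]
      have h1 := is_const_of_deriv_eq_zero (fun t => (hd t).differentiableAt)
        (fun t => (hd t).deriv) s 0
      simp only [intervalIntegral.integral_same, sub_zero, he.weylGroup_zero,
        one_apply_eq_self] at h1
      exact h1
    have h2 : weylGroup e ψ s x - ∫ r in (0 : ℝ)..s, weylGroup e ψ r y = x := by
      refine ext_inner_right ℂ fun v => ?_
      exact DFunLike.congr_fun hz v
    rw [sub_eq_iff_eq_add] at h2
    exact h2
  have h1 := (hI 0).const_add x
  rw [he.weylGroup_zero] at h1
  exact h1.congr_of_eventuallyEq (Eventually.of_forall key)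

theorem IsExponential.dense_differentiable (he : IsExponential e) (ψ : E) :
    Dense {x : H | ∃ y, HasDerivAt (fun t => weylGroup e ψ t x) y 0} := by
  refine he.dense_span.mono fun x hx => ?_
  induction hx using Submodule.span_induction with
  | mem x hx =>
    obtain ⟨φ, rfl⟩ := hx
    exact ⟨_, he.hasDerivAt_weyl ψ φ⟩
  | zero => exact ⟨0, by simpa using hasDerivAt_const (0 : ℝ) (0 : H)⟩
  | add x y _ _ hx hy =>
    obtain ⟨x', hx'⟩ := hx
    obtain ⟨y', hy'⟩ := hy
    exact ⟨x' + y', (hx'.add hy').congr_of_eventuallyEq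
      (Eventually.of_forall fun t => map_add (weylGroup e ψ t) x y)⟩
  | smul c x _ hx =>
    obtain ⟨x', hx'⟩ := hx
    exact ⟨c • x', (hx'.const_smul c).congr_of_eventuallyEq
      (Eventually.of_forall fun t => map_smul (weylGroup e ψ t) c x)⟩

/-- Skewness puts the closure of `g` inside the graph of the generator `T`. For equality, `T - 1`
restricted to the closure of `g` is shown to be onto, while `T` itself, being skew, has no
eigenvector with eigenvalue one; hence `T` cannot be a proper extension. -/
theorem IsExponential.hasDerivAt_weylGroup_iff (he : IsExponential e) (ψ : E) {g : Set (H × H)}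
    (hzero : 0 ∈ g) (hadd : ∀ p ∈ g, ∀ q ∈ g, p + q ∈ g) (hsmul : ∀ (c : ℂ), ∀ p ∈ g, c • p ∈ g)
    (hmem : ∀ φ, (e φ, weylGen e ψ φ) ∈ closure g)
    (hskew : ∀ p ∈ g, ∀ φ, ⟪p.1, weylGen e ψ φ⟫_ℂ = -⟪p.2, e φ⟫_ℂ) (x y : H) :
    HasDerivAt (fun t => weylGroup e ψ t x) y 0 ↔ (x, y) ∈ closure g := by
  have hfwd : ∀ p ∈ closure g, HasDerivAt (fun t => weylGroup e ψ t p.1) p.2 0 := by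
    intro p hp
    refine he.hasDerivAt_weylGroup_of_skew fun φ => ?_
    have hcl : IsClosed {p : H × H | ⟪p.1, weylGen e ψ φ⟫_ℂ = -⟪p.2, e φ⟫_ℂ} :=
      isClosed_eq (by fun_prop) (by fun_prop)
    exact hcl.closure_subset_iff.2 (fun q hq => hskew q hq φ) hp
  refine ⟨fun hxy => ?_, fun h => hfwd _ h⟩
  set G : Submodule ℂ (H × H) := Submodule.topologicalClosure
    { carrier := g
      zero_mem' := hzero
      add_mem' := fun hp hq => hadd _ hp _ hq
      smul_mem' := fun c p hp => hsmul c p hp } with hGdef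
  have hG : ∀ p, p ∈ G ↔ p ∈ closure g := fun p => Iff.rfl
  have hGc : IsClosed (G : Set (H × H)) := Submodule.isClosed_topologicalClosure _
  have : CompleteSpace G := hGc.completeSpace_coe
  set D : G →L[ℂ] H := (ContinuousLinearMap.snd ℂ H H - ContinuousLinearMap.fst ℂ H H) ∘L
    G.subtypeL with hD
  have hDa : ∀ p : G, D p = p.1.2 - p.1.1 := fun p => rfl
  -- For a skew pair the cross term vanishes, so `‖y - x‖ ^ 2 = ‖y‖ ^ 2 + ‖x‖ ^ 2`; the norm on the
  -- graph is the maximum of the two. The range of `D` is therefore closed.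
  have hbound : ∀ p : G, ‖p‖ ≤ ‖D p‖ := by
    intro p
    have h1 := re_inner_eq_zero_of_hasDerivAt (he.weylGroup_zero ψ) (he.weylGroup_mem_unitary ψ)
      (hfwd p.1 p.2)
    have h2 : ‖D p‖ ^ 2 = ‖p.1.2‖ ^ 2 + ‖p.1.1‖ ^ 2 := by
      rw [hDa, @norm_sub_sq ℂ]
      have : RCLike.re ⟪p.1.2, p.1.1⟫_ℂ = 0 := by
        rw [inner_re_symm]
        exact h1
      rw [this]
      ring
    refine abs_le_of_sq_le_sq' ?_ (norm_nonneg _) |>.2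
    rw [h2]
    have h3 : ‖p‖ = max ‖p.1.1‖ ‖p.1.2‖ := rfl
    rw [h3]
    rcases max_choice ‖p.1.1‖ ‖p.1.2‖ with h | h <;> rw [h] <;>
      nlinarith [sq_nonneg ‖p.1.1‖, sq_nonneg ‖p.1.2‖]
  have hanti : AntilipschitzWith 1 D :=
    D.antilipschitz_of_bound fun p => by simpa using hbound p
  have hclosed : IsClosed (D.range : Set H) := by
    exact hanti.isClosed_range D.uniformContinuous
  have hdense : D.rangeᗮ = ⊥ := by
    rw [Submodule.eq_bot_iff]
    intro v hv
    rw [Submodule.mem_orthogonal'] at hv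
    have hv1 : ∀ φ, ⟪v, weylGen e ψ φ⟫_ℂ = ⟪v, e φ⟫_ℂ := by
      intro φ
      have := hv (D ⟨(e φ, weylGen e ψ φ), (hG _).2 (hmem φ)⟩) ⟨_, rfl⟩
      rw [hDa, inner_sub_right, sub_eq_zero] at this
      exact this
    -- Orthogonality to the range makes `⟪v, weylGroup e ψ t (e φ)⟫` grow like `exp t`, although it
    -- is bounded by unitarity.
    have hv2 : innerSL ℂ v = 0 := by
      refine he.clm_ext fun φ => ?_
      simp only [innerSL_apply_apply, zero_apply]
      have hd : ∀ t, HasDerivAt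
          (fun t : ℝ => Complex.exp (-t) * ⟪v, weylGroup e ψ t (e φ)⟫_ℂ) 0 t := by
        intro t
        have d1 := (hasDerivAt_const t v).inner ℂ (hasDerivAt_group (he.weylGroup_add ψ)
            (he.hasDerivAt_weyl ψ φ) t)
        have d2 : HasDerivAt (fun t : ℝ => Complex.exp (-t)) (Complex.exp (-t) * -1) t :=
          (Complex.ofRealCLM.hasDerivAt (x := t)).neg.cexp
        have d3 := d2.mul d1
        obtain ⟨κ, φ', h1, h2⟩ := he.weylGroup_exp ψ t φ
        have h3 : ⟪v, weylGroup e ψ t (weylGen e ψ φ)⟫_ℂ = ⟪v, weylGroup e ψ t (e φ)⟫_ℂ := by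
          rw [h1, h2, inner_smul_right, inner_smul_right, hv1]
        rw [h3, inner_zero_left] at d3
        refine d3.congr_deriv ?_
        rw [add_zero, mul_neg_one, neg_mul, neg_add_cancel]
      have hconst : ∀ t : ℝ, ⟪v, e φ⟫_ℂ =
          Complex.exp (-t) * ⟪v, weylGroup e ψ t (e φ)⟫_ℂ := fun t => by
        have := is_const_of_deriv_eq_zero (fun t => (hd t).differentiableAt)
          (fun t => (hd t).deriv) 0 t
        simpa [he.weylGroup_zero] using this
      have hle : ∀ t : ℝ, ‖⟪v, e φ⟫_ℂ‖ ≤ Real.exp (-t) * (‖v‖ * ‖e φ‖) := fun t => by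
        rw [hconst t, norm_mul, Complex.norm_exp]
        simp only [neg_re, ofReal_re]
        gcongr
        refine (norm_inner_le_norm _ _).trans ?_
        rw [norm_apply_of_mem_unitary (he.weylGroup_mem_unitary ψ t)]
      have hlim : Tendsto (fun t : ℝ => Real.exp (-t) * (‖v‖ * ‖e φ‖)) atTop (𝓝 0) := by
        simpa using Real.tendsto_exp_neg_atTop_nhds_zero.mul_const (‖v‖ * ‖e φ‖)
      exact norm_le_zero_iff.1 (ge_of_tendsto' hlim hle)
    have := DFunLike.congr_fun hv2 v
    simpa using this
  have htop : D.range = ⊤ := by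
    have h1 := (Submodule.topologicalClosure_eq_top_iff (K := D.range)).2 hdense
    rwa [IsClosed.submodule_topologicalClosure_eq hclosed] at h1
  obtain ⟨p, hp⟩ : y - x ∈ D.range := by rw [htop]; trivial
  have hp' : y - x = p.1.2 - p.1.1 := hp.symm
  have h1 := hxy.sub (hfwd p.1 p.2)
  have h2 : HasDerivAt (fun t => weylGroup e ψ t (x - p.1.1)) (y - p.1.2) 0 := by
    refine h1.congr_of_eventuallyEq (Eventually.of_forall fun t => ?_)
    simp
  have h3 : y - p.1.2 = x - p.1.1 := by
    rw [sub_eq_sub_iff_add_eq_add] at hp' ⊢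
    rw [hp', add_comm]
  -- The difference `x - p.1.1` is now an eigenvector of the generator with eigenvalue one, hence
  -- zero by skewness.
  rw [h3] at h2
  have h4 := re_inner_eq_zero_of_hasDerivAt (he.weylGroup_zero ψ) (he.weylGroup_mem_unitary ψ) h2
  have h5 : x - p.1.1 = 0 := by
    have := inner_self_eq_norm_sq (𝕜 := ℂ) (x - p.1.1)
    rw [show RCLike.re ⟪x - p.1.1, x - p.1.1⟫_ℂ = 0 from h4] at this
    exact norm_eq_zero.1 (pow_eq_zero_iff two_ne_zero |>.1 this.symm)
  have h6 : (x, y) = p.1 := by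
    rw [h5] at h3
    exact Prod.ext (sub_eq_zero.1 h5) (sub_eq_zero.1 h3)
  rw [h6]
  exact p.2

end Generator

end KGCircle

namespace KGCircle

/-! ## The field operators on Fock space -/

section Field

open Filter Topology

theorem summable_fock_sq (F : Fock) : Summable fun l => ‖F.1 l‖ ^ 2 := by
  have h := (hasSum_fock_inner F F).summable.norm
  refine h.congr fun l => ?_
  rw [norm_mul, norm_star, sq]

theorem summable_fock_mul (F G : Fock) : Summable fun l => ‖star (F.1 l) * G.1 l‖ :=
  (hasSum_fock_inner F G).summable.norm

theorem norm_mul_le_add_sq (a b : ℂ) : ‖a * b‖ ≤ ‖a‖ ^ 2 + ‖b‖ ^ 2 := by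
  rw [norm_mul]
  nlinarith [sq_nonneg (‖a‖ - ‖b‖), sq_nonneg ‖a‖, sq_nonneg ‖b‖]

theorem summable_annihilation (ψ : OneParticle) (F : Fock) (l : List ℤ) :
    Summable fun k => star (coord ψ k) * F.1 (k :: l) := by
  have hinj : Function.Injective fun k : ℤ => k :: l := fun a b h => (List.cons.inj h).1
  refine Summable.of_norm_bounded (g := fun k => ‖coord ψ k‖ ^ 2 + ‖F.1 (k :: l)‖ ^ 2)
    ((hasSum_norm_coord_sq ψ).summable.add ((summable_fock_sq F).comp_injective hinj)) fun k => ?_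
  rw [← norm_star (coord ψ k)]
  exact norm_mul_le_add_sq _ _

/-- Marking a letter of a word. -/
def markedWordEquiv : (Σ p : ℤ × List ℤ, Fin (p.2.length + 1)) ≃ Σ L : List ℤ, Fin L.length where
  toFun x := ⟨x.1.2.insertIdx x.2 x.1.1, ⟨x.2, by
    rw [List.length_insertIdx_of_le_length (Nat.lt_succ_iff.1 x.2.2)]; exact x.2.2⟩⟩
  invFun y := ⟨(y.1.get y.2, y.1.eraseIdx y.2), ⟨y.2, by
    have := y.2.2
    simp only [List.length_eraseIdx, this, if_true]
    omega⟩⟩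
  left_inv x := by
    obtain ⟨⟨k, l⟩, j⟩ := x
    have hl : (l.insertIdx j k).eraseIdx j = l := List.eraseIdx_insertIdx_self k
    refine Sigma.ext ?_ ?_
    · simp [hl]
    · refine (Fin.heq_ext_iff ?_).2 rfl
      simp [hl]
  right_inv y := by
    obtain ⟨L, j⟩ := y
    have hL : (L.eraseIdx j).insertIdx j (L.get j) = L := List.insertIdx_eraseIdx_getElem j.2
    refine Sigma.ext ?_ ?_
    · simpa using hL
    · refine (Fin.heq_ext_iff ?_).2 rfl
      exact congrArg List.length hL

/-- The sum over words with a marked letter is regrouped by the letter and the remaining word. By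
symmetry of `B` all `n + 1` insertion places contribute equally, and `(n + 1) / √(n + 1) = √(n +
1)`. Since `hasSum_annihilation` has the same value, creation and annihilation are formally adjoint.
-/
theorem hasSum_creation {ψ : OneParticle} {A : List ℤ → ℂ} {B : Fock}
    (hs : Summable fun p : ℤ × List ℤ =>
      ‖(Real.sqrt (p.2.length + 1) : ℂ) * (star (coord ψ p.1 * A p.2) * B.1 (p.1 :: p.2))‖) :
    HasSum (fun L => star (creation ψ A L) * B.1 L) (∑' p : ℤ × List ℤ,
      (Real.sqrt (p.2.length + 1) : ℂ) * (star (coord ψ p.1 * A p.2) * B.1 (p.1 :: p.2))) := by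
  set g : ℤ × List ℤ → ℂ := fun p => star (coord ψ p.1 * A p.2) * B.1 (p.1 :: p.2) with hg
  set f₂ : (Σ p : ℤ × List ℤ, Fin (p.2.length + 1)) → ℂ := fun x =>
    ((Real.sqrt (x.1.2.length + 1))⁻¹ : ℂ) * g x.1 with hf₂
  set f₁ : (Σ L : List ℤ, Fin L.length) → ℂ := fun y =>
    ((Real.sqrt y.1.length)⁻¹ : ℂ) * (star (coord ψ (y.1.get y.2) * A (y.1.eraseIdx y.2)) * B.1 y.1)
    with hf₁
  have hsqrt : ∀ n : ℕ, ((n + 1 : ℕ) : ℝ) * (Real.sqrt (n + 1))⁻¹ = Real.sqrt (n + 1) := by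
    intro n
    push_cast
    rw [← div_eq_mul_inv, Real.div_sqrt]
  have hsqrtC : ∀ n : ℕ, ((n + 1 : ℕ) : ℂ) * ((Real.sqrt (n + 1) : ℝ) : ℂ)⁻¹ =
      ((Real.sqrt (n + 1) : ℝ) : ℂ) := fun n => by exact_mod_cast hsqrt n
  have hfib : ∀ p : ℤ × List ℤ, HasSum (fun j : Fin (p.2.length + 1) => f₂ ⟨p, j⟩)
      ((Real.sqrt (p.2.length + 1) : ℂ) * g p) := by
    intro p
    convert! hasSum_fintype (fun j : Fin (p.2.length + 1) => f₂ ⟨p, j⟩) using 1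
    simp only [hf₂, Finset.sum_const, Finset.card_univ, Fintype.card_fin, nsmul_eq_mul]
    exact (by rw [← mul_assoc, hsqrtC] : _ = ((p.2.length + 1 : ℕ) : ℂ) *
      (((Real.sqrt (p.2.length + 1) : ℝ) : ℂ)⁻¹ * g p))
  have hsum₂ : Summable f₂ := by
    refine Summable.of_norm ?_
    rw [summable_sigma_of_nonneg fun _ => norm_nonneg _]
    refine ⟨fun p => Summable.of_finite, hs.congr fun p => ?_⟩
    rw [tsum_fintype]
    change ‖((Real.sqrt (p.2.length + 1) : ℝ) : ℂ) * g p‖ =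
      ∑ _ : Fin (p.2.length + 1), ‖((Real.sqrt (p.2.length + 1) : ℝ) : ℂ)⁻¹ * g p‖
    rw [Finset.sum_const, Finset.card_univ, Fintype.card_fin, nsmul_eq_mul, norm_mul _ (g p),
      norm_mul _ (g p), ← mul_assoc, norm_inv, Complex.norm_real, Real.norm_eq_abs,
      abs_of_nonneg (Real.sqrt_nonneg _), hsqrt]
  have htot : HasSum f₂ (∑' p : ℤ × List ℤ, (Real.sqrt (p.2.length + 1) : ℂ) * g p) :=
    HasSum.sigma_of_hasSum hs.of_norm.hasSum hfib hsum₂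
  have hcomp : f₁ ∘ markedWordEquiv = f₂ := by
    funext x
    obtain ⟨⟨k, l⟩, j⟩ := x
    have hj : (j : ℕ) ≤ l.length := Nat.lt_succ_iff.1 j.2
    have h1 : (l.insertIdx j k).length = l.length + 1 := List.length_insertIdx_of_le_length hj k
    have h2 : (l.insertIdx j k).eraseIdx j = l := List.eraseIdx_insertIdx_self k
    have h3 : B.1 (l.insertIdx j k) = B.1 (k :: l) := B.2 _ _ (List.perm_insertIdx k l hj)
    simp only [hf₁, hf₂, hg, Function.comp_apply, markedWordEquiv, Equiv.coe_fn_mk, h1, h2, h3,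
      List.get_eq_getElem, List.getElem_insertIdx_self]
    push_cast
    rfl
  rw [← hcomp, markedWordEquiv.hasSum_iff] at htot
  refine htot.sigma fun L => ?_
  convert! hasSum_fintype (fun j : Fin L.length => f₁ ⟨L, j⟩) using 1
  simp only [creation, hf₁, star_mul', star_sum, star_inv₀, Complex.star_def, Complex.conj_ofReal,
    Finset.mul_sum, Finset.sum_mul]
  refine Finset.sum_congr rfl fun j _ => ?_
  ring

theorem hasSum_annihilation {ψ : OneParticle} {A : List ℤ → ℂ} {B : Fock}
    (hs : Summable fun p : ℤ × List ℤ =>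
      ‖(Real.sqrt (p.2.length + 1) : ℂ) * (star (coord ψ p.1 * A p.2) * B.1 (p.1 :: p.2))‖) :
    HasSum (fun L => star (A L) * annihilation ψ B.1 L) (∑' p : ℤ × List ℤ,
      (Real.sqrt (p.2.length + 1) : ℂ) * (star (coord ψ p.1 * A p.2) * B.1 (p.1 :: p.2))) := by
  have h := hs.of_norm.hasSum
  rw [← (Equiv.prodComm (List ℤ) ℤ).hasSum_iff] at h
  refine h.prod_fiberwise fun l => ?_
  have h1 := ((summable_annihilation ψ B l).hasSum.mul_left
    (Real.sqrt (l.length + 1) : ℂ)).mul_left (star (A l))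
  refine h1.congr_fun fun k => ?_
  simp only [Function.comp_apply, Equiv.prodComm_apply, Prod.swap_prod_mk, star_mul']
  ring

theorem sqrt_mul_cohCoeff_cons (c : ℤ → ℂ) (k : ℤ) (l : List ℤ) :
    (Real.sqrt (l.length + 1) : ℂ) * cohCoeff c (k :: l) = c k * cohCoeff c l := by
  have h1 : Real.sqrt (l.length + 1) ≠ 0 := (Real.sqrt_pos.2 (by positivity)).ne'
  have h2 : Real.sqrt ((k :: l).length.factorial : ℝ) =
      Real.sqrt (l.length + 1) * Real.sqrt (l.length.factorial : ℝ) := by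
    rw [List.length_cons, Nat.factorial_succ, Nat.cast_mul, Real.sqrt_mul (by positivity)]
    push_cast
    rfl
  have h1' : (Real.sqrt (l.length + 1) : ℂ) ≠ 0 := by exact_mod_cast h1
  rw [cohCoeff, cohCoeff, h2, List.map_cons, List.prod_cons]
  push_cast
  field_simp

theorem annihilation_coherent (ψ φ : OneParticle) (l : List ℤ) :
    annihilation ψ (coherent φ).1 l = ⟪ψ, φ⟫_ℂ * (coherent φ).1 l := by
  rw [annihilation, ← tsum_mul_left, ← (hasSum_coord_inner ψ φ).tsum_eq, ← tsum_mul_right]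
  congr 1
  funext k
  rw [coherent_apply, coherent_apply, mul_left_comm, sqrt_mul_cohCoeff_cons]
  ring

theorem hasDerivAt_list_prod (a b : ℤ → ℂ) (l : List ℤ) :
    HasDerivAt (fun t : ℝ => (l.map fun k => a k + (t : ℂ) * b k).prod)
      (∑ j : Fin l.length, b (l.get j) * ((l.eraseIdx j).map a).prod) 0 := by
  induction l with
  | nil => simpa using hasDerivAt_const (0 : ℝ) (1 : ℂ)
  | cons k l ih =>
    have h1 : HasDerivAt (fun t : ℝ => a k + (t : ℂ) * b k) (b k) 0 := by
      simpa using ((Complex.ofRealCLM.hasDerivAt (x := (0 : ℝ))).mul_const (b k)).const_add (a k)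
    have h2 := h1.mul ih
    simp only [List.map_cons, List.prod_cons]
    refine h2.congr_deriv ?_
    simp only [List.length_cons, Fin.sum_univ_succ, List.get_eq_getElem, Fin.val_zero,
      List.getElem_cons_zero, List.eraseIdx_cons_zero, Fin.val_succ, List.getElem_cons_succ,
      List.eraseIdx_cons_succ, List.map_cons, List.prod_cons, Complex.ofReal_zero, zero_mul,
      add_zero, Finset.mul_sum]
    congr 1
    refine Finset.sum_congr rfl fun j _ => ?_
    ring

theorem creation_cohCoeff (ψ : OneParticle) (c : ℤ → ℂ) (l : List ℤ) :
    creation ψ (cohCoeff c) l = ((Real.sqrt l.length.factorial)⁻¹ : ℂ) *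
      ∑ j : Fin l.length, coord ψ (l.get j) * ((l.eraseIdx j).map c).prod := by
  rw [creation, Finset.mul_sum, Finset.mul_sum]
  refine Finset.sum_congr rfl fun j _ => ?_
  have hj := j.2
  obtain ⟨n, hn⟩ : ∃ n, l.length = n + 1 := ⟨l.length - 1, by omega⟩
  have h1 : (l.eraseIdx j).length = n := by
    rw [List.length_eraseIdx, if_pos hj]
    omega
  have h2 : Real.sqrt ((n + 1).factorial : ℝ) =
      Real.sqrt ((n + 1 : ℕ) : ℝ) * Real.sqrt (n.factorial : ℝ) := by
    rw [Nat.factorial_succ, Nat.cast_mul, Real.sqrt_mul (by positivity)]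
  have h3 : Real.sqrt (l.length.factorial : ℝ) =
      Real.sqrt (l.length : ℝ) * Real.sqrt (n.factorial : ℝ) := by rw [hn, h2]
  rw [cohCoeff, h1, h3, Complex.ofReal_mul, mul_inv]
  ring

/-- Each coefficient of a coherent vector is a product over letters; the Leibniz rule yields a sum
over the position of the letter replaced, which is the creation operator. The abstract generator is
thereby identified with `a(ψ) - a*(ψ)`. -/
theorem expDeriv_coherent_apply (φ ψ : OneParticle) (l : List ℤ) :
    (expDeriv coherent φ ψ).1 l = creation ψ (coherent φ).1 l := by
  have h1 := isExponential_coherent.hasDerivAt φ ψ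
  have h2 : HasDerivAt (fun t : ℝ => (coherent (φ + (t : ℂ) • ψ)).1 l)
      ((expDeriv coherent φ ψ).1 l) 0 :=
    ((fockEval l).restrictScalars ℝ).hasFDerivAt.comp_hasDerivAt 0 h1
  have h3 := (hasDerivAt_list_prod (coord φ) (coord ψ) l).const_mul
    ((Real.sqrt l.length.factorial)⁻¹ : ℂ)
  have h4 : (fun t : ℝ => (coherent (φ + (t : ℂ) • ψ)).1 l) = fun t : ℝ =>
      ((Real.sqrt l.length.factorial)⁻¹ : ℂ) *
        (l.map fun k => coord φ k + (t : ℂ) * coord ψ k).prod := by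
    funext t
    have h : coord (φ + (t : ℂ) • ψ) = fun k => coord φ k + (t : ℂ) * coord ψ k :=
      funext fun k => by rw [coord_add, coord_smul]
    rw [coherent_apply, cohCoeff, h]
  rw [h4] at h2
  rw [h2.unique h3]
  exact (creation_cohCoeff ψ (coord φ) l).symm

theorem weylGen_coherent_apply (ψ φ : OneParticle) (l : List ℤ) :
    (weylGen coherent ψ φ).1 l = ⟪ψ, φ⟫_ℂ * (coherent φ).1 l - creation ψ (coherent φ).1 l := by
  rw [← expDeriv_coherent_apply]
  rfl

theorem fieldGraph_zero (ψ : OneParticle) : (0 : Fock × Fock) ∈ fieldGraph ψ := by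
  refine ⟨⟨0, fun _ _ => rfl⟩, fun l => ?_⟩
  have h' : ∀ l, (0 : Fock × Fock).2.1 l = 0 := fun _ => rfl
  rw [h', annihilation, creation]
  simp

theorem fieldGraph_add {ψ : OneParticle} {p q : Fock × Fock} (hp : p ∈ fieldGraph ψ)
    (hq : q ∈ fieldGraph ψ) : p + q ∈ fieldGraph ψ := by
  obtain ⟨⟨N, hN⟩, h1⟩ := hp
  obtain ⟨⟨M, hM⟩, h2⟩ := hq
  have e1 : ∀ l, (p + q).1.1 l = p.1.1 l + q.1.1 l := fun _ => rfl
  have e2 : ∀ l, (p + q).2.1 l = p.2.1 l + q.2.1 l := fun _ => rfl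
  refine ⟨⟨max N M, fun l hl => ?_⟩, fun l => ?_⟩
  · rw [max_lt_iff] at hl
    rw [e1, hN l hl.1, hM l hl.2, add_zero]
  · rw [e2, h1, h2]
    simp only [annihilation, creation, e1, mul_add, Finset.sum_add_distrib]
    rw [(summable_annihilation ψ p.1 l).tsum_add (summable_annihilation ψ q.1 l)]
    ring

theorem fieldGraph_smul {ψ : OneParticle} (c : ℂ) {p q : Fock × Fock} (hp : p ∈ fieldGraph ψ)
    (e1 : ∀ l, q.1.1 l = c * p.1.1 l) (e2 : ∀ l, q.2.1 l = c * p.2.1 l) : q ∈ fieldGraph ψ := by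
  obtain ⟨⟨N, hN⟩, h1⟩ := hp
  refine ⟨⟨N, fun l hl => by rw [e1, hN l hl, mul_zero]⟩, fun l => ?_⟩
  rw [e2, h1]
  simp only [annihilation, creation, e1, mul_left_comm _ c, tsum_mul_left, ← Finset.mul_sum]
  ring

/-- Truncation to at most `N` particles. -/
noncomputable def trunc (N : ℕ) (F : Fock) : Fock :=
  ⟨⟨fun l => if l.length ≤ N then F.1 l else 0, by
    refine memℓp_gen ?_
    have h : Summable fun l => ‖F.1 l‖ ^ 2 := summable_fock_sq F
    refine Summable.of_nonneg_of_le (fun _ => by positivity) (fun l => ?_) h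
    norm_num
    split_ifs
    · exact le_rfl
    · simp⟩, fun l l' h => by
    change (if _ then _ else _) = (if _ then _ else _)
    rw [h.length_eq, F.2 l l' h]⟩

theorem trunc_apply (N : ℕ) (F : Fock) (l : List ℤ) :
    (trunc N F).1 l = if l.length ≤ N then F.1 l else 0 := rfl

theorem tendsto_trunc (F : Fock) : Tendsto (fun N => trunc N F) atTop (𝓝 F) := by
  rw [tendsto_iff_norm_sub_tendsto_zero]
  have h1 : ∀ N, ‖trunc N F - F‖ ^ 2 = ∑' l, ‖(trunc N F - F).1 l‖ ^ 2 := by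
    intro N
    have h2 := hasSum_fock_inner (trunc N F - F) (trunc N F - F)
    have h3 : ⟪trunc N F - F, trunc N F - F⟫_ℂ = ((‖trunc N F - F‖ ^ 2 : ℝ) : ℂ) := by
      have := inner_self_eq_norm_sq_to_K (𝕜 := ℂ) (trunc N F - F)
      rw [this]
      simp
    rw [h3] at h2
    have h4 : HasSum (fun l => ‖(trunc N F - F).1 l‖ ^ 2) (‖trunc N F - F‖ ^ 2) := by
      refine Complex.hasSum_ofReal.1 (h2.congr_fun fun l => ?_)
      rw [mul_comm]
      simpa using (Complex.mul_conj' ((trunc N F - F).1 l)).symm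
    exact h4.tsum_eq.symm
  have h2 : Tendsto (fun N => ∑' l, ‖(trunc N F - F).1 l‖ ^ 2) atTop
      (𝓝 (∑' _ : List ℤ, (0 : ℝ))) := by
    refine tendsto_tsum_of_dominated_convergence (summable_fock_sq F) (fun l => ?_) ?_
    · refine tendsto_const_nhds.congr' ?_
      filter_upwards [eventually_ge_atTop l.length] with N hN
      have : (trunc N F - F).1 l = (trunc N F).1 l - F.1 l := rfl
      rw [this, trunc_apply, if_pos hN]
      simp
    · refine Eventually.of_forall fun N l => ?_
      have : (trunc N F - F).1 l = (trunc N F).1 l - F.1 l := rfl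
      rw [this, trunc_apply]
      split_ifs <;> simp
  rw [tsum_zero] at h2
  have h3 := (Real.continuous_sqrt.tendsto 0).comp h2
  rw [Real.sqrt_zero] at h3
  refine h3.congr fun N => ?_
  rw [Function.comp_apply, ← h1, Real.sqrt_sq (norm_nonneg _)]

/-- A coherent vector generally has components of every particle number, so it is reached by
truncation. -/
theorem coherent_mem_closure_fieldGraph (ψ φ : OneParticle) :
    (coherent φ, weylGen coherent ψ φ) ∈ closure (fieldGraph ψ) := by
  obtain ⟨c, hc⟩ : ∃ c : Fock, ∀ l, c.1 l = ⟪ψ, φ⟫_ℂ * (coherent φ).1 l :=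
    ⟨⟪ψ, φ⟫_ℂ • coherent φ, fun _ => rfl⟩
  have hgen : weylGen coherent ψ φ = c - expDeriv coherent φ ψ := fock_ext fun l => by
    rw [weylGen_coherent_apply, ← hc, ← expDeriv_coherent_apply]
    rfl
  -- Cutting at `N + 1` particles cuts the annihilation part at `N` and the creation part at `N +
  -- 2`.
  have hmem : ∀ N, (trunc (N + 1) (coherent φ),
      trunc N c - trunc (N + 2) (expDeriv coherent φ ψ)) ∈ fieldGraph ψ := by
    intro N
    refine ⟨⟨N + 1, fun l hl => if_neg (by omega)⟩, fun l => ?_⟩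
    have e0 : (trunc N c - trunc (N + 2) (expDeriv coherent φ ψ)).1 l =
        (trunc N c).1 l - (trunc (N + 2) (expDeriv coherent φ ψ)).1 l := rfl
    change (trunc N c - trunc (N + 2) (expDeriv coherent φ ψ)).1 l = _
    rw [e0, trunc_apply, trunc_apply, expDeriv_coherent_apply, hc, ← annihilation_coherent]
    congr 1
    · simp only [annihilation, trunc_apply, List.length_cons, add_le_add_iff_right]
      split_ifs <;> simp
    · simp only [creation, trunc_apply]
      split_ifs with h
      · congr 1
        refine Finset.sum_congr rfl fun j _ => ?_
        rw [if_pos]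
        rw [List.length_eraseIdx, if_pos j.2]
        omega
      · rw [Finset.sum_eq_zero, mul_zero]
        intro j _
        rw [if_neg, mul_zero]
        rw [List.length_eraseIdx, if_pos j.2]
        omega
  have hlim : Tendsto (fun N => (trunc (N + 1) (coherent φ),
      trunc N c - trunc (N + 2) (expDeriv coherent φ ψ))) atTop
      (𝓝 (coherent φ, weylGen coherent ψ φ)) := by
    rw [hgen]
    refine Tendsto.prodMk_nhds ((tendsto_trunc _).comp (tendsto_add_atTop_nat 1))
      ((tendsto_trunc c).sub ((tendsto_trunc _).comp (tendsto_add_atTop_nat 2)))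
  exact mem_closure_of_tendsto hlim (Eventually.of_forall hmem)

/-- Formal adjointness of creation and annihilation, used once in each direction; the work lies in
the absolute convergence of the two double sums. -/
theorem fieldGraph_skew {ψ : OneParticle} {p : Fock × Fock} (hp : p ∈ fieldGraph ψ)
    (φ : OneParticle) : ⟪p.1, weylGen coherent ψ φ⟫_ℂ = -⟪p.2, coherent φ⟫_ℂ := by
  obtain ⟨F, Y⟩ := p
  obtain ⟨-, hY⟩ := hp
  simp only at hY ⊢
  have hs1 : Summable fun p : ℤ × List ℤ => ‖(Real.sqrt (p.2.length + 1) : ℂ) *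
      (star (coord ψ p.1 * F.1 p.2) * (coherent φ).1 (p.1 :: p.2))‖ := by
    have h := Summable.mul_norm (summable_norm_coord_mul ψ φ) (summable_fock_mul F (coherent φ))
    refine h.congr fun p => ?_
    congr 1
    rw [coherent_apply, coherent_apply, mul_left_comm ((Real.sqrt (p.2.length + 1) : ℝ) : ℂ),
      sqrt_mul_cohCoeff_cons, star_mul']
    ring
  have hs2 : Summable fun p : ℤ × List ℤ => ‖(Real.sqrt (p.2.length + 1) : ℂ) *
      (star (coord ψ p.1 * (coherent φ).1 p.2) * F.1 (p.1 :: p.2))‖ := by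
    have hinj : Function.Injective fun p : ℤ × List ℤ => p.1 :: p.2 := fun a b h =>
      Prod.ext (List.cons.inj h).1 (List.cons.inj h).2
    -- The number factor is absorbed by rescaling: `n + 1 ≤ 2 ^ n`, and multiplying the `n`-particle
    -- part by `√2 ^ n` gives the coherent vector of `√2 φ`.
    have hl : Summable fun l : List ℤ => ‖(Real.sqrt (l.length + 1) : ℂ) * (coherent φ).1 l‖ ^ 2 := by
      refine Summable.of_nonneg_of_le (fun _ => by positivity) (fun l => ?_)
        (summable_fock_sq (coherent ((Real.sqrt 2 : ℂ) • φ)))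
      have h1 : (coherent ((Real.sqrt 2 : ℂ) • φ)).1 l =
          (Real.sqrt 2 : ℂ) ^ l.length * (coherent φ).1 l := by
        rw [coherent_apply, coherent_apply, cohCoeff, cohCoeff]
        have : (l.map (coord ((Real.sqrt 2 : ℂ) • φ))).prod =
            (Real.sqrt 2 : ℂ) ^ l.length * (l.map (coord φ)).prod := by
          have h : coord ((Real.sqrt 2 : ℂ) • φ) = fun k => (Real.sqrt 2 : ℂ) * coord φ k :=
            funext (coord_smul _ _)
          rw [h, List.prod_map_mul, List.map_const', List.prod_replicate]
        rw [this]
        ring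
      rw [h1, norm_mul, norm_mul, mul_pow, mul_pow, norm_pow, ← pow_mul, mul_comm l.length, pow_mul]
      gcongr
      simp only [Complex.norm_real, Real.norm_eq_abs, sq_abs]
      rw [Real.sq_sqrt (by positivity), Real.sq_sqrt (by positivity)]
      exact_mod_cast Nat.lt_two_pow_self (n := l.length)
    have h1 := (Summable.mul_of_nonneg (hasSum_norm_coord_sq ψ).summable hl
      (fun _ => by positivity) (fun _ => by positivity)).add
      ((summable_fock_sq F).comp_injective hinj)
    refine Summable.of_nonneg_of_le (fun _ => norm_nonneg _) (fun p => ?_) h1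
    have h2 := norm_mul_le_add_sq (star (coord ψ p.1) *
      star ((Real.sqrt (p.2.length + 1) : ℂ) * (coherent φ).1 p.2)) (F.1 (p.1 :: p.2))
    rw [norm_mul (star (coord ψ p.1)), norm_star, norm_star, mul_pow] at h2
    refine le_trans (le_of_eq ?_) h2
    congr 1
    simp only [star_mul', Complex.star_def, Complex.conj_ofReal]
    ring
  have a1 := hasSum_annihilation hs1
  have c1 := hasSum_creation hs1
  have a2 := hasSum_annihilation hs2
  have c2 := hasSum_creation hs2
  have hFe : HasSum (fun l => star (F.1 l) * annihilation ψ (coherent φ).1 l)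
      (⟪ψ, φ⟫_ℂ * ⟪F, coherent φ⟫_ℂ) := by
    refine ((hasSum_fock_inner F (coherent φ)).mul_left ⟪ψ, φ⟫_ℂ).congr_fun fun l => ?_
    rw [annihilation_coherent]
    ring
  have hx1 := a1.unique hFe
  rw [hx1] at c1
  set X := ∑' p : ℤ × List ℤ, (Real.sqrt (p.2.length + 1) : ℂ) *
      (star (coord ψ p.1 * (coherent φ).1 p.2) * F.1 (p.1 :: p.2))
  have a3 := a2.star
  have c3 := c2.star
  have hl : HasSum (fun l => star (F.1 l) * (weylGen coherent ψ φ).1 l)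
      (⟪ψ, φ⟫_ℂ * ⟪F, coherent φ⟫_ℂ - star X) := by
    refine (hFe.sub c3).congr_fun fun l => ?_
    rw [weylGen_coherent_apply, annihilation_coherent, star_mul', star_star]
    ring
  have hr : HasSum (fun l => star (Y.1 l) * (coherent φ).1 l)
      (star X - ⟪ψ, φ⟫_ℂ * ⟪F, coherent φ⟫_ℂ) := by
    refine (a3.sub c1).congr_fun fun l => ?_
    rw [hY, star_mul', star_star, star_sub]
    ring
  rw [(hasSum_fock_inner F _).unique hl, (hasSum_fock_inner Y _).unique hr]
  ring

/-- `weylOp ψ` acts on the coherent vectors as the Weyl operator `weyl`. -/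
theorem weylOp_eq (ψ : OneParticle) : weylOp ψ = weyl coherent ψ := by
  have he := isExponential_coherent
  have hgen := he.hasDerivAt_weylGroup_iff ψ (g := fieldGraph ψ) (fieldGraph_zero ψ)
    (fun _ hp _ hq => fieldGraph_add hp hq)
    (fun c _ hp => fieldGraph_smul c hp (fun _ => rfl) (fun _ => rfl))
    (coherent_mem_closure_fieldGraph ψ) (fun _ hp => fieldGraph_skew hp)
  have hex : IsUnitaryExp (closure (fieldGraph ψ)) (weyl coherent ψ) :=
    ⟨weylGroup coherent ψ, he.weylGroup_zero ψ, he.weylGroup_add ψ, he.weylGroup_mem_unitary ψ,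
      he.continuous_weylGroup ψ, hgen, by simp [weylGroup]⟩
  have h : ∃ U, IsUnitaryExp (closure (fieldGraph ψ)) U := ⟨_, hex⟩
  rw [weylOp, dif_pos h]
  -- The chosen exponential comes from some unitary group with the same generator; uniqueness of the
  -- group identifies it.
  obtain ⟨V, h0, hadd, hu, -, hg, h1⟩ := h.choose_spec
  rw [← h1]
  have hV : weylGroup coherent ψ = V := by
    refine group_eq_of_hasDerivAt (he.weylGroup_zero ψ) (he.weylGroup_add ψ) h0 hadd hu
      (fun x y hxy => (hg x y).2 ((hgen x y).1 hxy)) ?_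
    exact he.dense_differentiable ψ
  rw [← hV]
  simp [weylGroup]

end Field

end KGCircle

namespace KGCircle

/-! ## The one-particle structure -/

section OneParticleStructure

/-- The eigenvalue of `A^α` at `mode k`. -/
noncomputable def wt (m α : ℝ) (k : ℤ) : ℝ := ((k : ℝ) ^ 2 + m ^ 2) ^ α

theorem wt_pos {m : ℝ} (hm : 0 < m) (α : ℝ) (k : ℤ) : 0 < wt m α k :=
  Real.rpow_pos_of_pos (by positivity) _

theorem wt_neg (m α : ℝ) (k : ℤ) : wt m α (-k) = wt m α k := by simp [wt]

theorem wt_mul_wt_neg {m : ℝ} (hm : 0 < m) (α : ℝ) (k : ℤ) : wt m α k * wt m (-α) k = 1 := by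
  rw [wt, wt, ← Real.rpow_add (by positivity), add_neg_cancel, Real.rpow_zero]

theorem memℓp_of_mem_domA {m α : ℝ} {ψ : OneParticle} (hψ : ψ ∈ domA m α) :
    Memℓp (fun k => (wt m α k : ℂ) * coord ψ k) 2 := by
  refine memℓp_gen ?_
  have h : Summable fun k : ℤ => ‖(wt m α k : ℂ) * coord ψ k‖ ^ 2 := hψ
  simpa using h

theorem coord_powA {m α : ℝ} {ψ : OneParticle} (hψ : ψ ∈ domA m α) (k : ℤ) :
    coord (powA m α ψ) k = wt m α k * coord ψ k := by
  have h := modeBasis.hasSum_repr_symm ⟨_, memℓp_of_mem_domA hψ⟩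
  have h2 : powA m α ψ = modeBasis.repr.symm ⟨_, memℓp_of_mem_domA hψ⟩ := by
    rw [← h.tsum_eq, coe_modeBasis]
    rfl
  rw [h2, coord_eq_repr, LinearIsometryEquiv.apply_symm_apply]

theorem mem_domA_of_nonpos {m α : ℝ} (hm : 0 < m) (hα : α ≤ 0) (ψ : OneParticle) :
    ψ ∈ domA m α := by
  change Summable fun k : ℤ => ‖(wt m α k : ℂ) * coord ψ k‖ ^ 2
  refine Summable.of_nonneg_of_le (fun _ => by positivity) (fun k => ?_)
    ((hasSum_norm_coord_sq ψ).summable.mul_left (((m ^ 2) ^ α) ^ 2))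
  rw [norm_mul, mul_pow, Complex.norm_real, Real.norm_of_nonneg (wt_pos hm α k).le]
  gcongr
  · exact (wt_pos hm α k).le
  · exact Real.rpow_le_rpow_of_nonpos (by positivity) (by nlinarith [sq_nonneg (k : ℝ)]) hα

theorem inner_powA_powA_neg {m α : ℝ} (hm : 0 < m) {φ ψ : OneParticle} (hφ : φ ∈ domA m α)
    (hψ : ψ ∈ domA m (-α)) : ⟪powA m α φ, powA m (-α) ψ⟫_ℂ = ⟪φ, ψ⟫_ℂ := by
  refine (hasSum_coord_inner _ _).unique ((hasSum_coord_inner φ ψ).congr_fun fun k => ?_)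
  rw [coord_powA hφ, coord_powA hψ, star_mul', Complex.star_def, Complex.conj_ofReal]
  have h : (wt m α k : ℂ) * wt m (-α) k = 1 := by exact_mod_cast wt_mul_wt_neg hm α k
  linear_combination (starRingEnd ℂ (coord φ k) * coord ψ k) * h

/-! ### Fourier coefficients of real functions -/

theorem coe_mode (k : ℤ) :
    mode k =ᵐ[volume] fun θ : S1 => ((Real.sqrt (2 * Real.pi))⁻¹ : ℂ) * fourier k θ := by
  filter_upwards [Lp.coeFn_smul ((Real.sqrt (2 * Real.pi))⁻¹ : ℂ)
      (ContinuousMap.toLp (E := ℂ) 2 (volume : Measure S1) ℂ (fourier k)),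
    ContinuousMap.coeFn_toLp (p := 2) (𝕜 := ℂ) (volume : Measure S1) (fourier k)] with θ h1 h2
  rw [mode, h1, Pi.smul_apply, h2, smul_eq_mul]

theorem coe_toL2 (f : S1 → ℝ) (hf : MemLp f 2 volume) :
    toL2 f hf =ᵐ[volume] fun θ => (f θ : ℂ) := MemLp.coeFn_toLp _

theorem coord_toL2 (f : S1 → ℝ) (hf : MemLp f 2 volume) (k : ℤ) :
    coord (toL2 f hf) k =
      ((Real.sqrt (2 * Real.pi))⁻¹ : ℂ) * ∫ θ : S1, fourier (-k) θ * (f θ : ℂ) := by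
  rw [coord, L2.inner_def, ← integral_const_mul]
  refine integral_congr_ae ?_
  filter_upwards [coe_mode k, coe_toL2 f hf] with θ h1 h2
  rw [h1, h2, RCLike.inner_apply', map_mul, map_inv₀, Complex.conj_ofReal, fourier_neg]
  ring

theorem coord_toL2_neg (f : S1 → ℝ) (hf : MemLp f 2 volume) (k : ℤ) :
    coord (toL2 f hf) (-k) = star (coord (toL2 f hf) k) := by
  rw [coord_toL2, coord_toL2, star_mul', Complex.star_def, map_inv₀, Complex.conj_ofReal,
    ← integral_conj, neg_neg]
  congr 2
  funext θ
  rw [map_mul, Complex.conj_ofReal, fourier_neg, Complex.conj_conj]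

theorem inner_toL2 (f g : S1 → ℝ) (hf : MemLp f 2 volume) (hg : MemLp g 2 volume) :
    ⟪toL2 f hf, toL2 g hg⟫_ℂ = ((∫ θ : S1, f θ * g θ : ℝ) : ℂ) := by
  rw [L2.inner_def, ← integral_complex_ofReal]
  refine integral_congr_ae ?_
  filter_upwards [coe_toL2 f hf, coe_toL2 g hg] with θ h1 h2
  rw [h1, h2, RCLike.inner_apply', Complex.conj_ofReal, Complex.ofReal_mul]

/-- Real functions have conjugate coefficients at `k` and `-k`, and the weights are even; reindexing
by `-k` therefore conjugates the sum. -/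
theorem inner_powA_toL2_im {m α β : ℝ} {f g : S1 → ℝ} {hf : MemLp f 2 volume}
    {hg : MemLp g 2 volume} (hf' : toL2 f hf ∈ domA m α) (hg' : toL2 g hg ∈ domA m β) :
    (⟪powA m α (toL2 f hf), powA m β (toL2 g hg)⟫_ℂ).im = 0 := by
  rw [← Complex.conj_eq_iff_im]
  have h := hasSum_coord_inner (powA m α (toL2 f hf)) (powA m β (toL2 g hg))
  have h' := h.star
  rw [← (Equiv.neg ℤ).hasSum_iff] at h
  refine h'.unique (h.congr_fun fun k => ?_)
  simp only [Function.comp_apply, Equiv.neg_apply, coord_powA hf', coord_powA hg', wt_neg,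
    coord_toL2_neg, star_mul', Complex.star_def, Complex.conj_ofReal]

/-! ### Smooth functions -/

theorem mode_fourier_coe (k : ℤ) (x : ℝ) :
    fourier k (x : S1) = Complex.exp (I * k * x) := by
  rw [fourier_coe_apply]
  congr 1
  have : (Real.pi : ℂ) ≠ 0 := by exact_mod_cast Real.pi_ne_zero
  push_cast
  field_simp

theorem smoothFun_contDiff (Φ : SmoothFun) :
    ContDiff ℝ (⊤ : ℕ∞) (fun x : ℝ => (Φ : S1 → ℝ) (x : S1)) := Φ.2

theorem smoothFun_periodic (Φ : SmoothFun) :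
    Function.Periodic (fun x : ℝ => (Φ : S1 → ℝ) (x : S1)) (2 * Real.pi) := fun x => by
  simp only [AddCircle.coe_add_period]

/-- The smooth function on the circle with a given smooth periodic lift. -/
noncomputable def SmoothFun.ofPeriodic (f : ℝ → ℝ) (hf : ContDiff ℝ (⊤ : ℕ∞) f)
    (hp : Function.Periodic f (2 * Real.pi)) : SmoothFun :=
  ⟨hp.lift, by
    change ContDiff ℝ (⊤ : ℕ∞) fun x : ℝ => hp.lift (x : S1)
    simpa using hf⟩

theorem SmoothFun.ofPeriodic_coe {f : ℝ → ℝ} (hf : ContDiff ℝ (⊤ : ℕ∞) f)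
    (hp : Function.Periodic f (2 * Real.pi)) (x : ℝ) :
    (SmoothFun.ofPeriodic f hf hp : S1 → ℝ) (x : S1) = f x := hp.lift_coe x

theorem periodic_deriv_smoothFun (Φ : SmoothFun) :
    Function.Periodic (deriv fun x : ℝ => (Φ : S1 → ℝ) (x : S1)) (2 * Real.pi) := fun x => by
  rw [← deriv_comp_add_const]
  exact congrArg (fun f => deriv f x) (funext (smoothFun_periodic Φ))

/-- The derivative of a smooth function on the circle. -/
noncomputable def smoothDeriv (Φ : SmoothFun) : SmoothFun :=
  SmoothFun.ofPeriodic (deriv fun x : ℝ => (Φ : S1 → ℝ) (x : S1))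
    ((contDiff_infty_iff_deriv (𝕜 := ℝ)).1 (smoothFun_contDiff Φ)).2
    (periodic_deriv_smoothFun Φ)

theorem smoothFun_hasDerivAt (Φ : SmoothFun) (x : ℝ) :
    HasDerivAt (fun x : ℝ => (Φ : S1 → ℝ) (x : S1)) (((smoothDeriv Φ) : S1 → ℝ) (x : S1)) x := by
  rw [smoothDeriv]
  erw [SmoothFun.ofPeriodic_coe]
  exact ((smoothFun_contDiff Φ).differentiable (by simp) x).hasDerivAt

/-- Integration by parts over one period, with boundary terms cancelling by periodicity. -/
theorem coord_deriv (Φ : SmoothFun) (k : ℤ) :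
    coord (toL2 (smoothDeriv Φ) (smooth_memLp _)) k = I * k * coord (toL2 Φ (smooth_memLp _)) k := by
  rw [coord_toL2, coord_toL2, mul_left_comm]
  congr 1
  rw [← integral_const_mul, ← AddCircle.intervalIntegral_preimage (2 * Real.pi) 0,
    ← AddCircle.intervalIntegral_preimage (2 * Real.pi) 0, zero_add, ← sub_eq_zero]
  have hcont : ∀ Ψ : SmoothFun, Continuous fun x : ℝ => (fourier (-k) (x : S1) : ℂ) *
      ((Ψ : S1 → ℝ) (x : S1) : ℂ) := fun Ψ => by
    have h1 : Continuous fun x : ℝ => (fourier (-k) (x : S1) : ℂ) :=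
      (fourier (-k)).continuous.comp (AddCircle.continuous_mk' _)
    exact h1.mul (Complex.continuous_ofReal.comp (smoothFun_contDiff Ψ).continuous)
  rw [← intervalIntegral.integral_sub ((hcont _).intervalIntegrable _ _)
    (((hcont _).const_mul _).intervalIntegrable _ _)]
  have hd : ∀ x : ℝ, HasDerivAt
      (fun x : ℝ => (fourier (-k) (x : S1) : ℂ) * ((Φ : S1 → ℝ) (x : S1) : ℂ))
      ((fourier (-k) (x : S1) : ℂ) * (((smoothDeriv Φ) : S1 → ℝ) (x : S1) : ℂ) -
        I * k * ((fourier (-k) (x : S1) : ℂ) * ((Φ : S1 → ℝ) (x : S1) : ℂ))) x := by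
    intro x
    simp only [mode_fourier_coe]
    have h1 : HasDerivAt (fun x : ℝ => Complex.exp (I * ((-k : ℤ) : ℂ) * x))
        (Complex.exp (I * ((-k : ℤ) : ℂ) * x) * (I * ((-k : ℤ) : ℂ))) x := by
      have h0 : HasDerivAt (fun x : ℝ => I * ((-k : ℤ) : ℂ) * (x : ℂ)) (I * ((-k : ℤ) : ℂ)) x := by
        simpa using (Complex.ofRealCLM.hasDerivAt (x := x)).const_mul (I * ((-k : ℤ) : ℂ))
      exact h0.cexp
    refine (h1.mul (smoothFun_hasDerivAt Φ x).ofReal_comp).congr_deriv ?_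
    push_cast
    ring
  rw [intervalIntegral.integral_eq_sub_of_hasDerivAt (fun x _ => hd x)
    (((hcont _).sub ((hcont _).const_mul _)).intervalIntegrable _ _)]
  have h2 : ((2 * Real.pi : ℝ) : S1) = ((0 : ℝ) : S1) := by
    rw [AddCircle.coe_period]; rfl
  rw [h2, sub_self]

theorem norm_coord_le (φ : OneParticle) (k : ℤ) : ‖coord φ k‖ ≤ ‖φ‖ := by
  have h := norm_inner_le_norm (𝕜 := ℂ) (mode k) φ
  rwa [orthonormal_mode.1 k, one_mul] at h

theorem exists_norm_coord_smooth_le (Φ : SmoothFun) :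
    ∃ C, ∀ k : ℤ, (1 + (k : ℝ) ^ 4) * ‖coord (toL2 Φ (smooth_memLp _)) k‖ ≤ C := by
  refine ⟨‖toL2 Φ (smooth_memLp _)‖ + ‖toL2 (smoothDeriv (smoothDeriv (smoothDeriv (smoothDeriv Φ)))) (smooth_memLp _)‖,
    fun k => ?_⟩
  rw [add_mul, one_mul]
  refine add_le_add (norm_coord_le _ _) ?_
  refine le_trans (le_of_eq ?_) (norm_coord_le (toL2 (smoothDeriv (smoothDeriv (smoothDeriv (smoothDeriv Φ)))) (smooth_memLp _)) k)
  rw [coord_deriv, coord_deriv, coord_deriv, coord_deriv]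
  simp only [norm_mul, Complex.norm_I, one_mul, Complex.norm_intCast]
  rw [show (k : ℝ) ^ 4 = |(k : ℝ)| ^ 4 from (Even.pow_abs ⟨2, rfl⟩ _).symm]
  ring

theorem summable_one_add_pow_inv : Summable fun k : ℤ => (1 + (k : ℝ) ^ 2)⁻¹ := by
  have h1 : Summable fun k : ℤ => ((k : ℝ) ^ 2)⁻¹ := by
    simpa using (Real.summable_one_div_int_pow (p := 2)).2 one_lt_two
  have h2 : ∀ᶠ k : ℤ in Filter.cofinite, ‖(1 + (k : ℝ) ^ 2)⁻¹‖ ≤ ((k : ℝ) ^ 2)⁻¹ := by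
    filter_upwards [(Set.finite_singleton (0 : ℤ)).compl_mem_cofinite] with k hk
    have hk' : (k : ℝ) ≠ 0 := by exact_mod_cast hk
    rw [Real.norm_of_nonneg (by positivity)]
    gcongr
    linarith
  exact Summable.of_norm_bounded_eventually h1 h2

theorem summable_smooth_coord (Φ : SmoothFun) (a b : ℝ) (ha : 0 ≤ a) (hb : 0 ≤ b) :
    Summable fun k : ℤ => (a + b * (k : ℝ) ^ 2) * ‖coord (toL2 Φ (smooth_memLp _)) k‖ := by
  obtain ⟨C, hC⟩ := exists_norm_coord_smooth_le Φ
  refine Summable.of_nonneg_of_le (fun k => by positivity) (fun k => ?_)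
    (summable_one_add_pow_inv.mul_left ((a + b) * (2 * C)))
  have h1 := hC k
  have h0 : 0 ≤ ‖coord (toL2 Φ (smooth_memLp _)) k‖ := norm_nonneg _
  generalize ‖coord (toL2 Φ (smooth_memLp _)) k‖ = x at h0 h1
  have h2 : a + b * (k : ℝ) ^ 2 ≤ (a + b) * (1 + (k : ℝ) ^ 2) := by
    nlinarith [mul_nonneg ha (sq_nonneg (k : ℝ))]
  rw [← div_eq_mul_inv, le_div_iff₀ (by positivity)]
  -- From `(1 + k ^ 2) ^ 2 ≤ 2 (1 + k ^ 4)`, that is, `(k ^ 2 - 1) ^ 2 ≥ 0`.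
  have h3 : (1 + (k : ℝ) ^ 2) * x * (1 + (k : ℝ) ^ 2) ≤ 2 * C := by
    nlinarith [mul_nonneg h0 (sq_nonneg ((k : ℝ) ^ 2 - 1))]
  calc (a + b * (k : ℝ) ^ 2) * x * (1 + (k : ℝ) ^ 2)
      ≤ (a + b) * (1 + (k : ℝ) ^ 2) * x * (1 + (k : ℝ) ^ 2) := by gcongr
    _ = (a + b) * ((1 + (k : ℝ) ^ 2) * x * (1 + (k : ℝ) ^ 2)) := by ring
    _ ≤ _ := by gcongr

theorem smooth_mem_domA {m : ℝ} (hm : 0 < m) (Φ : SmoothFun) :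
    toL2 Φ (smooth_memLp _) ∈ domA m (1 / 4) := by
  change Summable fun k : ℤ => ‖(wt m (1 / 4) k : ℂ) * coord _ k‖ ^ 2
  have h := summable_smooth_coord Φ (1 + m ^ 2) 1 (by positivity) zero_le_one
  obtain ⟨C, hC⟩ := exists_norm_coord_smooth_le Φ
  have hC0 : 0 ≤ C := le_trans (by positivity) (hC 0)
  refine Summable.of_nonneg_of_le (fun k => by positivity) (fun k => ?_) (h.mul_right C)
  rw [norm_mul, mul_pow, Complex.norm_real, Real.norm_of_nonneg (wt_pos hm _ k).le]
  have h1 : wt m (1 / 4) k ^ 2 ≤ 1 + m ^ 2 + 1 * (k : ℝ) ^ 2 := by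
    have hb : (1 : ℝ) ≤ 1 + m ^ 2 + 1 * (k : ℝ) ^ 2 := by nlinarith [sq_nonneg m, sq_nonneg (k : ℝ)]
    rw [wt, ← Real.rpow_natCast, ← Real.rpow_mul (by positivity)]
    refine (Real.rpow_le_rpow (by positivity) (by linarith : (k : ℝ) ^ 2 + m ^ 2 ≤
      1 + m ^ 2 + 1 * (k : ℝ) ^ 2) (by norm_num)).trans ?_
    exact Real.rpow_le_self_of_one_le hb (by norm_num)
  have h2 : ‖coord (toL2 Φ (smooth_memLp _)) k‖ ≤ C := by
    refine le_trans ?_ (hC k)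
    exact le_mul_of_one_le_left (norm_nonneg _) (by nlinarith [sq_nonneg ((k : ℝ) ^ 2)])
  rw [sq ‖_‖, ← mul_assoc]
  gcongr

/-! ### The map `K` -/

variable {m : ℝ}

theorem toL2_add (Φ Ψ : SmoothFun) : toL2 (Φ + Ψ : SmoothFun) (smooth_memLp _) =
    toL2 Φ (smooth_memLp _) + toL2 Ψ (smooth_memLp _) := by
  rw [toL2, toL2, toL2, ← MemLp.toLp_add]
  congr 1
  funext θ
  exact Complex.ofReal_add _ _

theorem toL2_smul (c : ℝ) (Φ : SmoothFun) : toL2 (c • Φ : SmoothFun) (smooth_memLp _) =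
    (c : ℂ) • toL2 Φ (smooth_memLp _) := by
  rw [toL2, toL2, ← MemLp.toLp_const_smul]
  congr 1
  funext θ
  exact Complex.ofReal_mul _ _

theorem coord_K (hm : 0 < m) (z : CauchyData) (k : ℤ) :
    coord (K m z) k = ((Real.sqrt 2)⁻¹ : ℂ) *
      (wt m (1 / 4) k * coord (toL2 z.1 (smooth_memLp _)) k +
        I * (wt m (-(1 / 4)) k * coord (toL2 z.2 (smooth_memLp _)) k)) := by
  rw [K, coord_smul, coord_add, coord_smul, coord_powA (smooth_mem_domA hm _),
    coord_powA (mem_domA_of_nonpos hm (by norm_num) _)]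

theorem K_add (hm : 0 < m) (z w : CauchyData) : K m (z + w) = K m z + K m w := by
  refine coord_ext fun k => ?_
  rw [coord_add, coord_K hm, coord_K hm, coord_K hm, Prod.fst_add, Prod.snd_add, toL2_add, toL2_add,
    coord_add, coord_add]
  ring

theorem K_smul (hm : 0 < m) (c : ℝ) (z : CauchyData) : K m (c • z) = (c : ℂ) • K m z := by
  refine coord_ext fun k => ?_
  rw [coord_smul, coord_K hm, coord_K hm, Prod.smul_fst,
    Prod.smul_snd, toL2_smul, toL2_smul, coord_smul, coord_smul]
  ring

theorem K_zero (hm : 0 < m) : K m 0 = 0 := by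
  have h := K_smul hm 0 0
  rwa [zero_smul, Complex.ofReal_zero, zero_smul] at h

theorem inner_smul_I_add_im {E : Type*} [NormedAddCommGroup E] [InnerProductSpace ℂ E]
    (a b c d : E) (h1 : (⟪a, c⟫_ℂ).im = 0) (h2 : (⟪b, d⟫_ℂ).im = 0) :
    (⟪((Real.sqrt 2)⁻¹ : ℂ) • (a + I • b), ((Real.sqrt 2)⁻¹ : ℂ) • (c + I • d)⟫_ℂ).im =
      ((⟪a, d⟫_ℂ).re - (⟪b, c⟫_ℂ).re) / 2 := by
  have h : ((Real.sqrt 2)⁻¹ : ℂ) * ((Real.sqrt 2)⁻¹ : ℂ) = ((1 / 2 : ℝ) : ℂ) := by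
    rw [← mul_inv, ← Complex.ofReal_mul, Real.mul_self_sqrt (by norm_num)]
    norm_num
  rw [inner_smul_left, inner_smul_right, map_inv₀, Complex.conj_ofReal, ← mul_assoc, h,
    Complex.im_ofReal_mul, inner_add_left, inner_add_right, inner_add_right, inner_smul_left,
    inner_smul_left, inner_smul_right, inner_smul_right]
  simp only [Complex.add_im, Complex.mul_im, Complex.mul_re, Complex.conj_I, Complex.neg_re,
    Complex.neg_im, Complex.I_re, Complex.I_im, h1, h2]
  ring

/-- The diagonal terms are real, and in the cross terms `A^{1/4}` and `A^{-1/4}` cancel, so the mass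
drops out. -/
theorem inner_K_im (hm : 0 < m) (z w : CauchyData) : (⟪K m z, K m w⟫_ℂ).im = symp z w / 2 := by
  rw [K, K, inner_smul_I_add_im]
  · have h := inner_powA_powA_neg hm (smooth_mem_domA hm z.1)
      (mem_domA_of_nonpos hm (by norm_num : -(1 / 4 : ℝ) ≤ 0) (toL2 w.2 (smooth_memLp _)))
    have h' := inner_powA_powA_neg hm (α := -(1 / 4 : ℝ)) (mem_domA_of_nonpos hm (by norm_num)
      (toL2 z.2 (smooth_memLp _))) (by rw [neg_neg]; exact smooth_mem_domA hm w.1)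
    rw [neg_neg] at h'
    rw [h, h', inner_toL2, inner_toL2, Complex.ofReal_re, Complex.ofReal_re, symp, integral_sub]
    · congr 2
      congr 1
      funext θ
      exact mul_comm _ _
    · exact integrable_mul_smooth (smooth_memLp _) _
    · exact integrable_mul_smooth (smooth_memLp _) _
  · exact inner_powA_toL2_im (smooth_mem_domA hm _) (smooth_mem_domA hm _)
  · exact inner_powA_toL2_im (mem_domA_of_nonpos hm (by norm_num) _)
      (mem_domA_of_nonpos hm (by norm_num) _)

theorem mu_self (z : CauchyData) : mu m z z = ‖K m z‖ ^ 2 := by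
  rw [mu]
  exact inner_self_eq_norm_sq (𝕜 := ℂ) _

/-- The symplectic form as a bilinear form. -/
noncomputable def sympLin : CauchyData →ₗ[ℝ] CauchyData →ₗ[ℝ] ℝ :=
  LinearMap.mk₂ ℝ symp
    (fun z z' w => by
      -- Bilinearity is inherited from the inner product, with mass one as an arbitrary choice.
      have h := inner_K_im one_pos
      have e : ∀ z w, symp z w = 2 * (⟪K 1 z, K 1 w⟫_ℂ).im := fun z w => by rw [h]; ring
      rw [e, e, e, K_add one_pos, inner_add_left, Complex.add_im, mul_add])
    (fun c z w => by
      have h := inner_K_im one_pos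
      have e : ∀ z w, symp z w = 2 * (⟪K 1 z, K 1 w⟫_ℂ).im := fun z w => by rw [h]; ring
      rw [e, e, K_smul one_pos, inner_smul_left, Complex.conj_ofReal,
        Complex.im_ofReal_mul, smul_eq_mul, mul_left_comm])
    (fun z w w' => by
      have h := inner_K_im one_pos
      have e : ∀ z w, symp z w = 2 * (⟪K 1 z, K 1 w⟫_ℂ).im := fun z w => by rw [h]; ring
      rw [e, e, e, K_add one_pos, inner_add_right, Complex.add_im, mul_add])
    (fun c z w => by
      have h := inner_K_im one_pos
      have e : ∀ z w, symp z w = 2 * (⟪K 1 z, K 1 w⟫_ℂ).im := fun z w => by rw [h]; ring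
      rw [e, e, K_smul one_pos, inner_smul_right,
        Complex.im_ofReal_mul, smul_eq_mul, mul_left_comm])

theorem sympLin_apply (z w : CauchyData) : sympLin z w = symp z w := rfl

theorem sympLin_isAlt : sympLin.IsAlt := fun z => by
  rw [sympLin_apply, symp]
  simp only [sub_self, integral_zero]

theorem toL2_eq_zero {Φ : SmoothFun} (h : toL2 Φ (smooth_memLp _) = 0) : Φ = 0 := by
  have h1 : (fun θ => ((Φ : S1 → ℝ) θ : ℂ)) =ᵐ[volume] fun _ => (0 : ℂ) := by
    have h2 := coe_toL2 Φ (smooth_memLp _)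
    rw [h] at h2
    exact h2.symm.trans (Lp.coeFn_zero _ _ _)
  have h2 := Measure.eq_of_ae_eq h1 (Complex.continuous_ofReal.comp (smooth_continuous Φ))
    continuous_const
  exact Subtype.ext (funext fun θ => Complex.ofReal_eq_zero.1 (congrFun h2 θ))

theorem sympLin_nondegenerate (z : CauchyData) (hz : z ≠ 0) : ∃ w, sympLin w z ≠ 0 := by
  -- Pairing with this rotation of `z` gives minus the sum of the squared `L²` norms of the two
  -- components.
  refine ⟨(-z.2, z.1), fun h => hz ?_⟩
  have hn : ∀ Φ : SmoothFun, ∫ θ, (Φ : S1 → ℝ) θ * (Φ : S1 → ℝ) θ =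
      ‖toL2 Φ (smooth_memLp _)‖ ^ 2 := fun Φ => by
    have h1 := inner_toL2 Φ Φ (smooth_memLp _) (smooth_memLp _)
    have h2 := inner_self_eq_norm_sq (𝕜 := ℂ) (toL2 Φ (smooth_memLp _))
    rw [h1] at h2
    exact h2
  have h1 : sympLin (-z.2, z.1) z =
      -(‖toL2 z.2 (smooth_memLp _)‖ ^ 2 + ‖toL2 z.1 (smooth_memLp _)‖ ^ 2) := by
    rw [sympLin_apply, symp, ← hn, ← hn,
      ← integral_add (integrable_mul_smooth (smooth_memLp _) _)
        (integrable_mul_smooth (smooth_memLp _) _), ← integral_neg]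
    congr 1
    funext θ
    have : ((-z.2 : SmoothFun) : S1 → ℝ) θ = -((z.2 : S1 → ℝ) θ) := rfl
    simp only [this]
    ring
  rw [h1] at h
  have h2 : ‖toL2 z.2 (smooth_memLp _)‖ = 0 := by
    have := sq_nonneg ‖toL2 z.1 (smooth_memLp _)‖
    have := sq_nonneg ‖toL2 z.2 (smooth_memLp _)‖
    exact pow_eq_zero_iff two_ne_zero |>.1 (by linarith)
  have h3 : ‖toL2 z.1 (smooth_memLp _)‖ = 0 := by
    have := sq_nonneg ‖toL2 z.1 (smooth_memLp _)‖
    have := sq_nonneg ‖toL2 z.2 (smooth_memLp _)‖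
    exact pow_eq_zero_iff two_ne_zero |>.1 (by linarith)
  exact Prod.ext (toL2_eq_zero (norm_eq_zero.1 h3)) (toL2_eq_zero (norm_eq_zero.1 h2))

/-- The smooth function `2 Re (a e^{ikθ})`. -/
noncomputable def trigFun (a : ℂ) (k : ℤ) : SmoothFun :=
  SmoothFun.ofPeriodic (fun x => 2 * (a * Complex.exp (I * k * x)).re)
    (by
      have h : ContDiff ℝ (⊤ : ℕ∞) fun x : ℝ => a * Complex.exp (I * k * x) :=
        contDiff_const.mul (ContDiff.cexp (contDiff_const.mul Complex.ofRealCLM.contDiff))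
      exact contDiff_const.mul (Complex.reCLM.contDiff.comp h))
    (fun x => by
      simp only
      rw [← mode_fourier_coe, ← mode_fourier_coe, AddCircle.coe_add_period])

theorem toL2_trigFun (a : ℂ) (k : ℤ) : toL2 (trigFun a k) (smooth_memLp _) =
    (Real.sqrt (2 * Real.pi) : ℂ) • (a • mode k + star a • mode (-k)) := by
  refine Lp.ext ?_
  filter_upwards [coe_toL2 (trigFun a k) (smooth_memLp _), coe_mode k, coe_mode (-k),
    Lp.coeFn_smul (Real.sqrt (2 * Real.pi) : ℂ) (a • mode k + star a • mode (-k)),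
    Lp.coeFn_add (a • mode k) (star a • mode (-k)), Lp.coeFn_smul a (mode k),
    Lp.coeFn_smul (star a) (mode (-k))] with θ h1 h2 h3 h4 h5 h6 h7
  rw [h1, h4, Pi.smul_apply, h5, Pi.add_apply, h6, h7, Pi.smul_apply, Pi.smul_apply, h2, h3]
  have hs : (Real.sqrt (2 * Real.pi) : ℂ) ≠ 0 := by
    exact_mod_cast (Real.sqrt_pos.2 Real.two_pi_pos).ne'
  simp only [smul_eq_mul]
  have h8 : ((trigFun a k : S1 → ℝ) θ : ℂ) = a * fourier k θ + star a * fourier (-k) θ := by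
    induction θ using QuotientAddGroup.induction_on with | H x => ?_
    have := SmoothFun.ofPeriodic_coe (f := fun x => 2 * (a * Complex.exp (I * k * x)).re)
    rw [fourier_neg]
    erw [mode_fourier_coe]
    rw [trigFun]
    erw [SmoothFun.ofPeriodic_coe]
    rw [Complex.star_def, ← map_mul, Complex.add_conj]
  rw [h8]
  field_simp

/-- Real data occupy the modes `k` and `-k` together. The amplitudes `a` and `b` are tuned so that
the contributions of the two components add up to `c` at `k` and cancel at `-k`. -/
theorem smul_mode_mem_range_K (hm : 0 < m) (c : ℂ) (k : ℤ) : ∃ z, K m z = c • mode k := by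
  set s : ℂ := (Real.sqrt (2 * Real.pi) : ℂ) with hs_def
  have hs : s ≠ 0 := Complex.ofReal_ne_zero.2 (Real.sqrt_pos.2 Real.two_pi_pos).ne'
  have h2 : (Real.sqrt 2 : ℂ) ≠ 0 := by exact_mod_cast (Real.sqrt_pos.2 two_pos).ne'
  set u : ℂ := (wt m (1 / 4) k : ℂ) with hu
  set v : ℂ := (wt m (-(1 / 4)) k : ℂ) with hv
  have hu0 : u ≠ 0 := Complex.ofReal_ne_zero.2 (wt_pos hm _ k).ne'
  have hv0 : v ≠ 0 := Complex.ofReal_ne_zero.2 (wt_pos hm _ k).ne'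
  set a : ℂ := (Real.sqrt 2 : ℂ) * c / (2 * u * s) with ha
  set b : ℂ := -I * ((Real.sqrt 2 : ℂ) * c / (2 * v * s)) with hb
  refine ⟨(trigFun a k, trigFun b k), coord_ext fun j => ?_⟩
  have e1 : star u = u := Complex.conj_ofReal _
  have e2 : star v = v := Complex.conj_ofReal _
  have e3 : star s = s := Complex.conj_ofReal _
  have e4 : star (Real.sqrt 2 : ℂ) = (Real.sqrt 2 : ℂ) := Complex.conj_ofReal _
  have k1 : ((Real.sqrt 2)⁻¹ : ℂ) * (s * (u * a + I * (v * b))) = c := by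
    rw [ha, hb]
    field_simp
    linear_combination (-c) * I_sq
  have k2 : u * star a + I * (v * star b) = 0 := by
    rw [ha, hb]
    have e5 : star I = -I := Complex.conj_I
    simp only [star_mul', star_div₀, star_neg, e1, e2, e3, e4, e5, star_ofNat]
    field_simp
    linear_combination (Real.sqrt 2 : ℂ) * (star c) * I_sq
  rw [coord_K hm, toL2_trigFun, toL2_trigFun, coord_smul, coord_smul, coord_smul, coord_add,
    coord_add, coord_smul, coord_smul, coord_smul, coord_smul, coord_mode, coord_mode, ← hs_def]
  have hj : ∀ α, j = k ∨ j = -k → wt m α j = wt m α k := by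
    rintro α (rfl | rfl)
    · rfl
    · exact wt_neg m α k
  by_cases h : j = k ∨ j = -k
  · rw [hj _ h, hj _ h, ← hu, ← hv, ← k1]
    generalize (if j = k then (1 : ℂ) else 0) = p
    generalize (if j = -k then (1 : ℂ) else 0) = q
    linear_combination ((Real.sqrt 2)⁻¹ : ℂ) * s * q * k2
  · rw [not_or] at h
    rw [if_neg h.1, if_neg h.2]
    ring

/-- `K` is only real linear, but its range contains every complex multiple of every mode and hence
their complex span. -/
theorem dense_range_K (hm : 0 < m) : Dense (Set.range (K m)) := by
  have h1 : (Submodule.span ℂ (Set.range mode) : Set OneParticle) ⊆ Set.range (K m) := by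
    intro x hx
    refine Submodule.closure_induction (p := fun x _ => x ∈ Set.range (K m)) ?_ ?_ ?_ hx
    · exact ⟨0, K_zero hm⟩
    · rintro x y - - ⟨z, rfl⟩ ⟨w, rfl⟩
      exact ⟨z + w, K_add hm z w⟩
    · rintro c - ⟨k, rfl⟩
      exact smul_mode_mem_range_K hm c k
  have h2 : Dense (Submodule.span ℂ (Set.range mode) : Set OneParticle) :=
    Submodule.dense_iff_topologicalClosure_eq_top.2 span_mode_topologicalClosure
  exact h2.mono h1

end OneParticleStructure

end KGCircle

namespace KGCircle

/-! ## Multiplication by smooth functions -/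

section Multiplication

variable {m : ℝ}

theorem exists_coord_eq (b : OneParticle) (σ : ℤ ≃ ℤ) {d : ℤ → ℂ} {R : ℝ} (hR : 0 ≤ R)
    (hd : ∀ k, ‖d k‖ ≤ R * ‖coord b (σ k)‖) : ∃ v, coord v = d ∧ ‖v‖ ≤ R * ‖b‖ := by
  have h1 : HasSum (fun k => (R * ‖coord b (σ k)‖) ^ 2) (R ^ 2 * ‖b‖ ^ 2) := by
    have h := (σ.hasSum_iff.2 (hasSum_norm_coord_sq b)).mul_left (R ^ 2)
    exact h.congr_fun fun k => mul_pow _ _ _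
  have h2 : Summable fun k => ‖d k‖ ^ 2 :=
    Summable.of_nonneg_of_le (fun _ => by positivity) (fun k => by gcongr; exact hd k) h1.summable
  have hmem : Memℓp d 2 := memℓp_gen (by simpa using h2)
  have hc : coord (modeBasis.repr.symm ⟨d, hmem⟩) = d := funext fun k => by
    rw [coord_eq_repr, LinearIsometryEquiv.apply_symm_apply]
  refine ⟨_, hc, ?_⟩
  have h3 := hasSum_norm_coord_sq (modeBasis.repr.symm ⟨d, hmem⟩)
  rw [hc] at h3
  have h4 := hasSum_le (fun k => pow_le_pow_left₀ (norm_nonneg _) (hd k) 2) h3 h1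
  rw [← mul_pow] at h4
  exact (sq_le_sq₀ (norm_nonneg _) (by positivity)).1 h4

/-- The product of smooth functions. -/
noncomputable def smoothMul (h Φ : SmoothFun) : SmoothFun :=
  ⟨fun θ => (h : S1 → ℝ) θ * (Φ : S1 → ℝ) θ, (smoothFun_contDiff h).mul (smoothFun_contDiff Φ)⟩

theorem smoothMul_apply (h Φ : SmoothFun) (θ : S1) :
    (smoothMul h Φ : S1 → ℝ) θ = (h : S1 → ℝ) θ * (Φ : S1 → ℝ) θ := rfl

/-- Parseval's identity for `e^{ikθ} h` against `Φ` expresses the coefficients of the product as a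
convolution. -/
theorem hasSum_coord_smoothMul (h Φ : SmoothFun) (k : ℤ) :
    HasSum (fun n : ℤ => ((Real.sqrt (2 * Real.pi))⁻¹ : ℂ) * coord (toL2 h (smooth_memLp _)) n *
      coord (toL2 Φ (smooth_memLp _)) (k - n)) (coord (toL2 (smoothMul h Φ) (smooth_memLp _)) k) := by
  let g : C(S1, ℂ) := ⟨fun θ => fourier k θ * ((h : S1 → ℝ) θ : ℂ),
    (fourier k).continuous.mul (Complex.continuous_ofReal.comp (smooth_continuous h))⟩
  let G : OneParticle := ContinuousMap.toLp (E := ℂ) 2 (volume : Measure S1) ℂ g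
  have hG : G =ᵐ[volume] fun θ => fourier k θ * ((h : S1 → ℝ) θ : ℂ) :=
    ContinuousMap.coeFn_toLp (p := 2) (𝕜 := ℂ) (volume : Measure S1) g
  have h1 : coord (toL2 (smoothMul h Φ) (smooth_memLp _)) k =
      ((Real.sqrt (2 * Real.pi))⁻¹ : ℂ) * ⟪G, toL2 Φ (smooth_memLp _)⟫_ℂ := by
    rw [coord_toL2, L2.inner_def]
    congr 1
    refine integral_congr_ae ?_
    filter_upwards [hG, coe_toL2 Φ (smooth_memLp _)] with θ e1 e2
    rw [e1, e2, RCLike.inner_apply', map_mul, Complex.conj_ofReal, fourier_neg, smoothMul_apply]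
    push_cast
    ring
  have h2 : ∀ j, ⟪G, mode j⟫_ℂ = coord (toL2 h (smooth_memLp _)) (k - j) := fun j => by
    rw [coord_toL2, L2.inner_def, ← integral_const_mul]
    refine integral_congr_ae ?_
    filter_upwards [hG, coe_mode j] with θ e1 e2
    rw [e1, e2, RCLike.inner_apply', map_mul, Complex.conj_ofReal, neg_sub, sub_eq_add_neg,
      fourier_add, fourier_neg]
    ring
  rw [h1]
  have h3 := (modeBasis.hasSum_inner_mul_inner G (toL2 Φ (smooth_memLp _))).mul_left
    ((Real.sqrt (2 * Real.pi))⁻¹ : ℂ)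
  rw [← (Equiv.subLeft k).hasSum_iff] at h3
  refine h3.congr_fun fun n => ?_
  simp only [Function.comp_apply, Equiv.subLeft_apply, coe_modeBasis, h2, sub_sub_cancel, coord]
  ring

/-- A Peetre inequality: shifting the frequency by `n` changes `k ^ 2 + m ^ 2` by at most a factor
quadratic in `n`. The bound holds in both directions, which covers negative exponents, and `|α| ≤ 1`
keeps the factor below its first power. -/
theorem wt_le (hm : 0 < m) {α : ℝ} (hα : |α| ≤ 1) (k n : ℤ) :
    wt m α k ≤ (2 + 2 / m ^ 2 * (n : ℝ) ^ 2) * wt m α (k - n) := by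
  set ρ : ℝ := 2 + 2 / m ^ 2 * (n : ℝ) ^ 2 with hρ
  have hρ1 : 1 ≤ ρ := by
    have : 0 ≤ 2 / m ^ 2 * (n : ℝ) ^ 2 := by positivity
    linarith
  have key : ∀ a b : ℝ, (a - b) ^ 2 = (n : ℝ) ^ 2 → a ^ 2 + m ^ 2 ≤ ρ * (b ^ 2 + m ^ 2) := by
    intro a b hab
    have h1 : ρ * (b ^ 2 + m ^ 2) =
        2 * b ^ 2 + 2 * m ^ 2 + 2 * (n : ℝ) ^ 2 + 2 / m ^ 2 * (n : ℝ) ^ 2 * b ^ 2 := by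
      rw [hρ]
      field_simp
      ring
    have h2 : 0 ≤ 2 / m ^ 2 * (n : ℝ) ^ 2 * b ^ 2 := by positivity
    rw [h1, ← hab]
    rw [← hab] at h2
    nlinarith [sq_nonneg (a - 2 * b), sq_nonneg m]
  have k1 := key k (k - n : ℤ) (by push_cast; ring)
  have k2 := key (k - n : ℤ) k (by push_cast; ring)
  have hρα : ρ ^ |α| ≤ ρ := by
    simpa using Real.rpow_le_rpow_of_exponent_le hρ1 hα
  have p1 : (0 : ℝ) < (k : ℝ) ^ 2 + m ^ 2 := by positivity
  have p2 : (0 : ℝ) < ((k - n : ℤ) : ℝ) ^ 2 + m ^ 2 := by positivity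
  rw [wt, wt]
  generalize ((k - n : ℤ) : ℝ) ^ 2 + m ^ 2 = y at *
  generalize (k : ℝ) ^ 2 + m ^ 2 = x at *
  have hy : 0 ≤ y ^ α := (Real.rpow_pos_of_pos p2 _).le
  refine le_trans ?_ (mul_le_mul_of_nonneg_right hρα hy)
  rcases le_or_gt 0 α with h | h
  · rw [abs_of_nonneg h, ← Real.mul_rpow (by linarith) p2.le]
    exact Real.rpow_le_rpow p1.le k1 h
  · rw [abs_of_neg h, Real.rpow_neg (by linarith), ← Real.inv_rpow (by linarith),
      ← Real.mul_rpow (by positivity) p2.le]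
    refine Real.rpow_le_rpow_of_nonpos (by positivity) ?_ h.le
    rwa [inv_mul_le_iff₀ (by linarith)]

/-- The convolution is split by the frequency `n` of `h` into vectors `v n`; the Peetre inequality
bounds each by `ρ n` times the norm of `powA m α` on `Φ`, and `ρ` is summable because `h` is smooth.
-/
theorem exists_norm_powA_smoothMul_le (hm : 0 < m) {α : ℝ} (hα : |α| ≤ 1)
    (hdom : ∀ Φ : SmoothFun, toL2 Φ (smooth_memLp _) ∈ domA m α) (h : SmoothFun) :
    ∃ C, ∀ Φ, ‖powA m α (toL2 (smoothMul h Φ) (smooth_memLp _))‖ ≤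
      C * ‖powA m α (toL2 Φ (smooth_memLp _))‖ := by
  set c : ℤ → ℂ := fun n => ((Real.sqrt (2 * Real.pi))⁻¹ : ℂ) * coord (toL2 h (smooth_memLp _)) n
  set ρ : ℤ → ℝ := fun n => ‖c n‖ * (2 + 2 / m ^ 2 * (n : ℝ) ^ 2) with hρ
  have hs : Summable ρ := by
    refine ((summable_smooth_coord h 2 (2 / m ^ 2) (by positivity) (by positivity)).mul_left
      ‖((Real.sqrt (2 * Real.pi))⁻¹ : ℂ)‖).congr fun n => ?_
    rw [hρ]
    simp only [c, norm_mul]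
    ring
  refine ⟨∑' n, ρ n, fun Φ => ?_⟩
  set b := powA m α (toL2 Φ (smooth_memLp _)) with hb
  have hbc : ∀ k, coord b k = wt m α k * coord (toL2 Φ (smooth_memLp _)) k := coord_powA (hdom Φ)
  have hex : ∀ n : ℤ, ∃ v, coord v =
      (fun k => c n * (wt m α k * coord (toL2 Φ (smooth_memLp _)) (k - n))) ∧ ‖v‖ ≤ ρ n * ‖b‖ := by
    intro n
    refine exists_coord_eq b (Equiv.subRight n) (by positivity) fun k => ?_
    have hw : ∀ j, ‖(wt m α j : ℂ)‖ = wt m α j := fun j => by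
      rw [Complex.norm_real, Real.norm_of_nonneg (wt_pos hm _ _).le]
    rw [Equiv.subRight_apply, hbc, norm_mul (c n), norm_mul (wt m α k : ℂ),
      norm_mul (wt m α (k - n) : ℂ), hw, hw, mul_assoc, ← mul_assoc (2 + _)]
    gcongr
    exact wt_le hm hα k n
  choose v hv hvn using hex
  have hvs : Summable fun n => ‖v n‖ :=
    Summable.of_nonneg_of_le (fun _ => norm_nonneg _) hvn (hs.mul_right _)
  have hvh := hvs.of_norm.hasSum
  have heq : powA m α (toL2 (smoothMul h Φ) (smooth_memLp _)) = ∑' n, v n := by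
    refine coord_ext fun k => ?_
    rw [coord_powA (hdom _)]
    have h1 : HasSum (fun n => coord (v n) k) (coord (∑' n, v n) k) :=
      (innerSL ℂ (mode k)).hasSum hvh
    refine HasSum.unique ?_ h1
    refine ((hasSum_coord_smoothMul h Φ k).mul_left (wt m α k : ℂ)).congr_fun fun n => ?_
    rw [hv]
    simp only [c]
    ring
  rw [heq, ← tsum_mul_right]
  exact (norm_tsum_le_tsum_norm hvs).trans (hvs.tsum_le_tsum hvn (hs.mul_right _))

/-! ### Boundedness of multiplication on Cauchy data -/

theorem norm_add_I_smul_sq {E : Type*} [NormedAddCommGroup E] [InnerProductSpace ℂ E] (a b : E)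
    (h : (⟪a, b⟫_ℂ).im = 0) : ‖a + I • b‖ ^ 2 = ‖a‖ ^ 2 + ‖b‖ ^ 2 := by
  rw [norm_add_sq (𝕜 := ℂ), inner_smul_right, norm_smul, Complex.norm_I, one_mul]
  simp [h]

theorem norm_K_sq (hm : 0 < m) (z : CauchyData) : ‖K m z‖ ^ 2 =
    (‖powA m (1 / 4) (toL2 z.1 (smooth_memLp _))‖ ^ 2 +
      ‖powA m (-(1 / 4)) (toL2 z.2 (smooth_memLp _))‖ ^ 2) / 2 := by
  rw [K, norm_smul, mul_pow, norm_add_I_smul_sq _ _ (inner_powA_toL2_im (smooth_mem_domA hm _)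
    (mem_domA_of_nonpos hm (by norm_num) _)), norm_inv, Complex.norm_real,
    Real.norm_of_nonneg (Real.sqrt_nonneg _), inv_pow, Real.sq_sqrt (by norm_num)]
  ring

/-- Multiplication of Cauchy data by a smooth function. -/
noncomputable def dataMul (h : SmoothFun) (z : CauchyData) : CauchyData :=
  (smoothMul h z.1, smoothMul h z.2)

theorem exists_norm_K_dataMul_le (hm : 0 < m) (h : SmoothFun) :
    ∃ C, 0 < C ∧ ∀ z, ‖K m (dataMul h z)‖ ≤ C * ‖K m z‖ := by
  obtain ⟨C₁, h1⟩ := exists_norm_powA_smoothMul_le hm (α := 1 / 4) (by norm_num [abs_of_pos])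
    (smooth_mem_domA hm) h
  obtain ⟨C₂, h2⟩ := exists_norm_powA_smoothMul_le hm (α := -(1 / 4)) (by norm_num [abs_of_pos])
    (fun _ => mem_domA_of_nonpos hm (by norm_num) _) h
  refine ⟨|C₁| + |C₂| + 1, by positivity, fun z => ?_⟩
  refine (sq_le_sq₀ (norm_nonneg _) (by positivity)).1 ?_
  rw [mul_pow, norm_K_sq hm, norm_K_sq hm]
  have e1 := (h1 z.1).trans (mul_le_mul_of_nonneg_right
    (by linarith [le_abs_self C₁, abs_nonneg C₂] : C₁ ≤ |C₁| + |C₂| + 1) (norm_nonneg _))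
  have e2 := (h2 z.2).trans (mul_le_mul_of_nonneg_right
    (by linarith [le_abs_self C₂, abs_nonneg C₁] : C₂ ≤ |C₁| + |C₂| + 1) (norm_nonneg _))
  have e1' := pow_le_pow_left₀ (norm_nonneg _) e1 2
  have e2' := pow_le_pow_left₀ (norm_nonneg _) e2 2
  rw [mul_pow] at e1' e2'
  simp only [dataMul]
  linarith

/-! ### A partition of unity subordinate to two proper intervals -/

noncomputable def cosFun : SmoothFun :=
  SmoothFun.ofPeriodic Real.cos Real.contDiff_cos Real.cos_periodic

theorem cosFun_coe (x : ℝ) : (cosFun : S1 → ℝ) (x : S1) = Real.cos x :=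
  SmoothFun.ofPeriodic_coe _ _ x

/-- It vanishes where the cosine is at most `-1/2` and equals one where the cosine is at least
`1/2`. -/
noncomputable def bump : SmoothFun :=
  ⟨fun θ => Real.smoothTransition ((cosFun : S1 → ℝ) θ + 1 / 2),
    Real.smoothTransition.contDiff.comp ((smoothFun_contDiff cosFun).add contDiff_const)⟩

theorem bump_apply (θ : S1) :
    (bump : S1 → ℝ) θ = Real.smoothTransition ((cosFun : S1 → ℝ) θ + 1 / 2) := rfl

noncomputable def coBump : SmoothFun :=
  ⟨fun θ => 1 - (bump : S1 → ℝ) θ, by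
    change ContDiff ℝ (⊤ : ℕ∞) fun x : ℝ => 1 - (bump : S1 → ℝ) (x : S1)
    exact contDiff_const.sub (smoothFun_contDiff bump)⟩

theorem coBump_apply (θ : S1) : (coBump : S1 → ℝ) θ = 1 - (bump : S1 → ℝ) θ := rfl

theorem dataMul_bump_add (z : CauchyData) : dataMul bump z + dataMul coBump z = z := by
  have h : ∀ Φ : SmoothFun, smoothMul bump Φ + smoothMul coBump Φ = Φ := fun Φ =>
    Subtype.ext <| funext fun θ => by
      change (bump : S1 → ℝ) θ * (Φ : S1 → ℝ) θ + (1 - (bump : S1 → ℝ) θ) * (Φ : S1 → ℝ) θ = _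
      ring
  exact Prod.ext (h _) (h _)

/-- The thresholds `±3/4` lie beyond `±1/2`, so the closed supports of the cut-off data fit inside
the open intervals. -/
def cosIntervalRight : Set S1 := {θ | -(3 / 4) < (cosFun : S1 → ℝ) θ}

def cosIntervalLeft : Set S1 := {θ | (cosFun : S1 → ℝ) θ < 3 / 4}

theorem cosIntervalRight_eq : cosIntervalRight =
    (fun x : ℝ => (x : S1)) '' Set.Ioo (-Real.arccos (-(3 / 4))) (Real.arccos (-(3 / 4))) := by
  set a := Real.arccos (-(3 / 4)) with ha
  have hcos : Real.cos a = -(3 / 4) := Real.cos_arccos (by norm_num) (by norm_num)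
  have ha0 : 0 ≤ a := Real.arccos_nonneg _
  have haπ : a ≤ Real.pi := Real.arccos_le_pi _
  ext θ
  constructor
  · intro h
    obtain ⟨x, hx, rfl⟩ : ∃ x ∈ Set.Ioc (-Real.pi) (-Real.pi + 2 * Real.pi), (x : S1) = θ := by
      have := AddCircle.coe_image_Ioc_eq (2 * Real.pi) (-Real.pi)
      have hθ : θ ∈ (Set.univ : Set S1) := Set.mem_univ _
      rw [← this] at hθ
      exact hθ
    refine ⟨x, ?_, rfl⟩
    have h' : -(3 / 4) < Real.cos |x| := by
      rw [Real.cos_abs, ← cosFun_coe]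
      exact h
    rw [Set.mem_Ioo, ← abs_lt]
    by_contra hlt
    push Not at hlt
    have hxπ : |x| ≤ Real.pi := abs_le.2 ⟨hx.1.le, by linarith [hx.2]⟩
    have := Real.cos_le_cos_of_nonneg_of_le_pi ha0 hxπ hlt
    linarith
  · rintro ⟨x, hx, rfl⟩
    change -(3 / 4) < (cosFun : S1 → ℝ) (x : S1)
    rw [cosFun_coe, ← Real.cos_abs, ← hcos]
    exact Real.cos_lt_cos_of_nonneg_of_le_pi (abs_nonneg _) haπ (abs_lt.2 hx)

theorem cosFun_add_pi (θ : S1) :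
    (cosFun : S1 → ℝ) (θ + (Real.pi : ℝ)) = -(cosFun : S1 → ℝ) θ := by
  obtain ⟨x, rfl⟩ := QuotientAddGroup.mk_surjective θ
  have h1 := cosFun_coe (x + Real.pi)
  rw [AddCircle.coe_add, Real.cos_add_pi, ← cosFun_coe] at h1
  exact h1

theorem isProperInterval_cosIntervalRight : IsProperInterval cosIntervalRight where
  isOpen := isOpen_lt continuous_const (smooth_continuous _)
  isConnected := by
    rw [cosIntervalRight_eq]
    refine (isConnected_Ioo ?_).image _ (AddCircle.continuous_mk' _).continuousOn
    have : 0 < Real.arccos (-(3 / 4)) := Real.arccos_pos.2 (by norm_num)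
    linarith
  exterior_nonempty := by
    refine ⟨((Real.pi : ℝ) : S1), mem_interior.2 ⟨{θ | (cosFun : S1 → ℝ) θ < -(3 / 4)}, ?_, ?_, ?_⟩⟩
    · intro θ (h : (cosFun : S1 → ℝ) θ < _) (h' : _ < (cosFun : S1 → ℝ) θ)
      exact lt_asymm h h'
    · exact isOpen_lt (smooth_continuous _) continuous_const
    · change (cosFun : S1 → ℝ) ((Real.pi : ℝ) : S1) < -(3 / 4)
      rw [cosFun_coe, Real.cos_pi]
      norm_num

theorem isProperInterval_cosIntervalLeft : IsProperInterval cosIntervalLeft where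
  isOpen := isOpen_lt (smooth_continuous _) continuous_const
  isConnected := by
    -- Rotation by `π` changes the sign of the cosine, which reduces connectedness to the other
    -- interval.
    have h : cosIntervalLeft = (fun θ : S1 => θ + ((Real.pi : ℝ) : S1)) '' cosIntervalRight := by
      ext θ
      constructor
      · intro (h : (cosFun : S1 → ℝ) θ < 3 / 4)
        refine ⟨θ - ((Real.pi : ℝ) : S1), ?_, sub_add_cancel _ _⟩
        have h1 := cosFun_add_pi (θ - ((Real.pi : ℝ) : S1))
        rw [sub_add_cancel] at h1
        change -(3 / 4) < (cosFun : S1 → ℝ) (θ - ((Real.pi : ℝ) : S1))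
        linarith
      · rintro ⟨θ, h, rfl⟩
        have h' : -(3 / 4) < (cosFun : S1 → ℝ) θ := h
        change (cosFun : S1 → ℝ) (θ + ((Real.pi : ℝ) : S1)) < 3 / 4
        rw [cosFun_add_pi]
        linarith
    rw [h]
    exact isProperInterval_cosIntervalRight.isConnected.image _
      (continuous_add_const _).continuousOn
  exterior_nonempty := by
    refine ⟨((0 : ℝ) : S1), mem_interior.2 ⟨{θ | 3 / 4 < (cosFun : S1 → ℝ) θ}, ?_, ?_, ?_⟩⟩
    · intro θ (h : _ < (cosFun : S1 → ℝ) θ) (h' : (cosFun : S1 → ℝ) θ < _)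
      exact lt_asymm h h'
    · exact isOpen_lt continuous_const (smooth_continuous _)
    · change 3 / 4 < (cosFun : S1 → ℝ) ((0 : ℝ) : S1)
      rw [cosFun_coe, Real.cos_zero]
      norm_num

theorem dataMul_bump_mem (z : CauchyData) : dataMul bump z ∈ localData cosIntervalRight := by
  have h : ∀ Φ : SmoothFun, tsupport (smoothMul bump Φ : S1 → ℝ) ⊆ cosIntervalRight := by
    intro Φ
    have hc : IsClosed {θ | -(1 / 2) ≤ (cosFun : S1 → ℝ) θ} :=
      isClosed_le continuous_const (smooth_continuous _)
    refine (closure_minimal (fun θ hθ => ?_) hc).trans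
      fun θ (h : -(1 / 2) ≤ (cosFun : S1 → ℝ) θ) => ?_
    · by_contra hlt
      refine hθ ?_
      have hlt' : ¬ (-(1 / 2) ≤ (cosFun : S1 → ℝ) θ) := hlt
      rw [smoothMul_apply, bump_apply, Real.smoothTransition.zero_of_nonpos (by linarith), zero_mul]
    · change -(3 / 4) < (cosFun : S1 → ℝ) θ
      linarith
  exact ⟨h _, h _⟩

theorem dataMul_coBump_mem (z : CauchyData) : dataMul coBump z ∈ localData cosIntervalLeft := by
  have h : ∀ Φ : SmoothFun, tsupport (smoothMul coBump Φ : S1 → ℝ) ⊆ cosIntervalLeft := by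
    intro Φ
    have hc : IsClosed {θ | (cosFun : S1 → ℝ) θ ≤ 1 / 2} :=
      isClosed_le (smooth_continuous _) continuous_const
    refine (closure_minimal (fun θ hθ => ?_) hc).trans
      fun θ (h : (cosFun : S1 → ℝ) θ ≤ 1 / 2) => ?_
    · by_contra hlt
      refine hθ ?_
      have hlt' : ¬ ((cosFun : S1 → ℝ) θ ≤ 1 / 2) := hlt
      rw [smoothMul_apply, coBump_apply, bump_apply,
        Real.smoothTransition.one_of_one_le (by linarith), sub_self, zero_mul]
    · change (cosFun : S1 → ℝ) θ < 3 / 4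
      linarith
  exact ⟨h _, h _⟩

/-! ### Continuity with respect to `μ` -/

/-- Cauchy data supported in `I`, as a real subspace. -/
def localSubmodule (I : Set S1) : Submodule ℝ CauchyData where
  carrier := localData I
  add_mem' := fun {z w} hz hw =>
    ⟨(tsupport_add _ _).trans (Set.union_subset hz.1 hw.1),
      (tsupport_add _ _).trans (Set.union_subset hz.2 hw.2)⟩
  zero_mem' := by
    have h : tsupport ((0 : SmoothFun) : S1 → ℝ) ⊆ I := by
      have : ((0 : SmoothFun) : S1 → ℝ) = 0 := rfl
      rw [this, tsupport_zero]
      exact Set.empty_subset _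
    exact ⟨h, h⟩
  smul_mem' := fun c z hz =>
    ⟨(tsupport_smul_subset_right (fun _ => c) (z.1 : S1 → ℝ)).trans hz.1,
      (tsupport_smul_subset_right (fun _ => c) (z.2 : S1 → ℝ)).trans hz.2⟩

theorem quotChar_eq (χ₁ χ₂ : AddChar CauchyData Circle) (z : CauchyData) :
    quotChar χ₁ χ₂ z = ((χ₁ z / χ₂ z : Circle) : ℂ) := by
  rw [quotChar, div_eq_mul_inv, Circle.coe_mul, Circle.coe_inv_eq_conj, Complex.star_def]

theorem quotChar_add (χ₁ χ₂ : AddChar CauchyData Circle) (z w : CauchyData) :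
    quotChar χ₁ χ₂ (z + w) = quotChar χ₁ χ₂ z * quotChar χ₁ χ₂ w := by
  simp only [quotChar_eq, AddChar.map_add_eq_mul, ← Circle.coe_mul, mul_div_mul_comm]

theorem norm_quotChar (χ₁ χ₂ : AddChar CauchyData Circle) (z : CauchyData) :
    ‖quotChar χ₁ χ₂ z‖ = 1 := by rw [quotChar_eq, Circle.norm_coe]

theorem quotChar_zero (χ₁ χ₂ : AddChar CauchyData Circle) : quotChar χ₁ χ₂ 0 = 1 := by
  simp [quotChar_eq]

/-- The quotient is multiplicative with values of modulus one, so continuity at zero is uniform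
continuity. -/
theorem muContinuousOn_iff (χ₁ χ₂ : AddChar CauchyData Circle) (N : Submodule ℝ CauchyData) :
    MuContinuousOn m (quotChar χ₁ χ₂) (N : Set CauchyData) ↔
      ∀ ε > 0, ∃ δ > 0, ∀ w ∈ N, ‖K m w‖ < δ → ‖quotChar χ₁ χ₂ w - 1‖ < ε := by
  have hsq : ∀ w, Real.sqrt (mu m w w) = ‖K m w‖ := fun w => by
    rw [mu_self, Real.sqrt_sq (norm_nonneg _)]
  constructor
  · intro h ε hε
    obtain ⟨δ, hδ, h1⟩ := h 0 N.zero_mem ε hε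
    refine ⟨δ, hδ, fun w hw hlt => ?_⟩
    have := h1 w hw (by rwa [sub_zero, hsq])
    rwa [quotChar_zero] at this
  · intro h z hz ε hε
    obtain ⟨δ, hδ, h1⟩ := h ε hε
    refine ⟨δ, hδ, fun w hw hlt => ?_⟩
    rw [hsq] at hlt
    have h2 := h1 (w - z) (N.sub_mem hw hz) hlt
    have h3 : quotChar χ₁ χ₂ w - quotChar χ₁ χ₂ z =
        quotChar χ₁ χ₂ z * (quotChar χ₁ χ₂ (w - z) - 1) := by
      rw [mul_sub, ← quotChar_add, add_sub_cancel, mul_one]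
    rwa [h3, norm_mul, norm_quotChar, one_mul]

/-- The partition of unity writes `w` as a sum of two local data whose norms are controlled by that
of `w`, and the quotient character is multiplicative on this sum. Only two intervals are needed. -/
theorem muContinuousOn_univ_of_local (hm : 0 < m) {χ₁ χ₂ : AddChar CauchyData Circle}
    (h : ∀ I, IsProperInterval I → MuContinuousOn m (quotChar χ₁ χ₂) (localData I)) :
    MuContinuousOn m (quotChar χ₁ χ₂) Set.univ := by
  refine (muContinuousOn_iff χ₁ χ₂ ⊤).2 fun ε hε => ?_
  obtain ⟨δ₁, hδ₁, h1⟩ := (muContinuousOn_iff χ₁ χ₂ (localSubmodule _)).1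
    (h _ isProperInterval_cosIntervalRight) (ε / 2) (half_pos hε)
  obtain ⟨δ₂, hδ₂, h2⟩ := (muContinuousOn_iff χ₁ χ₂ (localSubmodule _)).1
    (h _ isProperInterval_cosIntervalLeft) (ε / 2) (half_pos hε)
  obtain ⟨C₁, hC₁, b1⟩ := exists_norm_K_dataMul_le hm bump
  obtain ⟨C₂, hC₂, b2⟩ := exists_norm_K_dataMul_le hm coBump
  refine ⟨min (δ₁ / C₁) (δ₂ / C₂), lt_min (by positivity) (by positivity), fun w _ hw => ?_⟩
  rw [lt_min_iff, lt_div_iff₀' hC₁, lt_div_iff₀' hC₂] at hw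
  have e1 := h1 _ (dataMul_bump_mem w) ((b1 w).trans_lt hw.1)
  have e2 := h2 _ (dataMul_coBump_mem w) ((b2 w).trans_lt hw.2)
  have e3 : quotChar χ₁ χ₂ w - 1 = quotChar χ₁ χ₂ (dataMul bump w) *
      (quotChar χ₁ χ₂ (dataMul coBump w) - 1) + (quotChar χ₁ χ₂ (dataMul bump w) - 1) := by
    conv_lhs => rw [← dataMul_bump_add w, quotChar_add]
    ring
  rw [e3]
  refine (norm_add_le _ _).trans_lt ?_
  rw [norm_mul, norm_quotChar, one_mul]
  linarith

end Multiplication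

end KGCircle

namespace KGCircle

/-! ## Characters and intertwiners -/

section Intertwiner

/-- A real normed space is simply connected, so `g` lifts through the covering `Circle.exp`.
Uniqueness of lifts makes the lift additive, and a continuous additive map is real linear. -/
theorem exists_clm_of_continuous_character {R : Type*} [NormedAddCommGroup R] [NormedSpace ℝ R]
    {g : R → Circle} (hc : Continuous g) (hadd : ∀ x y, g (x + y) = g x * g y) :
    ∃ f : R →L[ℝ] ℝ, ∀ x, g x = Circle.exp (f x) := by
  have h0 : g 0 = 1 := by
    have h := hadd 0 0
    rw [add_zero] at h
    exact left_eq_mul.1 h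
  obtain ⟨F, ⟨hF0, hF⟩, -⟩ := Circle.isCoveringMap_exp.existsUnique_continuousMap_lifts
    (⟨g, hc⟩ : C(R, Circle)) 0 0 (by simp [h0])
  have hFx : ∀ x, Circle.exp (F x) = g x := fun x => congrFun hF x
  have hFadd : ∀ x y, F (x + y) = F x + F y := by
    intro x y
    have h := Circle.isCoveringMap_exp.eq_of_comp_eq (g₁ := fun x => F (x + y))
      (g₂ := fun x => F x + F y) (by fun_prop) (by fun_prop) (by
        funext x
        simp only [Function.comp_apply, Circle.exp_add, hFx, hadd]) 0 (by simp [hF0])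
    exact congrFun h x
  exact ⟨(AddMonoidHom.mk' F hFadd).toRealLinearMap F.continuous, fun x => (hFx x).symm⟩

variable {E H V : Type*} [NormedAddCommGroup E] [InnerProductSpace ℂ E]
  [NormedAddCommGroup H] [InnerProductSpace ℂ H]

variable [CompleteSpace H] {e : E → H}

/-- The Weyl operator as a unitary isometry. -/
noncomputable def IsExponential.weylIso (he : IsExponential e) (η : E) : H ≃ₗᵢ[ℂ] H :=
  Unitary.linearIsometryEquiv ⟨weyl e η, he.weyl_mem_unitary η⟩

theorem IsExponential.weylIso_apply (he : IsExponential e) (η : E) (x : H) :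
    he.weylIso η x = weyl e η x := rfl

theorem IsExponential.weyl_apply_weyl_apply (he : IsExponential e) (η ψ : E) (x : H) :
    weyl e η (weyl e ψ x) =
      Complex.exp (-(2 * I * (⟪η, ψ⟫_ℂ).im)) • weyl e ψ (weyl e η x) := by
  have h := congrArg (fun T : H →L[ℂ] H => T (weyl e η x)) (he.weyl_mul_mul_star η ψ)
  have h2 : star (weyl e η) (weyl e η x) = x := by
    rw [he.star_weyl]
    exact congrArg (fun T : H →L[ℂ] H => T x) (he.weyl_neg_mul η)
  calc weyl e η (weyl e ψ x) = weyl e η (weyl e ψ (star (weyl e η) (weyl e η x))) := by rw [h2]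
    _ = _ := h

variable [CompleteSpace E] [AddCommGroup V] [Module ℝ V]

/-- A character that is continuous with respect to the seminorm `‖κ z‖` on a subspace is given
there by the imaginary part of the inner product with a fixed vector. -/
theorem exists_inner_eq_character {κ : V → E} (hκ : ∀ z w, κ (z + w) = κ z + κ w)
    (hκs : ∀ (c : ℝ) z, κ (c • z) = (c : ℂ) • κ z) (N : Submodule ℝ V) {q : V → Circle}
    (hq : ∀ z w, q (z + w) = q z * q w)
    (hcont : ∀ ε > 0, ∃ δ > 0, ∀ w ∈ N, ‖κ w‖ < δ → ‖(q w : ℂ) - 1‖ < ε) :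
    ∃ η : E, ∀ z ∈ N, (q z : ℂ) = Complex.exp (-(2 * I * (⟪η, κ z⟫_ℂ).im)) := by
  have hsub : ∀ z w, κ (z - w) = κ z - κ w := fun z w => by
    rw [eq_sub_iff_add_eq, ← hκ, sub_add_cancel]
  have hqsub : ∀ z w, q (z - w) = q z / q w := fun z w => by
    rw [eq_div_iff_mul_eq', ← hq, sub_add_cancel]
  have hdist : ∀ z w, ‖(q (z - w) : ℂ) - 1‖ = dist (q z) (q w) := fun z w => by
    have h1 : (q (z - w) : ℂ) - 1 = ((q z : ℂ) - q w) * ((q w)⁻¹ : Circle) := by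
      rw [hqsub, div_eq_mul_inv, Circle.coe_mul, sub_mul, ← Circle.coe_mul (q w), mul_inv_cancel,
        Circle.coe_one]
    rw [h1, norm_mul, Circle.norm_coe, mul_one]
    exact (dist_eq_norm _ _).symm
  -- The character descends to the image of `N`: continuity at zero makes it trivial on differences
  -- killed by `κ`.
  let R : Submodule ℝ E :=
    { carrier := κ '' N
      add_mem' := by
        rintro _ _ ⟨z, hz, rfl⟩ ⟨w, hw, rfl⟩
        exact ⟨z + w, N.add_mem hz hw, hκ z w⟩
      zero_mem' := ⟨0, N.zero_mem, by simpa using hκs 0 0⟩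
      smul_mem' := by
        rintro c _ ⟨z, hz, rfl⟩
        exact ⟨c • z, N.smul_mem c hz, by rw [hκs, Complex.coe_smul]⟩ }
  have hR : ∀ r : R, ∃ z ∈ N, κ z = r := fun r => r.2
  choose s hsN hs using hR
  have heq : ∀ z ∈ N, ∀ w ∈ N, κ z = κ w → q z = q w := by
    intro z hz w hw h
    rw [← dist_eq_zero, ← hdist]
    refine le_antisymm (le_of_forall_pos_lt_add fun ε hε => ?_) (norm_nonneg _)
    obtain ⟨δ, hδ, hlt⟩ := hcont ε hε
    rw [zero_add]
    exact hlt _ (N.sub_mem hz hw) (by rwa [hsub, h, sub_self, norm_zero])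
  have hgc : Continuous fun r : R => q (s r) := by
    rw [Metric.continuous_iff]
    intro b ε hε
    obtain ⟨δ, hδ, hlt⟩ := hcont ε hε
    refine ⟨δ, hδ, fun a ha => ?_⟩
    rw [← hdist]
    refine hlt _ (N.sub_mem (hsN a) (hsN b)) ?_
    rwa [hsub, hs, hs, ← dist_eq_norm, ← Subtype.dist_eq]
  obtain ⟨f, hf⟩ := exists_clm_of_continuous_character hgc fun x y => by
    rw [← hq]
    refine heq _ (hsN _) _ (N.add_mem (hsN _) (hsN _)) ?_
    rw [hκ, hs, hs, hs]
    rfl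
  -- Hahn-Banach is applied because the image `R` need not be closed or dense.
  obtain ⟨F, hF, -⟩ := exists_extension_norm_eq R f
  obtain ⟨v, hv⟩ : ∃ v : E, ∀ x, F x = (⟪v, x⟫_ℂ).re := by
    let _ : InnerProductSpace ℝ E := InnerProductSpace.complexToReal
    refine ⟨(InnerProductSpace.toDual ℝ E).symm F, fun x => ?_⟩
    rw [← InnerProductSpace.toDual_symm_apply (𝕜 := ℝ), real_inner_eq_re_inner ℂ]
    rfl
  -- With this factor `-2 Im ⟪η, x⟫` equals `Re ⟪v, x⟫`.
  refine ⟨(I / 2) • v, fun z hz => ?_⟩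
  have h1 : q z = Circle.exp (F (κ z)) := by
    have h2 := hf ⟨κ z, z, hz, rfl⟩
    rw [← hF] at h2
    rw [← h2]
    exact heq _ hz _ (hsN _) (hs ⟨κ z, z, hz, rfl⟩).symm
  rw [h1, Circle.coe_exp, hv, inner_smul_left]
  congr 1
  have h3 : (starRingEnd ℂ) (I / 2) = ((-1 / 2 : ℝ) : ℂ) * I := by
    rw [map_div₀, Complex.conj_I, map_ofNat]
    push_cast
    ring
  rw [h3, mul_assoc ((-1 / 2 : ℝ) : ℂ) I, Complex.im_ofReal_mul, Complex.I_mul_im]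
  push_cast
  ring

/-- An intertwiner turns the quotient `q` into the scalar by which `U ∘ weyl` and `weyl ∘ U` differ,
and both tend to `U` strongly as the argument tends to zero. Conversely, a continuous quotient is a
symplectic pairing with some `η`, and a Weyl operator intertwines. -/
theorem IsExponential.exists_intertwiner_iff (he : IsExponential e) {κ : V → E}
    (hκ : ∀ z w, κ (z + w) = κ z + κ w) (hκs : ∀ (c : ℝ) z, κ (c • z) = (c : ℂ) • κ z)
    (N : Submodule ℝ V) {χ₁ χ₂ : V → Circle} (h1 : ∀ z w, χ₁ (z + w) = χ₁ z * χ₁ w)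
    (h2 : ∀ z w, χ₂ (z + w) = χ₂ z * χ₂ w) :
    (∃ U : H ≃ₗᵢ[ℂ] H, ∀ z ∈ N, ∀ x,
      U ((χ₁ z : ℂ) • weyl e (κ z) x) = (χ₂ z : ℂ) • weyl e (κ z) (U x)) ↔
    ∀ ε > 0, ∃ δ > 0, ∀ w ∈ N, ‖κ w‖ < δ → ‖((χ₁ w / χ₂ w : Circle) : ℂ) - 1‖ < ε := by
  constructor
  · rintro ⟨U, hU⟩ ε hε
    set x := e 0 with hx
    have hxn : ‖x‖ = 1 := by
      have h := inner_self_eq_norm_sq (𝕜 := ℂ) x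
      rw [hx, he.inner_eq, inner_zero_left, Complex.exp_zero, RCLike.one_re] at h
      exact (pow_eq_one_iff_of_nonneg (norm_nonneg _) two_ne_zero).1 h.symm
    have hc : Continuous fun ψ => ‖x - weyl e ψ x‖ + ‖weyl e ψ (U x) - U x‖ :=
      (continuous_const.sub (he.continuous_weyl_apply x)).norm.add
        ((he.continuous_weyl_apply (U x)).sub continuous_const).norm
    have hc0 := hc.tendsto 0
    simp only [he.weyl_zero, one_apply_eq_self, sub_self, norm_zero, add_zero]
      at hc0
    obtain ⟨δ, hδ, hlt⟩ := Metric.eventually_nhds_iff.1 (hc0.eventually (eventually_lt_nhds hε))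
    refine ⟨δ, hδ, fun w hw hwδ => ?_⟩
    refine lt_of_le_of_lt ?_ (hlt (y := κ w) (by rwa [dist_zero_right]))
    set q : Circle := χ₁ w / χ₂ w with hq
    have e1 : (q : ℂ) • U (weyl e (κ w) x) = weyl e (κ w) (U x) := by
      have h3 := hU w hw x
      rw [map_smul] at h3
      have h4 := congrArg (fun y => (((χ₂ w)⁻¹ : Circle) : ℂ) • y) h3
      simp only [smul_smul, ← Circle.coe_mul, inv_mul_cancel, Circle.coe_one, one_smul] at h4
      rw [← h4, hq, div_eq_inv_mul]
    have e2 : ((q : ℂ) - 1) • U x =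
        (q : ℂ) • U (x - weyl e (κ w) x) + (weyl e (κ w) (U x) - U x) := by
      rw [map_sub, smul_sub, e1, sub_smul, one_smul]
      abel
    have e3 := congrArg norm e2
    rw [norm_smul, U.norm_map, hxn, mul_one] at e3
    rw [e3]
    refine (norm_add_le _ _).trans_eq ?_
    rw [norm_smul, Circle.norm_coe, one_mul, U.norm_map]
  · intro h
    obtain ⟨η, hη⟩ := exists_inner_eq_character hκ hκs N (q := fun z => χ₁ z / χ₂ z)
      (fun z w => by rw [h1, h2, mul_div_mul_comm]) h
    -- Commuting `weyl e (-η)` past a Weyl operator produces the phase `q⁻¹`, which turns `χ₁` into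
    -- `χ₂`.
    refine ⟨he.weylIso (-η), fun z hz x => ?_⟩
    rw [map_smul, he.weylIso_apply, he.weylIso_apply, he.weyl_apply_weyl_apply, smul_smul]
    congr 1
    have h3 : Complex.exp (-(2 * I * (⟪-η, κ z⟫_ℂ).im)) * ((χ₁ z / χ₂ z : Circle) : ℂ) = 1 := by
      rw [hη z hz, ← Complex.exp_add, inner_neg_left, Complex.neg_im]
      push_cast
      rw [mul_neg, neg_neg, add_neg_cancel, Complex.exp_zero]
    have h4 : (χ₁ z : ℂ) = ((χ₁ z / χ₂ z : Circle) : ℂ) * (χ₂ z : ℂ) := by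
      rw [← Circle.coe_mul, div_mul_cancel]
    rw [h4, mul_right_comm, mul_comm _ (Complex.exp _), h3, one_mul]

end Intertwiner

/-! ### Intertwiners on generated algebras and uniqueness of GNS triples -/

section Representations

variable {𝔄 : Type*} [CStarAlgebra 𝔄] {H H' : Type*} [NormedAddCommGroup H]
  [InnerProductSpace ℂ H] [CompleteSpace H] [NormedAddCommGroup H'] [InnerProductSpace ℂ H']
  [CompleteSpace H']

theorem continuous_starAlgHom {𝔅 : Type*} [CStarAlgebra 𝔅] (π : 𝔄 →⋆ₐ[ℂ] 𝔅) : Continuous π :=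
  AddMonoidHomClass.continuous_of_bound π 1 fun a => by
    rw [one_mul]
    exact NonUnitalStarAlgHom.norm_apply_le π a

theorem intertwines_of_mem_closure_adjoin (π₁ : 𝔄 →⋆ₐ[ℂ] (H →L[ℂ] H))
    (π₂ : 𝔄 →⋆ₐ[ℂ] (H' →L[ℂ] H')) (U : H ≃ₗᵢ[ℂ] H') {S : Set 𝔄}
    (hS : ∀ a ∈ S, ∀ x, U (π₁ a x) = π₂ a (U x)) :
    ∀ a ∈ (StarAlgebra.adjoin ℂ S).topologicalClosure, ∀ x, U (π₁ a x) = π₂ a (U x) := by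
  have hcl : IsClosed {a : 𝔄 | ∀ x, U (π₁ a x) = π₂ a (U x)} := by
    have : {a : 𝔄 | ∀ x, U (π₁ a x) = π₂ a (U x)} = ⋂ x, {a | U (π₁ a x) = π₂ a (U x)} := by
      ext a
      simp only [Set.mem_iInter]
      exact Iff.rfl
    rw [this]
    refine isClosed_iInter fun x => isClosed_eq ?_ ?_
    · exact U.continuous.comp ((ContinuousLinearMap.apply ℂ H x).continuous.comp (continuous_starAlgHom π₁))
    · exact (ContinuousLinearMap.apply ℂ H' (U x)).continuous.comp (continuous_starAlgHom π₂)
  have hsub : ((StarAlgebra.adjoin ℂ S : StarSubalgebra ℂ 𝔄) : Set 𝔄) ⊆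
      {a : 𝔄 | ∀ x, U (π₁ a x) = π₂ a (U x)} := by
    intro a ha
    refine StarAlgebra.adjoin_induction (p := fun a _ => ∀ x, U (π₁ a x) = π₂ a (U x))
      hS ?_ ?_ ?_ ?_ ha
    · intro r x
      rw [AlgHomClass.commutes π₁, AlgHomClass.commutes π₂, Algebra.algebraMap_eq_smul_one,
        Algebra.algebraMap_eq_smul_one]
      exact map_smul U r x
    · intro a b _ _ ha hb x
      rw [map_add, map_add, add_apply, add_apply, map_add,
        ha, hb]
    · intro a b _ _ ha hb x
      rw [map_mul, map_mul, mul_apply_eq_comp,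
        mul_apply_eq_comp, ha, hb]
    · intro a _ ha x
      refine ext_inner_left ℂ fun y => ?_
      obtain ⟨y, rfl⟩ := U.surjective y
      rw [U.inner_map_map, map_star, map_star, ContinuousLinearMap.star_eq_adjoint,
        ContinuousLinearMap.star_eq_adjoint, ContinuousLinearMap.adjoint_inner_right,
        ContinuousLinearMap.adjoint_inner_right, ← ha, U.inner_map_map]
  exact fun a ha => closure_minimal hsub hcl ha

theorem exists_linearIsometryEquiv {X : Type*} [AddCommGroup X] [Module ℂ X] (f : X →ₗ[ℂ] H)
    (g : X →ₗ[ℂ] H') (hf : DenseRange f) (hg : DenseRange g) (h : ∀ x, ‖f x‖ = ‖g x‖) :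
    ∃ U : H ≃ₗᵢ[ℂ] H', ∀ x, U (f x) = g x := by
  have hU := fun x => LinearMap.extendOfNorm_eq (e := f) (f := g) hf ⟨1, fun x => by
    rw [h, one_mul]⟩ x
  have hV := fun x => LinearMap.extendOfNorm_eq (e := g) (f := f) hg ⟨1, fun x => by
    rw [h, one_mul]⟩ x
  set U := g.extendOfNorm f
  set V := f.extendOfNorm g
  have hVU : ∀ y, V (U y) = y := fun y => by
    refine congrFun (hf.equalizer (V.continuous.comp U.continuous) continuous_id ?_) y
    funext x
    simp only [Function.comp_apply, hU, hV, id]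
  have hUV : ∀ y, U (V y) = y := fun y => by
    refine congrFun (hg.equalizer (U.continuous.comp V.continuous) continuous_id ?_) y
    funext x
    simp only [Function.comp_apply, hU, hV, id]
  have hn : ∀ y, ‖U y‖ = ‖y‖ := fun y => by
    refine congrFun (hf.equalizer U.continuous.norm continuous_norm ?_) y
    funext x
    simp only [Function.comp_apply, hU, h]
  exact ⟨⟨LinearEquiv.ofLinearMap U.toLinearMap V.toLinearMap (LinearMap.ext hUV) (LinearMap.ext hVU),
    hn⟩, hU⟩

variable [PartialOrder 𝔄] [StarOrderedRing 𝔄]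

/-- Uniqueness of the GNS construction: the vectors of `a` in the two spaces have the same squared
norm `φ (star a * a)`. Unitary equivalence of states can thus be tested on Fock space. -/
theorem IsGNSTriple.exists_equiv {φ : 𝔄 →ₚ[ℂ] ℂ} {π : 𝔄 →⋆ₐ[ℂ] (H →L[ℂ] H)} {Ψ : H}
    (hπ : IsGNSTriple φ π Ψ) :
    ∃ T : φ.GNS ≃ₗᵢ[ℂ] H, ∀ a x, T (φ.gnsStarAlgHom a x) = π a (T x) := by
  let f : 𝔄 →ₗ[ℂ] φ.GNS :=
    (UniformSpace.Completion.toComplL (𝕜 := ℂ) (E := φ.PreGNS)).toLinearMap ∘ₗ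
      φ.toPreGNS.toLinearMap
  let g : 𝔄 →ₗ[ℂ] H := (ContinuousLinearMap.apply ℂ H Ψ).toLinearMap ∘ₗ π.toAlgHom.toLinearMap
  have hfa : ∀ a, f a = ((φ.toPreGNS a : φ.PreGNS) : φ.GNS) := fun _ => rfl
  have hga : ∀ a, g a = π a Ψ := fun _ => rfl
  have hf : DenseRange f :=
    (UniformSpace.Completion.denseRange_coe (α := φ.PreGNS)).comp
      φ.toPreGNS.surjective.denseRange (UniformSpace.Completion.continuous_coe _)
  have hn : ∀ a, ‖f a‖ = ‖g a‖ := by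
    intro a
    rw [hfa, hga, UniformSpace.Completion.norm_coe, ← sq_eq_sq₀ (norm_nonneg _) (norm_nonneg _)]
    have h1 := φ.preGNS_norm_sq (φ.toPreGNS a)
    have h2 := inner_self_eq_norm_sq_to_K (𝕜 := ℂ) (π a Ψ)
    have h3 : ⟪π a Ψ, π a Ψ⟫_ℂ = φ (star a * a) := by
      rw [hπ.expectation, map_mul, map_star, mul_apply_eq_comp,
        ContinuousLinearMap.star_eq_adjoint, ContinuousLinearMap.adjoint_inner_right]
    rw [h3] at h2
    have h4 := h1.trans h2
    refine Complex.ofReal_injective ?_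
    rw [Complex.ofReal_pow, Complex.ofReal_pow]
    exact h4
  obtain ⟨T, hT⟩ := exists_linearIsometryEquiv f g hf hπ.cyclic hn
  refine ⟨T, fun a x => ?_⟩
  refine congrFun (hf.equalizer (T.continuous.comp (φ.gnsStarAlgHom a).continuous)
    ((π a).continuous.comp T.continuous) ?_) x
  funext b
  simp only [Function.comp_apply]
  rw [hT, hga, ← mul_apply_eq_comp, ← map_mul, ← hga, ← hT]
  congr 1
  rw [hfa, hfa]
  exact φ.gnsNonUnitalStarAlgHom_apply_coe

theorem unitarilyEquivalentOn_iff {φ φ' : 𝔄 →ₚ[ℂ] ℂ} {π : 𝔄 →⋆ₐ[ℂ] (H →L[ℂ] H)} {Ψ : H}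
    {π' : 𝔄 →⋆ₐ[ℂ] (H' →L[ℂ] H')} {Ψ' : H'} (hπ : IsGNSTriple φ π Ψ)
    (hπ' : IsGNSTriple φ' π' Ψ') (S : Set 𝔄) :
    UnitarilyEquivalentOn S φ φ' ↔
      ∃ U : H ≃ₗᵢ[ℂ] H', ∀ a ∈ S, ∀ x, U (π a x) = π' a (U x) := by
  obtain ⟨T, hT⟩ := hπ.exists_equiv
  obtain ⟨T', hT'⟩ := hπ'.exists_equiv
  have hs : ∀ a x, T.symm (π a x) = φ.gnsStarAlgHom a (T.symm x) := fun a x => by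
    rw [LinearIsometryEquiv.symm_apply_eq, hT, LinearIsometryEquiv.apply_symm_apply]
  have hs' : ∀ a x, T'.symm (π' a x) = φ'.gnsStarAlgHom a (T'.symm x) := fun a x => by
    rw [LinearIsometryEquiv.symm_apply_eq, hT', LinearIsometryEquiv.apply_symm_apply]
  constructor
  · rintro ⟨U, hU⟩
    refine ⟨(T.symm.trans U).trans T', fun a ha x => ?_⟩
    simp only [LinearIsometryEquiv.trans_apply, hs, hU a ha, hT']
  · rintro ⟨U, hU⟩
    refine ⟨(T.trans U).trans T'.symm, fun a ha x => ?_⟩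
    simp only [LinearIsometryEquiv.trans_apply, hT, hU a ha, hs']

end Representations

end KGCircle

namespace KGCircle

/-! ## The vacuum representation and its character automorphisms -/

section Vacuum

/-- The vector functional `a ↦ ⟪Ψ, π(a) Ψ⟫`. -/
noncomputable def vectorFunctional {𝔄 : Type*} [CStarAlgebra 𝔄] [PartialOrder 𝔄]
    [StarOrderedRing 𝔄] {H : Type*} [NormedAddCommGroup H] [InnerProductSpace ℂ H]
    [CompleteSpace H] (π : 𝔄 →⋆ₐ[ℂ] (H →L[ℂ] H)) (Ψ : H) : 𝔄 →ₚ[ℂ] ℂ :=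
  PositiveLinearMap.mk₀
    ((innerSL ℂ Ψ ∘L ContinuousLinearMap.apply ℂ H Ψ).toLinearMap ∘ₗ π.toAlgHom.toLinearMap)
    (fun a ha => by
      obtain ⟨b, rfl⟩ := CStarAlgebra.nonneg_iff_eq_star_mul_self.1 ha
      change 0 ≤ ⟪Ψ, π (star b * b) Ψ⟫_ℂ
      rw [map_mul, map_star, mul_apply_eq_comp, ContinuousLinearMap.star_eq_adjoint,
        ContinuousLinearMap.adjoint_inner_right, inner_self_eq_norm_sq_to_K]
      have h : (0 : ℂ) ≤ ((‖π b Ψ‖ ^ 2 : ℝ) : ℂ) := Complex.zero_le_real.2 (sq_nonneg _)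
      rwa [Complex.ofReal_pow] at h)

theorem vectorFunctional_apply {𝔄 : Type*} [CStarAlgebra 𝔄] [PartialOrder 𝔄]
    [StarOrderedRing 𝔄] {H : Type*} [NormedAddCommGroup H] [InnerProductSpace ℂ H]
    [CompleteSpace H] (π : 𝔄 →⋆ₐ[ℂ] (H →L[ℂ] H)) (Ψ : H) (a : 𝔄) :
    vectorFunctional π Ψ a = ⟪Ψ, π a Ψ⟫_ℂ := rfl

theorem IsExponential.dense_of_dense {E H : Type*} [NormedAddCommGroup E] [InnerProductSpace ℂ E]
    [NormedAddCommGroup H] [InnerProductSpace ℂ H] {e : E → H} (he : IsExponential e) {D : Set E}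
    (hD : Dense D) (S : Submodule ℂ H) (hS : ∀ φ ∈ D, e φ ∈ S) : Dense (S : Set H) := by
  have hc : Continuous e := continuous_of_inner_eq_exp he.inner_eq
  have h : Submodule.span ℂ (Set.range e) ≤ S.topologicalClosure := by
    rw [Submodule.span_le]
    rintro _ ⟨φ, rfl⟩
    exact map_mem_closure hc (hD φ) hS
  rw [← dense_closure]
  exact he.dense_span.mono h

variable {m : ℝ} {H : Type*} [NormedAddCommGroup H] [InnerProductSpace ℂ H] [CompleteSpace H]
  {e : OneParticle → H}

theorem IsExponential.isWeylSystem_weyl_K (he : IsExponential e) (hm : 0 < m) :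
    IsWeylSystem (fun z w => sympLin z w) fun z => weyl e (K m z) where
  map_zero := by rw [K_zero hm, he.weyl_zero]
  map_neg z := by
    have h : K m (-z) = -K m z := eq_neg_of_add_eq_zero_left (by
      rw [← K_add hm, neg_add_cancel, K_zero hm])
    rw [h, he.star_weyl]
  map_mul z w := by
    rw [he.weyl_mul, K_add hm, inner_K_im hm, sympLin_apply]
    congr 2
    push_cast
    ring

/-- The vector is formally `K (0, f)`, and the one in `inner_upper_K_im` is formally `K (g, 0)`; the
formulas extend `inner_K_im` to such nonsmooth data. -/
theorem inner_lower_K_im (hm : 0 < m) (f : S1 → ℝ) (hf : MemLp f 2 volume) (z : CauchyData) :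
    (⟪(I * ((Real.sqrt 2)⁻¹ : ℂ)) • powA m (-(1 / 4)) (toL2 f hf), K m z⟫_ℂ).im =
      -(∫ θ, f θ * (z.1 : S1 → ℝ) θ) / 2 := by
  have h : (I * ((Real.sqrt 2)⁻¹ : ℂ)) • powA m (-(1 / 4)) (toL2 f hf) =
      ((Real.sqrt 2)⁻¹ : ℂ) • (0 + I • powA m (-(1 / 4)) (toL2 f hf)) := by
    rw [zero_add, smul_smul, mul_comm I]
  have hd : ∀ ψ, ψ ∈ domA m (-(1 / 4)) := mem_domA_of_nonpos hm (by norm_num)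
  have h' := inner_powA_powA_neg hm (α := -(1 / 4 : ℝ)) (hd (toL2 f hf))
    (by rw [neg_neg]; exact smooth_mem_domA hm z.1)
  rw [neg_neg] at h'
  rw [h, K, inner_smul_I_add_im _ _ _ _ (by simp) (inner_powA_toL2_im (hd _) (hd _)), h',
    inner_toL2, inner_zero_left, Complex.ofReal_re, Complex.zero_re, zero_sub]

theorem inner_upper_K_im (hm : 0 < m) (g : S1 → ℝ) (hg : MemLp g 2 volume)
    (hdom : toL2 g hg ∈ domA m (1 / 4)) (z : CauchyData) :
    (⟪((Real.sqrt 2)⁻¹ : ℂ) • powA m (1 / 4) (toL2 g hg), K m z⟫_ℂ).im =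
      (∫ θ, g θ * (z.2 : S1 → ℝ) θ) / 2 := by
  have h : ((Real.sqrt 2)⁻¹ : ℂ) • powA m (1 / 4) (toL2 g hg) =
      ((Real.sqrt 2)⁻¹ : ℂ) • (powA m (1 / 4) (toL2 g hg) + I • (0 : OneParticle)) := by
    rw [smul_zero, add_zero]
  have h' := inner_powA_powA_neg hm hdom
    (mem_domA_of_nonpos hm (by norm_num) (toL2 z.2 (smooth_memLp _)))
  rw [h, K, inner_smul_I_add_im _ _ _ _ (inner_powA_toL2_im hdom (smooth_mem_domA hm _)) (by simp),
    h', inner_toL2, inner_zero_left, Complex.ofReal_re, Complex.zero_re, sub_zero]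

variable {𝔄 : Type*} [CStarAlgebra 𝔄] {W : CauchyData → 𝔄}

/-- Two twisted representations are intertwined on the algebra of a subspace if and only if the
quotient of the characters is `μ`-continuous there. -/
theorem IsExponential.exists_intertwiner_iff_muContinuousOn (he : IsExponential e) (hm : 0 < m)
    {χ₁ χ₂ : AddChar CauchyData Circle} {π₁ π₂ : 𝔄 →⋆ₐ[ℂ] (H →L[ℂ] H)}
    (h1 : ∀ z, π₁ (W z) = (χ₁ z : ℂ) • weyl e (K m z))
    (h2 : ∀ z, π₂ (W z) = (χ₂ z : ℂ) • weyl e (K m z)) (N : Submodule ℝ CauchyData) :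
    (∃ U : H ≃ₗᵢ[ℂ] H, ∀ a ∈ (StarAlgebra.adjoin ℂ (W '' N)).topologicalClosure,
      ∀ x, U (π₁ a x) = π₂ a (U x)) ↔ MuContinuousOn m (quotChar χ₁ χ₂) (N : Set CauchyData) := by
  rw [muContinuousOn_iff]
  simp only [quotChar_eq]
  rw [← he.exists_intertwiner_iff (K_add hm) (K_smul hm) N χ₁.map_add_eq_mul χ₂.map_add_eq_mul]
  refine exists_congr fun U => ⟨fun h z hz x => ?_, fun h => ?_⟩
  · have h3 := h (W z) (StarSubalgebra.le_topologicalClosure _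
      (StarAlgebra.subset_adjoin ℂ _ ⟨z, hz, rfl⟩)) x
    rw [h1, h2] at h3
    exact h3
  · refine intertwines_of_mem_closure_adjoin π₁ π₂ U ?_
    rintro _ ⟨z, hz, rfl⟩ x
    rw [h1, h2]
    exact h z hz x

/-- A character given by the symplectic pairing with a vector `η` is implemented by the Weyl
operator of `η`. -/
theorem IsExponential.implemented_of_character (he : IsExponential e)
    (hW : IsWeylAlgebra symp W) {χ : AddChar CauchyData Circle} {π₀ π : 𝔄 →⋆ₐ[ℂ] (H →L[ℂ] H)}
    (h0 : ∀ z, π₀ (W z) = weyl e (K m z)) (h : ∀ z, π (W z) = (χ z : ℂ) • π₀ (W z))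
    {η : OneParticle} (hη : ∀ z, (χ z : ℂ) = Complex.exp (-(2 * I * (⟪η, K m z⟫_ℂ).im))) :
    (∃ U : H ≃ₗᵢ[ℂ] H, ∀ a x, U (π a x) = π₀ a (U x)) ∧
      ∀ a, π a = weyl e η * π₀ a * star (weyl e η) := by
  have h1 : ∀ a x, weyl e η (π₀ a x) = π a (weyl e η x) := by
    intro a
    refine intertwines_of_mem_closure_adjoin π₀ π (he.weylIso η) (S := Set.range W) ?_ a ?_
    · rintro _ ⟨z, rfl⟩ x
      rw [he.weylIso_apply, he.weylIso_apply, h, h0, he.weyl_apply_weyl_apply, ← hη]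
      rfl
    · rw [hW.generates]
      trivial
  refine ⟨⟨(he.weylIso η).symm, fun a x => ?_⟩, fun a => ?_⟩
  · obtain ⟨y, rfl⟩ := (he.weylIso η).surjective x
    rw [LinearIsometryEquiv.symm_apply_apply, he.weylIso_apply, ← h1, ← he.weylIso_apply,
      LinearIsometryEquiv.symm_apply_apply]
  · have h2 : weyl e η * π₀ a = π a * weyl e η := ContinuousLinearMap.ext (h1 a)
    rw [h2, mul_assoc, he.star_weyl, he.weyl_mul_neg, mul_one]

theorem IsExponential.isGNSTriple [PartialOrder 𝔄] [StarOrderedRing 𝔄] (he : IsExponential e)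
    (hm : 0 < m) {π : 𝔄 →⋆ₐ[ℂ] (H →L[ℂ] H)} {χ : CauchyData → Circle}
    (h : ∀ z, π (W z) = (χ z : ℂ) • weyl e (K m z)) :
    IsGNSTriple (vectorFunctional π (e 0)) π (e 0) where
  expectation _ := rfl
  cyclic := by
    let g : 𝔄 →ₗ[ℂ] H :=
      (ContinuousLinearMap.apply ℂ H (e 0)).toLinearMap ∘ₗ π.toAlgHom.toLinearMap
    have hg : (LinearMap.range g : Set H) = Set.range fun a => π a (e 0) := rfl
    rw [← hg]
    -- `W z` sends the vacuum to a nonzero multiple of `e (-K m z)`; the sign explains the preimage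
    -- under negation, and density of these arguments suffices for cyclicity.
    refine he.dense_of_dense ((dense_range_K hm).preimage (Homeomorph.neg OneParticle).isOpenMap)
      _ ?_
    rintro φ ⟨z, hz⟩
    have hz' : K m z = -φ := hz
    have h1 : g (W z) = ((χ z : ℂ) * Complex.exp (-(⟪φ, φ⟫_ℂ / 2))) • e φ := by
      change π (W z) (e 0) = _
      rw [h, smul_apply, he.weyl_coherent, hz', smul_smul, inner_zero_right, inner_neg_neg,
        zero_sub, zero_sub, neg_neg]
    have h2 : ((χ z : ℂ) * Complex.exp (-(⟪φ, φ⟫_ℂ / 2))) ≠ 0 :=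
      mul_ne_zero (Circle.coe_ne_zero _) (Complex.exp_ne_zero _)
    rw [← Submodule.smul_mem_iff _ h2, ← h1]
    exact LinearMap.mem_range_self g _

/-- All claims are proved for an arbitrary total exponential family, with the vacuum `e 0`; no
feature of Fock space beyond `IsExponential` enters. -/
theorem IsExponential.exists_vacuum_representation [PartialOrder 𝔄] [StarOrderedRing 𝔄]
    [Nontrivial 𝔄] (he : IsExponential e) (hm : 0 < m) (hW : IsWeylAlgebra symp W) :
    ∃ (ω₀ : 𝔄 →ₚ[ℂ] ℂ) (α : AddChar CauchyData Circle → (𝔄 ≃⋆ₐ[ℂ] 𝔄))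
      (ω : AddChar CauchyData Circle → (𝔄 →ₚ[ℂ] ℂ))
      (π₀ : 𝔄 →⋆ₐ[ℂ] (H →L[ℂ] H))
      (π : AddChar CauchyData Circle → 𝔄 →⋆ₐ[ℂ] (H →L[ℂ] H)),
      (∀ z, ω₀ (W z) = Complex.exp (-(inner ℂ (K m z) (K m z) / 2))) ∧
      (∀ z, π₀ (W z) = weyl e (K m z)) ∧
      IsGNSTriple ω₀ π₀ (e 0) ∧
      (∀ χ z, α χ (W z) = (χ z : ℂ) • W z) ∧
      (∀ χ a, ω χ a = ω₀ (α χ a)) ∧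
      (∀ χ z, π χ (W z) = (χ z : ℂ) • π₀ (W z)) ∧
      (∀ χ, IsGNSTriple (ω χ) (π χ) (e 0)) ∧
      (∀ χ₁ χ₂ I, IsProperInterval I →
        ((∃ U : H ≃ₗᵢ[ℂ] H, ∀ a ∈ localAlgebra W I, ∀ x, U (π χ₁ a x) = π χ₂ a (U x)) ↔
          MuContinuousOn m (quotChar χ₁ χ₂) (localData I))) ∧
      (∀ χ₁ χ₂, UnitarilyEquivalent (ω χ₁) (ω χ₂) ↔
        MuContinuousOn m (quotChar χ₁ χ₂) Set.univ) ∧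
      (∀ (f : S1 → ℝ) (hf : MemLp f 2 volume),
        UnitarilyEquivalent (ω (charLower f hf)) ω₀ ∧
        ∀ a, π (charLower f hf) a =
          weyl e ((I * ((Real.sqrt 2)⁻¹ : ℂ)) • powA m (-(1 / 4)) (toL2 f hf)) * π₀ a *
            star (weyl e ((I * ((Real.sqrt 2)⁻¹ : ℂ)) • powA m (-(1 / 4)) (toL2 f hf)))) ∧
      (∀ (g : S1 → ℝ) (hg : MemLp g 2 volume), toL2 g hg ∈ domA m (1 / 4) →
        UnitarilyEquivalent (ω (charUpper g hg)) ω₀ ∧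
        ∀ a, π (charUpper g hg) a =
          weyl e (((Real.sqrt 2)⁻¹ : ℂ) • powA m (1 / 4) (toL2 g hg)) * π₀ a *
            star (weyl e (((Real.sqrt 2)⁻¹ : ℂ) • powA m (1 / 4) (toL2 g hg)))) ∧
      (∀ χ₁ χ₂, UnitarilyEquivalent (ω χ₁) (ω χ₂) ↔
        LocallyUnitarilyEquivalent W (ω χ₁) (ω χ₂)) := by
  obtain ⟨π₀, h0⟩ := IsWeylAlgebra.exists_starAlgHom sympLin_isAlt sympLin_nondegenerate hW
    (he.isWeylSystem_weyl_K hm)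
  choose α hα using IsWeylAlgebra.exists_gauge sympLin_isAlt sympLin_nondegenerate hW
  set π : AddChar CauchyData Circle → 𝔄 →⋆ₐ[ℂ] (H →L[ℂ] H) := fun χ =>
    π₀.comp (α χ : 𝔄 →⋆ₐ[ℂ] 𝔄) with hπ_def
  have hπ : ∀ χ z, π χ (W z) = (χ z : ℂ) • π₀ (W z) := fun χ z => by
    change π₀ (α χ (W z)) = _
    rw [hα, map_smul]
  have hπ' : ∀ χ z, π χ (W z) = (χ z : ℂ) • weyl e (K m z) := fun χ z => by rw [hπ, h0]
  have hG0 : IsGNSTriple (vectorFunctional π₀ (e 0)) π₀ (e 0) :=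
    he.isGNSTriple hm (χ := 1) fun z => by rw [h0, Pi.one_apply, Circle.coe_one, one_smul]
  have hG : ∀ χ, IsGNSTriple (vectorFunctional (π χ) (e 0)) (π χ) (e 0) := fun χ =>
    he.isGNSTriple hm (hπ' χ)
  have hloc : ∀ χ₁ χ₂ I,
      (∃ U : H ≃ₗᵢ[ℂ] H, ∀ a ∈ localAlgebra W I, ∀ x, U (π χ₁ a x) = π χ₂ a (U x)) ↔
        MuContinuousOn m (quotChar χ₁ χ₂) (localData I) := fun χ₁ χ₂ I =>
    he.exists_intertwiner_iff_muContinuousOn hm (hπ' χ₁) (hπ' χ₂) (localSubmodule I)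
  have hglob : ∀ χ₁ χ₂, UnitarilyEquivalent (vectorFunctional (π χ₁) (e 0))
      (vectorFunctional (π χ₂) (e 0)) ↔ MuContinuousOn m (quotChar χ₁ χ₂) Set.univ := by
    intro χ₁ χ₂
    -- The global statement is the case of all Cauchy data, whose Weyl elements generate the whole
    -- algebra.
    have h := he.exists_intertwiner_iff_muContinuousOn hm (hπ' χ₁) (hπ' χ₂) ⊤
    rw [Submodule.top_coe, Set.image_univ, hW.generates] at h
    rw [UnitarilyEquivalent, unitarilyEquivalentOn_iff (hG χ₁) (hG χ₂), ← h]
    exact Iff.rfl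
  refine ⟨vectorFunctional π₀ (e 0), α, fun χ => vectorFunctional (π χ) (e 0), π₀, π, fun z => ?_,
    h0, hG0, hα, fun χ a => rfl, hπ, hG, fun χ₁ χ₂ I _ => hloc χ₁ χ₂ I, hglob, fun f hf => ?_,
    fun g hg hdom => ?_, fun χ₁ χ₂ => ⟨fun ⟨U, hU⟩ I _ => ⟨U, fun a _ => hU a trivial⟩,
      fun h => (hglob χ₁ χ₂).2 (muContinuousOn_univ_of_local hm fun I hI => ?_)⟩⟩
  · rw [vectorFunctional_apply, h0, he.weyl_coherent, inner_smul_right, he.inner_eq,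
      inner_zero_left, inner_zero_right, Complex.exp_zero, mul_one, zero_sub]
  · obtain ⟨⟨U, hU⟩, h⟩ := he.implemented_of_character hW h0 (hπ (charLower f hf))
      (η := (I * ((Real.sqrt 2)⁻¹ : ℂ)) • powA m (-(1 / 4)) (toL2 f hf)) fun z => by
        rw [inner_lower_K_im hm]
        change ((Circle.exp _ : Circle) : ℂ) = _
        rw [Circle.coe_exp]
        congr 1
        push_cast
        ring
    exact ⟨(unitarilyEquivalentOn_iff (hG _) hG0 _).2 ⟨U, fun a _ => hU a⟩, h⟩
  · obtain ⟨⟨U, hU⟩, h⟩ := he.implemented_of_character hW h0 (hπ (charUpper g hg))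
      (η := ((Real.sqrt 2)⁻¹ : ℂ) • powA m (1 / 4) (toL2 g hg)) fun z => by
        rw [inner_upper_K_im hm g hg hdom]
        change ((Circle.exp _ : Circle) : ℂ) = _
        rw [Circle.coe_exp]
        congr 1
        push_cast
        ring
    exact ⟨(unitarilyEquivalentOn_iff (hG _) hG0 _).2 ⟨U, fun a _ => hU a⟩, h⟩
  · exact (hloc χ₁ χ₂ I).1 ((unitarilyEquivalentOn_iff (hG χ₁) (hG χ₂) _).1 (h I hI))

end Vacuum

end KGCircle

/-! ### Transfer to the Fock space -/

theorem mainTheorem9 (m : ℝ) (hm : 0 < m) {𝔄 : Type*} [CStarAlgebra 𝔄] [PartialOrder 𝔄]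
    [StarOrderedRing 𝔄] [Nontrivial 𝔄] (W : KGCircle.CauchyData → 𝔄)
    (hW : KGCircle.IsWeylAlgebra KGCircle.symp W) :
    ∃ (ω₀ : 𝔄 →ₚ[ℂ] ℂ) (α : AddChar KGCircle.CauchyData Circle → (𝔄 ≃⋆ₐ[ℂ] 𝔄))
      (ω : AddChar KGCircle.CauchyData Circle → (𝔄 →ₚ[ℂ] ℂ))
      (π₀ : 𝔄 →⋆ₐ[ℂ] (KGCircle.Fock →L[ℂ] KGCircle.Fock))
      (π : AddChar KGCircle.CauchyData Circle → 𝔄 →⋆ₐ[ℂ] (KGCircle.Fock →L[ℂ] KGCircle.Fock)),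
      -- the vacuum state and its GNS triple, the automorphisms, states and GNS triples of characters
      (∀ z, ω₀ (W z) = Complex.exp (-(inner ℂ (KGCircle.K m z) (KGCircle.K m z) / 2))) ∧
      (∀ z, π₀ (W z) = KGCircle.weylOp (KGCircle.K m z)) ∧
      KGCircle.IsGNSTriple ω₀ π₀ KGCircle.vacuum ∧
      (∀ χ z, α χ (W z) = (χ z : ℂ) • W z) ∧
      (∀ χ a, ω χ a = ω₀ (α χ a)) ∧
      (∀ χ z, π χ (W z) = (χ z : ℂ) • π₀ (W z)) ∧
      (∀ χ, KGCircle.IsGNSTriple (ω χ) (π χ) KGCircle.vacuum) ∧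
      -- (a)
      (∀ χ₁ χ₂ I, KGCircle.IsProperInterval I →
        ((∃ U : KGCircle.Fock ≃ₗᵢ[ℂ] KGCircle.Fock,
            ∀ a ∈ KGCircle.localAlgebra W I, ∀ x, U (π χ₁ a x) = π χ₂ a (U x)) ↔
          KGCircle.MuContinuousOn m (KGCircle.quotChar χ₁ χ₂) (KGCircle.localData I))) ∧
      -- (b)
      (∀ χ₁ χ₂, KGCircle.UnitarilyEquivalent (ω χ₁) (ω χ₂) ↔
        KGCircle.MuContinuousOn m (KGCircle.quotChar χ₁ χ₂) Set.univ) ∧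
      -- (c)
      (∀ (f : KGCircle.S1 → ℝ) (hf : MeasureTheory.MemLp f 2 MeasureTheory.volume),
        KGCircle.UnitarilyEquivalent (ω (KGCircle.charLower f hf)) ω₀ ∧
        ∀ a, π (KGCircle.charLower f hf) a =
          KGCircle.weylOp ((Complex.I * ((Real.sqrt 2)⁻¹ : ℂ)) •
              KGCircle.powA m (-(1 / 4)) (KGCircle.toL2 f hf)) * π₀ a *
            star (KGCircle.weylOp ((Complex.I * ((Real.sqrt 2)⁻¹ : ℂ)) •
              KGCircle.powA m (-(1 / 4)) (KGCircle.toL2 f hf)))) ∧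
      (∀ (g : KGCircle.S1 → ℝ) (hg : MeasureTheory.MemLp g 2 MeasureTheory.volume),
        KGCircle.toL2 g hg ∈ KGCircle.domA m (1 / 4) →
        KGCircle.UnitarilyEquivalent (ω (KGCircle.charUpper g hg)) ω₀ ∧
        ∀ a, π (KGCircle.charUpper g hg) a =
          KGCircle.weylOp (((Real.sqrt 2)⁻¹ : ℂ) •
              KGCircle.powA m (1 / 4) (KGCircle.toL2 g hg)) * π₀ a *
            star (KGCircle.weylOp (((Real.sqrt 2)⁻¹ : ℂ) •
              KGCircle.powA m (1 / 4) (KGCircle.toL2 g hg)))) ∧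
      -- (d)
      (∀ χ₁ χ₂, KGCircle.UnitarilyEquivalent (ω χ₁) (ω χ₂) ↔
        KGCircle.LocallyUnitarilyEquivalent W (ω χ₁) (ω χ₂)) := by
  have h := KGCircle.isExponential_coherent.exists_vacuum_representation hm hW
  -- Here the operators defined on coherent vectors become the exponentials of the closed field
  -- operators, and `e 0` becomes the vacuum.
  simp only [← KGCircle.weylOp_eq, KGCircle.coherent_zero] at h
  exact h
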